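/- Let $R$ be a commutative $\mathbb{Q}$-algebra with commuting derivations $\partial_{t_1},\partial_{t_2},\dots$ (functions of the KP times $\mathfrak t=(t_1=x,t_2,\dots)$; $\partial=\partial_x$), and let $R$ also carry a Hausdorff ring topology, in which infinite sums are understood (as unconditional sums). Let $\mathfrak D=1+w_1\partial^{-1}+\cdots$ and $\mathfrak L=\mathfrak D\partial\mathfrak D^{-1}$ be the dressing and Lax operators of a solution of the KP hierarchy with coefficients in $R$, i.e. $\mathfrak D_{t_n}=-(\mathfrak L^n)_{-}\mathfrak D$ for $n\ge1$. Let $\psi=\mathfrak D(e^{\eta})$ and $\psi^*=(\mathfrak D^{-1})^*(e^{-\eta})$, $\eta=\sum_i t_i\lambda^i$, be the wave functions, and let $\tau_{\rm KP}\in R^\times$ be a tau function, i.e. $\psi=\dfrac{\tau_{\rm KP}(t_1-\lambda^{-1},t_2-\lambda^{-2}/2,\dots)}{\tau_{\rm KP}(\mathfrak t)}e^{\eta}$. Eigenfunctions $f$ and adjoint eigenfunctions $g$ satisfy $f_{t_n}=(\mathfrak L^n)_{\ge0}(f)$ and $g_{t_n}=-\big((\mathfrak L^n)_{\ge0}\big)^*(g)$.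 A squared eigenfunction potential (SEP) $\Omega(f,g)$ for $\mathfrak L$ is any element with $\Omega_x=fg$ and $\Omega_{t_n}={\rm Res}_\partial\big(\partial^{-1}g(\mathfrak L^n)_{\ge0}f\partial^{-1}\big)$; it is determined up to an additive constant. Fix an arbitrary family of eigenfunctions $q'$ containing an invertible $q$, an arbitrary family of adjoint eigenfunctions $r'$ containing $r$, and a choice of $\Omega(q',r')$ in $R$ for all pairs. *Squared eigenfunction symmetry.* $\partial^*=\partial^*_{q,r}$ acts by $$\partial^*\mathfrak L=[q\partial^{-1}r,\mathfrak L],\quad \partial^*\mathfrak D=q\partial^{-1}r\,\mathfrak D,\quad \partial^*q'=q\,\Omega(q',r),\quad \partial^*r'=r\,\Omega(q,r'),$$ $$\partial^*\psi=q\,\partial^{-1}(r\psi),\quad \partial^*\psi^*=r\,\partial^{-1}(q\psi^*),\quad \partial^*\Omega(q',r')=\Omega(q,r')\,\Omega(q',r),\quad \partial^*\tau_{\rm KP}=-\Omega(q,r)\,\tau_{\rm KP}$$ (also for $q'=q$, $r'=r$). For $\mathfrak N$ any of the objects $\mathfrak L,\mathfrak D,q',r',\psi,\psi^*,\Omega(q',r'),\tau_{\rm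 KP}$, let $e^{s\partial^*}\mathfrak N=\sum_m \frac{s^m}{m!}(\partial^*)^m\mathfrak N$ be the integral curve of this flow through $\mathfrak N$, a formal power series in $s$, and let $e^{\partial^*}\mathfrak N$ be the sum of its coefficients (taken coefficientwise for operators and wave functions) when it converges. *Binary Darboux transformation.* $T(q,r)=T_I(r^{(1)})T_D(q)$, where $T_D(q)=q\partial q^{-1}$, $T_I(r)=r^{-1}\partial^{-1}r$ and $r^{(1)}=-q^{-1}\widetilde\Omega(q,r)$ is the image of $r$ under $T_D(q)$, formed with an SEP $\widetilde\Omega(q,r)$. With $T=T(q,r)$ the transformed objects are $$\mathfrak L^{[1]}=T\mathfrak LT^{-1},\quad \mathfrak D^{[1]}=T\mathfrak D,\quad \psi^{[1]}=T(\psi),\quad \psi^{*[1]}=(T^{-1})^*(\psi^*);$$ $q'^{[1]}=T_I(r^{(1)})(q'^{(1)})=(r^{(1)})^{-1}\Omega(q'^{(1)},r^{(1)})$ with $q'^{(1)}=q\,\partial_x(q^{-1}q')$ and an SEP for $\mathfrak L^{(1)}=T_D(q)\mathfrak LT_D(q)^{-1}$; $r'^{[1]}=(T_I(r^{(1)})^{-1})^*(r'^{(1)})=-r^{(1)}\partial_x\big((r^{(1)})^{-1}r'^{(1)}\big)$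 with $r'^{(1)}=-q^{-1}\Omega(q,r')$; $\Omega(q',r')^{[1]}$ is an SEP of $q'^{[1]},r'^{[1]}$ for $\mathfrak L^{[1]}$; and $\tau_{\rm KP}^{[1]}$ is a tau function for $\psi^{[1]}$. **Proposition.** The integral curve $e^{s\partial^*}\mathfrak N$ exists and is unique. If the exponential series converge, then, with the SEP constant chosen as $\widetilde\Omega(q,r)=\Omega(q,r)-1$ in $T(q,r)$, the function $r^{(1)}$ is invertible and $$\mathfrak N^{[1]}=e^{\partial^*_{q,r}}\mathfrak N,\qquad \mathfrak N\in\{\mathfrak L,\mathfrak D,q',r',\psi,\psi^*,\Omega(q',r'),\tau_{\rm KP}\},$$ where for $q'$ and $\Omega(q',r')$ this means equality for a suitable choice of the additive constants in the SEPs $\Omega(q'^{(1)},r^{(1)})$ and $\Omega(q'^{[1]},r'^{[1]})$, and for $\tau_{\rm KP}$ that $e^{\partial^*_{q,r}}\tau_{\rm KP}$ is a tau function for $\psi^{[1]}$. The exponential series do converge as soon as $\sum_m m^k\,\Omega(q,r)^m$ converges in $R$ for every $k\ge0$ (for instance for formal power series in $\mathfrak t$ when $\Omega(q,r)$ has no constant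 term). -/

import Mathlib

open scoped PowerSeries

noncomputable section

namespace KP

/-- A differential algebra of functions of the KP times: a commutative algebra with commuting
derivations `∂/∂t₁, ∂/∂t₂, …`. The space variable is `x = t₁`. -/
class TimeAlgebra (R : Type*) [CommRing R] [Algebra ℚ R] where
  /-- `dt n` is the derivation `∂/∂tₙ`. -/
  dt : ℕ+ → Derivation ℚ R R
  dt_comm : ∀ (m n : ℕ+) (f : R), dt m (dt n f) = dt n (dt m f)

open TimeAlgebra (dt)

/-- The derivation `∂ = ∂/∂x = ∂/∂t₁`. -/
def dx {R : Type*} [CommRing R] [Algebra ℚ R] [TimeAlgebra R] : Derivation ℚ R R := dt 1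

/-- A derivation of `R` extended to `R⟦s⟧` coefficientwise (so that `s` is a constant). -/
def coeffwise {R : Type*} [CommRing R] [Algebra ℚ R] (d : Derivation ℚ R R) :
    Derivation ℚ R⟦X⟧ R⟦X⟧ :=
  Derivation.mk'
    { toFun := fun f => PowerSeries.mk fun m => d (PowerSeries.coeff m f)
      map_add' := fun f g => by ext m; simp
      map_smul' := fun c f => by ext m; simp }
    (fun f g => by
      ext m
      simp only [LinearMap.coe_mk, AddHom.coe_mk, PowerSeries.coeff_mk, PowerSeries.coeff_mul,
        map_sum, Derivation.leibniz, smul_eq_mul, map_add, Finset.sum_add_distrib]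
      congr 1
      exact (Finset.Nat.sum_antidiagonal_swap (n := m)
        (f := fun p => PowerSeries.coeff p.1 g * d (PowerSeries.coeff p.2 f))))

/-- Functions of the KP times that are formal power series in one more variable `s`. -/
instance {R : Type*} [CommRing R] [Algebra ℚ R] [TimeAlgebra R] : TimeAlgebra R⟦X⟧ where
  dt n := coeffwise (dt n)
  dt_comm m n f := by
    ext k
    simp [coeffwise, TimeAlgebra.dt_comm]

/-! ### Pseudo-differential operators -/

/-- A pseudo-differential operator `∑_{k ≤ N} aₖ ∂ᵏ`, where `aₖ = coeff k`. -/
@[ext] structure PDO (R : Type*) [CommRing R] where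
  coeff : ℤ → R
  bdd : ∃ N : ℤ, ∀ k, N < k → coeff k = 0

namespace PDO

section Additive

variable {R : Type*} [CommRing R]

/-- The operator `a ∂ⁿ`. -/
def monomial (n : ℤ) (a : R) : PDO R where
  coeff k := if k = n then a else 0
  bdd := ⟨n, fun k hk => if_neg (by omega)⟩

/-- The operator of multiplication by the function `a`. -/
def C (a : R) : PDO R := monomial 0 a

/-- `∂ⁿ`, for an integer `n`. -/
def D (n : ℤ) : PDO R := monomial n 1

instance : One (PDO R) := ⟨C 1⟩

instance : Neg (PDO R) where
  neg A :=
    { coeff := fun k => -A.coeff k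
      bdd := by
        obtain ⟨N, hN⟩ := A.bdd
        exact ⟨N, fun k hk => by simp [hN k hk]⟩ }

instance : Sub (PDO R) where
  sub A B :=
    { coeff := fun k => A.coeff k - B.coeff k
      bdd := by
        obtain ⟨N, hN⟩ := A.bdd
        obtain ⟨M, hM⟩ := B.bdd
        exact ⟨max N M, fun k hk => by simp [hN k (by omega), hM k (by omega)]⟩ }

/-- The part `A_{≥ 0}`, a differential operator. -/
def pos (A : PDO R) : PDO R where
  coeff k := if 0 ≤ k then A.coeff k else 0
  bdd := by
    obtain ⟨N, hN⟩ := A.bdd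
    exact ⟨N, fun k hk => by simp [hN k hk]⟩

/-- The part `A_- = A_{< 0}`. -/
def neg (A : PDO R) : PDO R where
  coeff k := if k < 0 then A.coeff k else 0
  bdd := ⟨0, fun k hk => if_neg (by omega)⟩

/-- `Res_∂ ∑ aₖ ∂ᵏ = a_{-1}`. -/
def res (A : PDO R) : R := A.coeff (-1)

/-- Apply an additive map to all the coefficients. -/
def map {S : Type*} [CommRing S] (φ : R →+ S) (A : PDO R) : PDO S where
  coeff k := φ (A.coeff k)
  bdd := by
    obtain ⟨N, hN⟩ := A.bdd
    exact ⟨N, fun k hk => by simp [hN k hk]⟩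

end Additive

variable {R : Type*} [CommRing R] [Algebra ℚ R] [TimeAlgebra R]

/-- The composition of operators, by the Leibniz rule
`a ∂ⁱ ∘ b ∂ʲ = ∑_{l ≥ 0} (i choose l) a b^{(l)} ∂^{i+j-l}`. The coefficient of `∂ᵏ` is the sum over
`(i, l)` with `j = k - i + l`, and has only finitely many non-zero terms. -/
instance : Mul (PDO R) where
  mul A B :=
    { coeff := fun k => ∑ᶠ p : ℤ × ℕ,
        A.coeff p.1 * (Ring.choose p.1 p.2 • dx^[p.2] (B.coeff (k - p.1 + p.2)))
      bdd := by
        obtain ⟨N, hN⟩ := A.bdd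
        obtain ⟨M, hM⟩ := B.bdd
        refine ⟨N + M, fun k hk => finsum_eq_zero_of_forall_eq_zero fun p => ?_⟩
        by_cases h : N < p.1
        · rw [hN _ h, zero_mul]
        · rw [hM _ (by omega), iterate_map_zero, smul_zero, mul_zero] }

instance : Pow (PDO R) ℕ := ⟨fun A n => npowRec n A⟩

/-- The formal adjoint `(∑ aⱼ ∂ʲ)^* = ∑ (-∂)ʲ aⱼ`. -/
def adjoint (A : PDO R) : PDO R where
  coeff k := ∑ᶠ l : ℕ, (((-1 : ℤˣ) ^ (k + l) : ℤˣ) : ℤ) •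
    Ring.choose (k + l) l • dx^[l] (A.coeff (k + l))
  bdd := by
    obtain ⟨N, hN⟩ := A.bdd
    refine ⟨N, fun k hk => finsum_eq_zero_of_forall_eq_zero fun l => ?_⟩
    rw [hN _ (by omega), iterate_map_zero, smul_zero, smul_zero]

/-- The value `A_{≥ 0}(f) = ∑_{i ≥ 0} aᵢ f^{(i)}` of the differential operator `A_{≥ 0}` at the
function `f`. -/
def posApply (A : PDO R) (f : R) : R := ∑ᶠ i : ℕ, A.coeff i * dx^[i] f

end PDO

/-! ### Oscillating functions -/

/-- A formal oscillating function `(∑_{k ≤ N} fₖ λᵏ) e^{ε η(t, λ)}` with `fₖ = coeff k`, where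
`η(t, λ) = ∑ tᵢ λⁱ` and `ε = ±1`. -/
@[ext] structure Osc (ε : ℤˣ) (R : Type*) [CommRing R] where
  coeff : ℤ → R
  bdd : ∃ N : ℤ, ∀ k, N < k → coeff k = 0

namespace Osc

section Additive

variable {ε : ℤˣ} {R : Type*} [CommRing R]

/-- `A(e^{ε η})`, computed from `∂ᵏ(e^{ε η}) = (ε λ)ᵏ e^{ε η}` for all integers `k`. -/
def ofPDO (ε : ℤˣ) (A : PDO R) : Osc ε R where
  coeff k := ((ε ^ k : ℤˣ) : ℤ) • A.coeff k
  bdd := by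
    obtain ⟨N, hN⟩ := A.bdd
    exact ⟨N, fun k hk => by simp [hN k hk]⟩

/-- The operator `A` with `A(e^{ε η}) = f`. -/
def toPDO (f : Osc ε R) : PDO R where
  coeff k := ((ε ^ k : ℤˣ) : ℤ) • f.coeff k
  bdd := by
    obtain ⟨N, hN⟩ := f.bdd
    exact ⟨N, fun k hk => by simp [hN k hk]⟩

/-- Apply an additive map to all the coefficients. -/
def map {S : Type*} [CommRing S] (φ : R →+ S) (f : Osc ε R) : Osc ε S where
  coeff k := φ (f.coeff k)
  bdd := by
    obtain ⟨N, hN⟩ := f.bdd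
    exact ⟨N, fun k hk => by simp [hN k hk]⟩

end Additive

/-- The action of a pseudo-differential operator on an oscillating function:
`B(A(e^{ε η})) = (B A)(e^{ε η})`. -/
def act {ε : ℤˣ} {R : Type*} [CommRing R] [Algebra ℚ R] [TimeAlgebra R]
    (B : PDO R) (f : Osc ε R) : Osc ε R :=
  ofPDO ε (B * f.toPDO)

end Osc

/-! ### The KP hierarchy -/

section Hierarchy

variable {R : Type*} [CommRing R] [Algebra ℚ R] [TimeAlgebra R]

/-- `f` is an eigenfunction of the Lax operator `L`: `f_{tₙ} = (Lⁿ)_{≥ 0}(f)`. -/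
def IsEigenfunction (L : PDO R) (f : R) : Prop :=
  ∀ n : ℕ+, dt n f = (L ^ (n : ℕ)).posApply f

/-- `g` is an adjoint eigenfunction of `L`: `g_{tₙ} = -((Lⁿ)_{≥ 0})^*(g)`. -/
def IsAdjointEigenfunction (L : PDO R) (g : R) : Prop :=
  ∀ n : ℕ+, dt n g = -((L ^ (n : ℕ)).pos.adjoint.posApply g)

/-- `ω` is a squared eigenfunction potential `Ω(f, g)`: `ω_x = f g` and
`ω_{tₙ} = Res_∂ (∂⁻¹ g (Lⁿ)_{≥ 0} f ∂⁻¹)`. -/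
def IsSEP (L : PDO R) (f g ω : R) : Prop :=
  dx ω = f * g ∧
  ∀ n : ℕ+, dt n ω =
    (PDO.D (-1) * PDO.C g * (L ^ (n : ℕ)).pos * PDO.C f * PDO.D (-1)).res

/-- `miwa f k` is the coefficient of `λ^{-k}` in
`f(t₁ - λ⁻¹, t₂ - λ⁻²/2, t₃ - λ⁻³/3, …) = exp(-∑_{j ≥ 1} λ^{-j} j⁻¹ ∂/∂tⱼ) f`. Differentiating the
exponential with respect to `λ⁻¹` gives
`(k + 1) · miwa f (k + 1) = -∑_{j=0}^{k} ∂/∂t_{j+1} (miwa f (k - j))`. -/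
def miwa (f : R) : ℕ → R
  | 0 => f
  | k + 1 => -(((k + 1 : ℚ)⁻¹) • ∑ j : Fin (k + 1), dt (Nat.succPNat j) (miwa f (k - j)))

/-- `τ` is a tau function of the hierarchy with wave function `ψ`:
`ψ(t, λ) = τ(t₁ - λ⁻¹, t₂ - λ⁻²/2, …) / τ(t) · e^{η(t, λ)}`. -/
def IsTau (ψ : Osc 1 R) (τ : R) : Prop :=
  IsUnit τ ∧ (∀ k : ℕ, τ * ψ.coeff (-k) = miwa τ k) ∧ ∀ k : ℤ, 0 < k → ψ.coeff k = 0

end Hierarchy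

/-- The objects attached to the KP hierarchy: Lax operator `L`, dressing operator `W`,
functions `f i`, `g j`, oscillating functions `ψ`, `ψs` (multiples of `e^{η}` and of `e^{-η}`),
functions `Ω i j`, and a function `τ`. -/
@[ext] structure Data (ι κ R : Type*) [CommRing R] where
  L : PDO R
  W : PDO R
  f : ι → R
  g : κ → R
  ψ : Osc 1 R
  ψs : Osc (-1) R
  Ω : ι → κ → R
  τ : R

section Main

variable {ι κ R : Type*} [CommRing R] [Algebra ℚ R] [TimeAlgebra R]

/-- `N` is a solution of the KP hierarchy with eigenfunctions `f i`, adjoint eigenfunctions `g j`,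
wave function `ψ`, adjoint wave function `ψs`, squared eigenfunction potentials
`Ω i j = Ω(f i, g j)` and tau function `τ`. -/
structure Data.IsSolution (N : Data ι κ R) : Prop where
  /-- `W = 1 + w₁ ∂⁻¹ + w₂ ∂⁻² + …` -/
  monic : N.W.coeff 0 = 1 ∧ ∀ k : ℤ, 0 < k → N.W.coeff k = 0
  /-- `L = W ∂ W⁻¹`, `ψs = (W⁻¹)^*(e^{-η})` and `W_{tₙ} = -(Lⁿ)_- W`; here `V = W⁻¹`. -/
  dressing : ∃ V : PDO R, N.W * V = 1 ∧ V * N.W = 1 ∧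
    N.L = N.W * PDO.D 1 * V ∧
    N.ψs = Osc.ofPDO (-1) V.adjoint ∧
    ∀ n : ℕ+, N.W.map (dt n).toLinearMap.toAddMonoidHom = -((N.L ^ (n : ℕ)).neg * N.W)
  wave : N.ψ = Osc.ofPDO 1 N.W
  eigen : ∀ i, IsEigenfunction N.L (N.f i)
  adjEigen : ∀ j, IsAdjointEigenfunction N.L (N.g j)
  sep : ∀ i j, IsSEP N.L (N.f i) (N.g j) (N.Ω i j)
  tau : IsTau N.ψ N.τ

/-! ### The squared eigenfunction symmetry and its exponential -/

/-- The derivation `d/ds` of `R⟦s⟧`, as an additive map. -/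
def ds : R⟦X⟧ →+ R⟦X⟧ := (PowerSeries.derivative R).toLinearMap.toAddMonoidHom

/-- The value at `s = 0`, as an additive map. -/
def atZero : R⟦X⟧ →+ R := (PowerSeries.constantCoeff (R := R)).toAddMonoidHom

/-- `F = e^{s ∂^*_{q,r}} N`, the integral curve through `N` of the squared eigenfunction symmetry
`∂^*_{q,r}` with `q = f i₀`, `r = g j₀`, as a formal power series in the flow parameter `s`.
The coefficient of `s^m` in `F` is `(∂^*_{q,r})^m N / m!`. -/
structure IsSymmetryFlow (i₀ : ι) (j₀ : κ) (N : Data ι κ R) (F : Data ι κ R⟦X⟧) : Prop where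
  init_L : F.L.map atZero = N.L
  init_W : F.W.map atZero = N.W
  init_f : ∀ i, atZero (F.f i) = N.f i
  init_g : ∀ j, atZero (F.g j) = N.g j
  init_ψ : F.ψ.map atZero = N.ψ
  init_ψs : F.ψs.map atZero = N.ψs
  init_Ω : ∀ i j, atZero (F.Ω i j) = N.Ω i j
  init_τ : atZero F.τ = N.τ
  /-- `∂^* L = [q ∂⁻¹ r, L]` -/
  flow_L : F.L.map ds =
    (PDO.C (F.f i₀) * PDO.D (-1) * PDO.C (F.g j₀)) * F.L -
      F.L * (PDO.C (F.f i₀) * PDO.D (-1) * PDO.C (F.g j₀))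
  /-- `∂^* W = q ∂⁻¹ r W` -/
  flow_W : F.W.map ds = (PDO.C (F.f i₀) * PDO.D (-1) * PDO.C (F.g j₀)) * F.W
  /-- `∂^* q' = q Ω(q', r)` -/
  flow_f : ∀ i, ds (F.f i) = F.f i₀ * F.Ω i j₀
  /-- `∂^* r' = r Ω(q, r')` -/
  flow_g : ∀ j, ds (F.g j) = F.g j₀ * F.Ω i₀ j
  /-- `∂^* ψ = q Ω(ψ, r)`, where `Ω(ψ, r) = ∂⁻¹(r ψ)` -/
  flow_ψ : F.ψ.map ds = Osc.act (PDO.C (F.f i₀) * PDO.D (-1) * PDO.C (F.g j₀)) F.ψ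
  /-- `∂^* ψs = r Ω(q, ψs)`, where `Ω(q, ψs) = ∂⁻¹(q ψs)` -/
  flow_ψs : F.ψs.map ds = Osc.act (PDO.C (F.g j₀) * PDO.D (-1) * PDO.C (F.f i₀)) F.ψs
  /-- `∂^* Ω(q', r') = Ω(q, r') Ω(q', r)` -/
  flow_Ω : ∀ i j, ds (F.Ω i j) = F.Ω i₀ j * F.Ω i j₀
  /-- `∂^* τ = -Ω(q, r) τ` -/
  flow_τ : ds F.τ = -(F.Ω i₀ j₀ * F.τ)

/-- The series `F` in `s` converges at `s = 1` to `a`. -/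
def SumsTo [TopologicalSpace R] (F : R⟦X⟧) (a : R) : Prop :=
  HasSum (fun m : ℕ => PowerSeries.coeff m F) a

/-- If `F = e^{s ∂^*} N`, this says that the series `e^{∂^*} N = ∑ (∂^*)^m N / m!` converges
(coefficientwise for operators and oscillating functions) to `N'`, that is, `N' = e^{∂^*} N`. -/
structure Data.SumsTo [TopologicalSpace R] (F : Data ι κ R⟦X⟧) (N' : Data ι κ R) : Prop where
  L : ∀ k, KP.SumsTo (F.L.coeff k) (N'.L.coeff k)
  W : ∀ k, KP.SumsTo (F.W.coeff k) (N'.W.coeff k)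
  f : ∀ i, KP.SumsTo (F.f i) (N'.f i)
  g : ∀ j, KP.SumsTo (F.g j) (N'.g j)
  ψ : ∀ k, KP.SumsTo (F.ψ.coeff k) (N'.ψ.coeff k)
  ψs : ∀ k, KP.SumsTo (F.ψs.coeff k) (N'.ψs.coeff k)
  Ω : ∀ i j, KP.SumsTo (F.Ω i j) (N'.Ω i j)
  τ : KP.SumsTo F.τ N'.τ

/-! ### Darboux transformations -/

/-- `T_D(q) = q ∂ q⁻¹` -/
def TD (q : R) : PDO R := PDO.C q * PDO.D 1 * PDO.C (Ring.inverse q)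

/-- `T_D(q)⁻¹ = q ∂⁻¹ q⁻¹` -/
def TDinv (q : R) : PDO R := PDO.C q * PDO.D (-1) * PDO.C (Ring.inverse q)

/-- `T_I(r) = r⁻¹ ∂⁻¹ r` -/
def TI (r : R) : PDO R := PDO.C (Ring.inverse r) * PDO.D (-1) * PDO.C r

/-- `T_I(r)⁻¹ = r⁻¹ ∂ r` -/
def TIinv (r : R) : PDO R := PDO.C (Ring.inverse r) * PDO.D 1 * PDO.C r

/-- The image `T_D(q)(f) = q ∂(q⁻¹ f)` of an eigenfunction `f` under `T_D(q)`. -/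
def TDeigen (q f : R) : R := q * dx (Ring.inverse q * f)

/-- The image `(T_D(q)⁻¹)^*(g) = -q⁻¹ ∂⁻¹(q g) = -q⁻¹ Ω(q, g)` of an adjoint eigenfunction `g`
under `T_D(q)`, where `ω = Ω(q, g)`. -/
def TDadj (q ω : R) : R := -(Ring.inverse q * ω)

/-- The image `T_I(r)(f) = r⁻¹ ∂⁻¹(r f) = r⁻¹ Ω(f, r)` of an eigenfunction `f` under `T_I(r)`,
where `ω = Ω(f, r)`. -/
def TIeigen (r ω : R) : R := Ring.inverse r * ω

/-- The image `(T_I(r)⁻¹)^*(g) = -r ∂(r⁻¹ g)` of an adjoint eigenfunction `g` under `T_I(r)`. -/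
def TIadj (r g : R) : R := -(r * dx (Ring.inverse r * g))

/-- `N'` is the transform `N^{[1]}` of `N` under the binary Darboux transformation
`T(q, r) = T_I(r^{(1)}) T_D(q)`, where `q = f i₀`, `r = g j₀` and `r^{(1)}` is the image of `r`
under `T_D(q)`, formed with the potential `ω = Ω(q, r)`. -/
structure IsBinaryDarboux (i₀ : ι) (j₀ : κ) (ω : R) (N N' : Data ι κ R) : Prop where
  sep : IsSEP N.L (N.f i₀) (N.g j₀) ω
  isUnit_q : IsUnit (N.f i₀)
  isUnit_r1 : IsUnit (TDadj (N.f i₀) ω)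
  /-- `L^{[1]} = T L T⁻¹` -/
  L : N'.L = (TI (TDadj (N.f i₀) ω) * TD (N.f i₀)) * N.L *
    (TDinv (N.f i₀) * TIinv (TDadj (N.f i₀) ω))
  /-- `W^{[1]} = T W` -/
  W : N'.W = (TI (TDadj (N.f i₀) ω) * TD (N.f i₀)) * N.W
  /-- `q'^{[1]} = T_I(r^{(1)})(q'^{(1)})` with `q'^{(1)} = T_D(q)(q')`; the potential `β` belongs to
  the Lax operator `L^{(1)} = T_D(q) L T_D(q)⁻¹`. -/
  f : ∀ i, ∃ β : R,
    IsSEP (TD (N.f i₀) * N.L * TDinv (N.f i₀)) (TDeigen (N.f i₀) (N.f i))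
      (TDadj (N.f i₀) ω) β ∧
    N'.f i = TIeigen (TDadj (N.f i₀) ω) β
  /-- `r'^{[1]}` is the image under `T_I(r^{(1)})` of the image `r'^{(1)}` of `r'` under
  `T_D(q)`. -/
  g : ∀ j, N'.g j = TIadj (TDadj (N.f i₀) ω) (TDadj (N.f i₀) (N.Ω i₀ j))
  /-- `ψ^{[1]} = T(ψ)` -/
  ψ : N'.ψ = Osc.act (TI (TDadj (N.f i₀) ω) * TD (N.f i₀)) N.ψ
  /-- `ψs^{[1]} = (T⁻¹)^*(ψs)` -/
  ψs : N'.ψs = Osc.act (TDinv (N.f i₀) * TIinv (TDadj (N.f i₀) ω)).adjoint N.ψs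
  /-- `Ω(q', r')^{[1]} = Ω(q'^{[1]}, r'^{[1]})`, a potential for `L^{[1]}` -/
  Ω : ∀ i j, IsSEP N'.L (N'.f i) (N'.g j) (N'.Ω i j)
  /-- `τ^{[1]}` is a tau function for `ψ^{[1]}`. -/
  τ : IsTau N'.ψ N'.τ

end Main

end KP

end

/-! The flow can be solved in closed form. Write `ω = Ω(q,r)`. Along the flow `ω` satisfies the
Riccati equation `ω' = ω²`, so with `v = 1/(1 - sω)` it becomes `ω v`. The equations for `q` and `r`
are then linear with solutions `q v` and `r v`, the potentials and functions move by a rank-one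
correction with coefficient `s v`, and `τ` becomes `τ (1 - sω)`. On operators the flow is left
multiplication by `G = 1 + s v q∂⁻¹r`, with inverse `H = 1 - q∂⁻¹r s v`. Everything about `G` and
`H` follows from `∂⁻¹ a' ∂⁻¹ = a∂⁻¹ - ∂⁻¹a` (`dressOp_mul_dressInv`, `sqOp_mul_dressOp`). Uniqueness
is `s`-adic: a solution of `d/ds` with zero initial value gains one order of vanishing at each
integration.

At `s = 1` one has `r⁽¹⁾ = q⁻¹(1 - ω)`, and moving `1 - ω` past `∂` shows that `T_I(r⁽¹⁾) T_D(q)` is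
exactly `G` (`TI_mul_TD`). It remains to sum the series. The series of `q` is `q ∑ ωᵐsᵐ` with `q`
invertible, so `∑ ωᵐ` converges, necessarily to `(1 - ω)⁻¹`. This handles everything except `L = G L
H`, where both factors depend on `s`; there both sides are first multiplied by `1 - ωs`, which
leaves a polynomial (`eq_of_sumsTo_conj`). The potentials are checked by residue computations
(`IsSEP.dress`, `IsSEP.elementaryDarboux`).

For the tau function, let `∇ = z d/dz + ∑ zⁿ ∂/∂tₙ` with `z = λ⁻¹`. Its kernel consists of the Miwa
shifts `f(t - [z])`. If `w` and `x` are the symbols of `W` and of `∂⁻¹rW`, then `∇` kills `ω - q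
x/w`, which is therefore the Miwa shift of `ω`. Multiplying `1 - (ω - q x/w)` by `τ w`, the Miwa
shift of `τ`, gives the Miwa shift of `τ(1 - ω)` on the one hand and `τ(1 - ω)` times the symbol of
`G W` on the other (`isTau_dressOp`).

Convergence under the summability hypothesis holds because all coefficients of the closed form are
polynomials in `s` times powers of `v`, and the coefficients of `vʲ` are polynomials in `m` times
`ωᵐ`. -/

set_option linter.unusedSectionVars false

noncomputable section

namespace KP

open TimeAlgebra (dt)
open Finset.HasAntidiagonal (antidiagonal mem_antidiagonal)

/-! ### The ring of pseudo-differential operators -/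

namespace PDO

section Additive

variable {R : Type*} [CommRing R]

instance : Zero (PDO R) := ⟨{ coeff := fun _ => 0, bdd := ⟨0, fun _ _ => rfl⟩ }⟩

instance : Add (PDO R) where
  add A B :=
    { coeff := fun k => A.coeff k + B.coeff k
      bdd := by
        obtain ⟨N, hN⟩ := A.bdd
        obtain ⟨M, hM⟩ := B.bdd
        exact ⟨max N M, fun k hk => by simp [hN k (by omega), hM k (by omega)]⟩ }

@[simp] theorem coeff_zero (k : ℤ) : (0 : PDO R).coeff k = 0 := rfl

@[simp] theorem coeff_add (A B : PDO R) (k : ℤ) : (A + B).coeff k = A.coeff k + B.coeff k := rfl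

@[simp] theorem coeff_neg (A : PDO R) (k : ℤ) : (-A).coeff k = -A.coeff k := rfl

@[simp] theorem coeff_sub (A B : PDO R) (k : ℤ) : (A - B).coeff k = A.coeff k - B.coeff k := rfl

instance : AddCommGroup (PDO R) where
  add_assoc A B E := by ext k; simp [add_assoc]
  zero_add A := by ext k; simp
  add_zero A := by ext k; simp
  add_comm A B := by ext k; simp [add_comm]
  neg_add_cancel A := by ext k; simp
  sub_eq_add_neg A B := by ext k; simp [sub_eq_add_neg]
  nsmul := nsmulRec
  zsmul := zsmulRec

/-- The coefficient of `∂ᵏ`, as an additive map. -/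
def coeffHom (k : ℤ) : PDO R →+ R where
  toFun A := A.coeff k
  map_zero' := rfl
  map_add' _ _ := rfl

theorem coeff_sum {α : Type*} (s : Finset α) (A : α → PDO R) (k : ℤ) :
    (∑ i ∈ s, A i).coeff k = ∑ i ∈ s, (A i).coeff k :=
  map_sum (coeffHom k) A s

/-- The operator has order at most `N`. -/
def OrdLE (A : PDO R) (N : ℤ) : Prop := ∀ k, N < k → A.coeff k = 0

theorem OrdLE.mono {A : PDO R} {N M : ℤ} (h : A.OrdLE N) (hNM : N ≤ M) : A.OrdLE M :=
  fun k hk => h k (by omega)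

theorem exists_ordLE (A : PDO R) : ∃ N, A.OrdLE N := A.bdd

theorem exists_ordLE₂ (A B : PDO R) : ∃ N, A.OrdLE N ∧ B.OrdLE N := by
  obtain ⟨N, hN⟩ := A.bdd
  obtain ⟨M, hM⟩ := B.bdd
  exact ⟨max N M, fun k hk => hN k (by omega), fun k hk => hM k (by omega)⟩

theorem coeff_monomial (n : ℤ) (a : R) (k : ℤ) :
    (monomial n a).coeff k = if k = n then a else 0 := rfl

theorem ordLE_monomial (n : ℤ) (a : R) : (monomial n a).OrdLE n :=
  fun _ hk => if_neg (by omega)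

@[simp] theorem coeff_pos (A : PDO R) (k : ℤ) :
    A.pos.coeff k = if 0 ≤ k then A.coeff k else 0 := rfl

@[simp] theorem coeff_negPart (A : PDO R) (k : ℤ) :
    A.neg.coeff k = if k < 0 then A.coeff k else 0 := rfl

@[simp] theorem coeff_map {S : Type*} [CommRing S] (φ : R →+ S) (A : PDO R) (k : ℤ) :
    (A.map φ).coeff k = φ (A.coeff k) := rfl

theorem pos_add_neg (A : PDO R) : A.pos + A.neg = A := by
  ext k
  by_cases h : k < 0
  · simp [h, not_le.mpr h]
  · simp [h, not_lt.mp h]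

/-- Finite sums of monomials. -/
def IsFinite (A : PDO R) : Prop :=
  A ∈ AddSubmonoid.closure {B : PDO R | ∃ n a, B = monomial n a}

/-- A given coefficient of a product sees only finitely many top coefficients of each factor, so
identities that are additive in each factor can be checked on finite sums after discarding a tail of
very low order. -/
theorem exists_isFinite_sub_ordLE (A : PDO R) (K : ℤ) :
    ∃ A' a : PDO R, A'.IsFinite ∧ a.OrdLE K ∧ A = A' + a := by
  obtain ⟨N, hN⟩ := A.bdd
  refine ⟨∑ i ∈ Finset.Icc (K + 1) N, monomial i (A.coeff i),
    { coeff := fun k => if k ≤ K then A.coeff k else 0, bdd := ⟨K, fun k hk => if_neg (by omega)⟩ },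
    AddSubmonoid.sum_mem _ fun i _ => AddSubmonoid.subset_closure ⟨_, _, rfl⟩,
    fun k hk => if_neg (by omega), ?_⟩
  ext k
  simp only [coeff_add, coeff_sum, coeff_monomial, Finset.sum_ite_eq, Finset.mem_Icc]
  split_ifs <;> first | omega | simp
  exact hN k (by omega)

end Additive

variable {R : Type*} [CommRing R] [Algebra ℚ R] [TimeAlgebra R]

theorem coeff_mul (A B : PDO R) (k : ℤ) : (A * B).coeff k = ∑ᶠ p : ℤ × ℕ,
    A.coeff p.1 * (Ring.choose p.1 p.2 • dx^[p.2] (B.coeff (k - p.1 + p.2))) := rfl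

/-- The index set depends only on the bounds `M` and `M'`, so products of different operators with
common bounds can be compared term by term. -/
theorem coeff_mul_eq_sum {A B : PDO R} {M M' : ℤ} (hA : A.OrdLE M) (hB : B.OrdLE M') (k : ℤ) :
    (A * B).coeff k = ∑ p ∈ Finset.Icc (k - M') M ×ˢ Finset.range (M + M' - k + 1).toNat,
      A.coeff p.1 * (Ring.choose p.1 p.2 • dx^[p.2] (B.coeff (k - p.1 + p.2))) := by
  rw [coeff_mul]
  refine finsum_eq_sum_of_support_subset _ fun p hp => ?_
  rw [Function.mem_support] at hp
  have h1 : p.1 ≤ M := by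
    by_contra h
    exact hp (by rw [hA _ (by omega), zero_mul])
  have h2 : k - p.1 + p.2 ≤ M' := by
    by_contra h
    exact hp (by rw [hB _ (by omega), iterate_map_zero, smul_zero, mul_zero])
  simp only [Finset.coe_product, Set.mem_prod, Finset.coe_Icc, Set.mem_Icc, Finset.coe_range,
    Set.mem_Iio]
  omega

theorem OrdLE.mul {A B : PDO R} {M M' : ℤ} (hA : A.OrdLE M) (hB : B.OrdLE M') :
    (A * B).OrdLE (M + M') := by
  intro k hk
  rw [coeff_mul_eq_sum hA hB, Finset.Icc_eq_empty (by omega), Finset.empty_product,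
    Finset.sum_empty]

theorem pdo_add_mul (A B E : PDO R) : (A + B) * E = A * E + B * E := by
  ext k
  obtain ⟨M, hA, hB⟩ := exists_ordLE₂ A B
  obtain ⟨M', hE⟩ := E.exists_ordLE
  have hAB : (A + B).OrdLE M := fun k hk => by simp [hA k hk, hB k hk]
  simp only [coeff_add, coeff_mul_eq_sum hAB hE, coeff_mul_eq_sum hA hE, coeff_mul_eq_sum hB hE,
    add_mul, Finset.sum_add_distrib]

theorem pdo_mul_add (A B E : PDO R) : A * (B + E) = A * B + A * E := by
  ext k
  obtain ⟨M, hB, hE⟩ := exists_ordLE₂ B E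
  obtain ⟨M', hA⟩ := A.exists_ordLE
  have hBE : (B + E).OrdLE M := fun k hk => by simp [hB k hk, hE k hk]
  simp only [coeff_add, coeff_mul_eq_sum hA hB, coeff_mul_eq_sum hA hE, coeff_mul_eq_sum hA hBE,
    iterate_map_add, smul_add, mul_add, Finset.sum_add_distrib]

theorem coeff_monomial_mul (i : ℤ) (a : R) {B : PDO R} {M : ℤ} (hB : B.OrdLE M) (n : ℕ) :
    (monomial i a * B).coeff (i + M - n) =
      ∑ l ∈ Finset.range (n + 1), a * (Ring.choose i l • dx^[l] (B.coeff (M - (n - l : ℤ)))) := by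
  rw [coeff_mul_eq_sum (ordLE_monomial i a) hB, Finset.sum_product,
    Finset.sum_eq_single_of_mem i (by simp only [Finset.mem_Icc]; omega)]
  · rw [show (i + M - (i + M - n) + 1 : ℤ).toNat = n + 1 by omega]
    refine Finset.sum_congr rfl fun l _ => ?_
    rw [coeff_monomial, if_pos rfl]
    rw [show i + M - (n : ℤ) - i + l = M - (n - l : ℤ) by ring]
  · intro j _ hj
    exact Finset.sum_eq_zero fun l _ => by rw [coeff_monomial, if_neg hj, zero_mul]

theorem coeff_mul_monomial (j : ℤ) (b : R) {A : PDO R} {M : ℤ} (hA : A.OrdLE M) (n : ℕ) :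
    (A * monomial j b).coeff (M + j - n) =
      ∑ l ∈ Finset.range (n + 1),
        A.coeff (M - (n - l : ℤ)) * (Ring.choose (M - (n - l : ℤ)) l • dx^[l] b) := by
  rw [coeff_mul_eq_sum hA (ordLE_monomial j b), Finset.sum_product_right,
    show (M + j - (M + j - n) + 1 : ℤ).toNat = n + 1 by omega]
  refine Finset.sum_congr rfl fun l hl => ?_
  rw [Finset.mem_range] at hl
  rw [Finset.sum_eq_single_of_mem (M - (n - l : ℤ)) (by simp only [Finset.mem_Icc]; omega)]
  · rw [coeff_monomial, if_pos (by ring)]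
  · intro p _ hp
    rw [coeff_monomial, if_neg (by omega), iterate_map_zero, smul_zero, mul_zero]

theorem coeff_monomial_mul_monomial (i j : ℤ) (a b : R) (n : ℕ) :
    (monomial i a * monomial j b).coeff (i + j - n) = a * (Ring.choose i n • dx^[n] b) := by
  rw [coeff_monomial_mul i a (ordLE_monomial j b), Finset.sum_range_succ, Finset.sum_eq_zero,
    zero_add, coeff_monomial, if_pos (by ring)]
  intro l hl
  rw [Finset.mem_range] at hl
  rw [coeff_monomial, if_neg (by omega), iterate_map_zero, smul_zero, mul_zero]

theorem iterate_dx_mul (n : ℕ) (a b : R) : dx^[n] (a * b) =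
    ∑ p ∈ antidiagonal n, n.choose p.1 • (dx^[p.1] a * dx^[p.2] b) := by
  induction n with
  | zero => simp
  | succ n ih =>
    rw [Finset.sum_antidiagonal_choose_succ_nsmul (M := R) (fun i j => dx^[i] a * dx^[j] b) n]
    simp only [Function.iterate_succ_apply', ih, map_sum, map_nsmul, Derivation.leibniz,
      smul_eq_mul, smul_add, Finset.sum_add_distrib]
    congr 1
    refine Finset.sum_congr rfl fun ⟨i, j⟩ hij => ?_
    rw [n.choose_symm_of_eq_add (mem_antidiagonal.1 hij).symm]
    simp only [mul_comm]

/-- On the left, the Vandermonde identity splits the binomial coefficient of the exponent `(i - (n -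
l)) + j`. On the right, the Leibniz rule expands the derivatives of a product, and `choose i l *
choose l z = choose i z * choose (i - z) (l - z)` brings the coefficients to the same shape. -/
theorem monomial_mul_assoc (i j m : ℤ) (a b c : R) :
    monomial i a * monomial j b * monomial m c = monomial i a * (monomial j b * monomial m c) := by
  have hP := (ordLE_monomial i a).mul (ordLE_monomial j b)
  have hQ := (ordLE_monomial j b).mul (ordLE_monomial m c)
  ext t
  by_cases ht : i + j + m < t
  · rw [hP.mul (ordLE_monomial m c) t ht, (ordLE_monomial i a).mul hQ t (by omega)]
  obtain ⟨n, rfl⟩ : ∃ n : ℕ, t = i + j + m - n := ⟨(i + j + m - t).toNat, by omega⟩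
  rw [coeff_mul_monomial m c hP, show i + j + m - (n : ℤ) = i + (j + m) - n by ring,
    coeff_monomial_mul i a hQ]
  have e1 : ∀ l ∈ Finset.range (n + 1),
      (monomial i a * monomial j b).coeff (i + j - (n - l : ℤ)) *
        (Ring.choose (i + j - (n - l : ℤ)) l • dx^[l] c) =
      a * ∑ w ∈ antidiagonal l, (Ring.choose i (n - l) * (Ring.choose (i - (n - l : ℕ)) w.1 *
        Ring.choose j w.2)) • (dx^[n - l] b * dx^[w.1 + w.2] c) := by
    intro l hl
    rw [Finset.mem_range] at hl
    have hnl : (n - l : ℤ) = ((n - l : ℕ) : ℤ) := by omega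
    rw [hnl, coeff_monomial_mul_monomial, show i + j - ((n - l : ℕ) : ℤ) = (i - (n - l : ℕ)) + j by
      ring, Ring.add_choose_eq _ (Commute.all _ _), Finset.sum_smul, Finset.mul_sum,
      Finset.mul_sum]
    refine Finset.sum_congr rfl fun w hw => ?_
    rw [mem_antidiagonal.1 hw]
    simp only [zsmul_eq_mul, Int.cast_mul]
    ring
  have e2 : ∀ l ∈ Finset.range (n + 1),
      a * (Ring.choose i l • dx^[l] ((monomial j b * monomial m c).coeff (j + m - (n - l : ℤ)))) =
      a * ∑ z ∈ antidiagonal l, (Ring.choose i z.1 * (Ring.choose (i - z.1) z.2 *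
        Ring.choose j (n - l))) • (dx^[z.1] b * dx^[z.2 + (n - l)] c) := by
    intro l hl
    rw [Finset.mem_range] at hl
    have hnl : (n - l : ℤ) = ((n - l : ℕ) : ℤ) := by omega
    rw [hnl, coeff_monomial_mul_monomial, mul_smul_comm _ b, iterate_map_zsmul, iterate_dx_mul,
      Finset.smul_sum, Finset.smul_sum]
    congr 1
    refine Finset.sum_congr rfl fun z hz => ?_
    rw [mem_antidiagonal] at hz
    have h := Ring.choose_smul_choose i (show z.1 ≤ l by omega)
    rw [nsmul_eq_mul, show l - z.1 = z.2 by omega] at h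
    rw [← Function.iterate_add_apply, ← mul_assoc (Ring.choose i z.1), ← h]
    simp only [zsmul_eq_mul, nsmul_eq_mul, Int.cast_mul, Int.cast_natCast]
    ring
  rw [Finset.sum_congr rfl e1, Finset.sum_congr rfl e2, ← Finset.mul_sum, ← Finset.mul_sum]
  congr 1
  rw [Finset.sum_sigma', Finset.sum_sigma']
  -- Both sums run over triples of natural numbers with sum `n`: derivatives of `b` produced by
  -- `∂ⁱ`, derivatives of `c` produced by `∂ⁱ`, and derivatives of `c` produced by `∂ʲ`. Only the
  -- grouping differs.
  refine Finset.sum_nbij' (fun x => ⟨n - x.2.2, (n - x.1, x.2.1)⟩)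
    (fun x => ⟨n - x.2.1, (x.2.2, n - x.1)⟩) ?_ ?_ ?_ ?_ ?_
  · rintro ⟨l, w⟩ h
    simp only [Finset.mem_sigma, Finset.mem_range, mem_antidiagonal] at h ⊢
    omega
  · rintro ⟨l, w⟩ h
    simp only [Finset.mem_sigma, Finset.mem_range, mem_antidiagonal] at h ⊢
    omega
  · rintro ⟨l, w, w'⟩ h
    simp only [Finset.mem_sigma, Finset.mem_range, mem_antidiagonal] at h
    obtain rfl : l = w + w' := h.2.symm
    simp only [show n - (n - (w + w')) = w + w' by omega, show n - (n - w') = w' by omega]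
  · rintro ⟨l, w, w'⟩ h
    simp only [Finset.mem_sigma, Finset.mem_range, mem_antidiagonal] at h
    obtain rfl : l = w + w' := h.2.symm
    simp only [show n - (n - (w + w')) = w + w' by omega, show n - (n - w) = w by omega]
  · rintro ⟨l, w, w'⟩ h
    simp only [Finset.mem_sigma, Finset.mem_range, mem_antidiagonal] at h
    simp only [show n - (n - w') = w' by omega]

/-- Additivity reduces finite sums to monomials. The factors are then made arbitrary one at a time:
for the coefficient of `∂ᵏ`, a tail of order `k - 1 - M - M`, with `M` bounding the other two
factors, contributes nothing to either side. -/
theorem pdo_mul_assoc (A B E : PDO R) : A * B * E = A * (B * E) := by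
  have z_mul : ∀ X : PDO R, 0 * X = 0 := fun X => by
    have := pdo_add_mul 0 0 X
    rwa [add_zero, left_eq_add] at this
  have mul_z : ∀ X : PDO R, X * 0 = 0 := fun X => by
    have := pdo_mul_add X 0 0
    rwa [add_zero, left_eq_add] at this
  have h3 : ∀ A B E : PDO R, A.IsFinite → B.IsFinite → E.IsFinite → A * B * E = A * (B * E) := by
    intro A B E hA hB hE
    induction hE using AddSubmonoid.closure_induction with
    | zero => simp only [mul_z]
    | add X Y _ _ hX hY => simp only [pdo_mul_add, hX, hY]
    | mem E hE =>
      obtain ⟨m, c, rfl⟩ := hE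
      induction hB using AddSubmonoid.closure_induction with
      | zero => simp only [mul_z, z_mul]
      | add X Y _ _ hX hY => simp only [pdo_mul_add, pdo_add_mul, hX, hY]
      | mem B hB =>
        obtain ⟨j, b, rfl⟩ := hB
        induction hA using AddSubmonoid.closure_induction with
        | zero => simp only [z_mul]
        | add X Y _ _ hX hY => simp only [pdo_add_mul, hX, hY]
        | mem A hA =>
          obtain ⟨i, a, rfl⟩ := hA
          exact monomial_mul_assoc i j m a b c
  have h_left : ∀ A B E : PDO R, B.IsFinite → E.IsFinite → A * B * E = A * (B * E) := by
    intro A B E hB hE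
    ext k
    obtain ⟨M, hMB, hME⟩ := exists_ordLE₂ B E
    obtain ⟨A', a, hA', ha, rfl⟩ := A.exists_isFinite_sub_ordLE (k - 1 - M - M)
    rw [pdo_add_mul, pdo_add_mul, pdo_add_mul, coeff_add, coeff_add, h3 A' B E hA' hB hE,
      ((ha.mul hMB).mul hME) k (by omega), (ha.mul (hMB.mul hME)) k (by omega)]
  have h_mid : ∀ A B E : PDO R, E.IsFinite → A * B * E = A * (B * E) := by
    intro A B E hE
    ext k
    obtain ⟨M, hMA, hME⟩ := exists_ordLE₂ A E
    obtain ⟨B', b, hB', hb, rfl⟩ := B.exists_isFinite_sub_ordLE (k - 1 - M - M)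
    rw [pdo_mul_add, pdo_add_mul, pdo_add_mul, pdo_mul_add, coeff_add, coeff_add,
      h_left A B' E hB' hE, ((hMA.mul hb).mul hME) k (by omega),
      (hMA.mul (hb.mul hME)) k (by omega)]
  ext k
  obtain ⟨M, hMA, hMB⟩ := exists_ordLE₂ A B
  obtain ⟨E', e, hE', he, rfl⟩ := E.exists_isFinite_sub_ordLE (k - 1 - M - M)
  rw [pdo_mul_add, pdo_mul_add, pdo_mul_add, coeff_add, coeff_add, h_mid A B E' hE',
    ((hMA.mul hMB).mul he) k (by omega), (hMA.mul (hMB.mul he)) k (by omega)]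

theorem coeff_C_mul (a : R) (B : PDO R) (k : ℤ) : (C a * B).coeff k = a * B.coeff k := by
  obtain ⟨M, hB⟩ := B.exists_ordLE
  by_cases hk : M < k
  · have h : (C a * B).OrdLE (0 + M) := (ordLE_monomial 0 a).mul hB
    rw [h k (by omega), hB k hk, mul_zero]
  obtain ⟨n, rfl⟩ : ∃ n : ℕ, k = 0 + M - n := ⟨(M - k).toNat, by omega⟩
  rw [C, coeff_monomial_mul 0 a hB, Finset.sum_eq_single_of_mem 0 (by simp)]
  · simp
  · intro l _ hl
    rw [Ring.choose_zero_pos ℤ (Nat.pos_of_ne_zero hl), zero_smul, mul_zero]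

theorem coeff_mul_D (A : PDO R) (j k : ℤ) : (A * D j).coeff k = A.coeff (k - j) := by
  obtain ⟨M, hA⟩ := A.exists_ordLE
  by_cases hk : M + j < k
  · have h : (A * D j).OrdLE (M + j) := hA.mul (ordLE_monomial j 1)
    rw [h k hk, hA _ (by omega)]
  obtain ⟨n, rfl⟩ : ∃ n : ℕ, k = M + j - n := ⟨(M + j - k).toNat, by omega⟩
  rw [D, coeff_mul_monomial j 1 hA, Finset.sum_eq_single_of_mem 0 (by simp)]
  · simp only [Nat.cast_zero, sub_zero, Ring.choose_zero_right, Function.iterate_zero, id_eq,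
      one_smul, mul_one]
    congr 1
    ring
  · intro l _ hl
    obtain ⟨l, rfl⟩ := Nat.exists_eq_succ_of_ne_zero hl
    rw [Function.iterate_succ_apply, Derivation.map_one_eq_zero, iterate_map_zero, smul_zero,
      mul_zero]

/-- Product, unit and natural powers are definitionally the operations used in the statement, so
ring lemmas apply directly to the powers `Lⁿ`. -/
instance : Ring (PDO R) where
  __ := (inferInstance : AddCommGroup (PDO R))
  mul := (· * ·)
  one := 1
  npow n A := npowRec n A
  left_distrib := pdo_mul_add
  right_distrib := pdo_add_mul
  zero_mul A := by
    have := pdo_add_mul 0 0 A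
    rwa [add_zero, left_eq_add] at this
  mul_zero A := by
    have := pdo_mul_add A 0 0
    rwa [add_zero, left_eq_add] at this
  mul_assoc := pdo_mul_assoc
  one_mul A := by
    ext k
    exact (coeff_C_mul 1 A k).trans (one_mul _)
  mul_one A := by
    ext k
    exact (coeff_mul_D A 0 k).trans (by rw [sub_zero])

end PDO

/-! ### Elementary operators, residues and coefficientwise maps -/

namespace PDO

section Additive

variable {R : Type*} [CommRing R]

theorem coeff_C (a : R) (k : ℤ) : (C a).coeff k = if k = 0 then a else 0 := rfl

theorem coeff_D (n k : ℤ) : (D n : PDO R).coeff k = if k = n then 1 else 0 := rfl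

theorem ordLE_C (a : R) : (C a).OrdLE 0 := ordLE_monomial 0 a

theorem ordLE_D (n : ℤ) : (D n : PDO R).OrdLE n := ordLE_monomial n 1

theorem ordLE_negPart (A : PDO R) : A.neg.OrdLE (-1) := fun k hk => by
  rw [coeff_negPart, if_neg (by omega)]

theorem OrdLE.add {A B : PDO R} {N : ℤ} (hA : A.OrdLE N) (hB : B.OrdLE N) : (A + B).OrdLE N :=
  fun k hk => by rw [coeff_add, hA k hk, hB k hk, add_zero]

theorem C_add (a b : R) : C (a + b) = C a + C b := by
  ext k; simp only [coeff_add, coeff_C]; split_ifs <;> simp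

theorem C_neg (a : R) : C (-a) = -C a := by
  ext k; simp only [coeff_neg, coeff_C]; split_ifs <;> simp

theorem C_sub (a b : R) : C (a - b) = C a - C b := by
  ext k; simp only [coeff_sub, coeff_C]; split_ifs <;> simp

theorem C_zero : C (0 : R) = 0 := by
  ext k; simp only [coeff_zero, coeff_C, ite_self]

theorem one_eq_C : (1 : PDO R) = C 1 := rfl

theorem one_eq_D : (1 : PDO R) = D 0 := rfl

theorem res_add (A B : PDO R) : (A + B).res = A.res + B.res := rfl

theorem res_sub (A B : PDO R) : (A - B).res = A.res - B.res := rfl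

variable {S : Type*} [CommRing S] (φ : R →+ S)

theorem map_add (A B : PDO R) : (A + B).map φ = A.map φ + B.map φ := by
  ext k; simp

theorem map_sub (A B : PDO R) : (A - B).map φ = A.map φ - B.map φ := by
  ext k; simp

theorem map_C (a : R) : (C a).map φ = C (φ a) := by
  ext k; simp only [coeff_map, coeff_C, apply_ite φ, map_zero]

theorem map_D (h : φ 1 = 1) (n : ℤ) : (D n).map φ = D n := by
  ext k; simp only [coeff_map, coeff_D, apply_ite φ, map_zero, h]

theorem OrdLE.map {A : PDO R} {N : ℤ} (hA : A.OrdLE N) : (A.map φ).OrdLE N := fun k hk => by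
  rw [coeff_map, hA k hk, map_zero]

end Additive

variable {R : Type*} [CommRing R] [Algebra ℚ R] [TimeAlgebra R]

theorem C_mul (a b : R) : C (a * b) = C a * C b := by
  ext k; rw [coeff_C_mul, coeff_C, coeff_C, mul_ite, mul_zero]

theorem D_mul_D (i j : ℤ) : (D i : PDO R) * D j = D (i + j) := by
  ext k
  rw [coeff_mul_D, coeff_D, coeff_D]
  congr 1
  exact propext ⟨fun h => by omega, fun h => by omega⟩

theorem D_one_mul_D_neg_one : (D 1 : PDO R) * D (-1) = 1 := D_mul_D 1 (-1)

theorem D_neg_one_mul_D_one : (D (-1) : PDO R) * D 1 = 1 := D_mul_D (-1) 1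

theorem D_one_pow (n : ℕ) : (D 1 : PDO R) ^ n = D n := by
  induction n with
  | zero => rfl
  | succ n ih => rw [pow_succ, ih, D_mul_D]; rfl

theorem D_one_mul_C (a : R) : D 1 * C a = C a * D 1 + C (dx a) := by
  ext k
  rw [coeff_add, coeff_mul_D, coeff_C, coeff_C]
  by_cases hk : 1 < k
  · have h : (D 1 * C a).OrdLE (1 + 0) := (ordLE_D 1).mul (ordLE_C a)
    rw [h k (by omega), if_neg (by omega), if_neg (by omega), add_zero]
  obtain ⟨n, rfl⟩ : ∃ n : ℕ, k = 1 + 0 - n := ⟨(1 - k).toNat, by omega⟩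
  rw [D, C, coeff_monomial_mul_monomial]
  rcases n with _ | _ | n
  · simp
  · simp
  · rw [show (1 : ℤ) = ((1 : ℕ) : ℤ) from rfl, Ring.choose_natCast,
      Nat.choose_eq_zero_of_lt (by omega), if_neg (by push_cast; omega), if_neg (by push_cast; omega)]
    simp

/-- `∂⁻¹ a' ∂⁻¹ = a ∂⁻¹ - ∂⁻¹ a`. -/
theorem D_neg_one_mul_C_dx_mul_D_neg_one (a : R) :
    D (-1) * C (dx a) * D (-1) = C a * D (-1) - D (-1) * C a := by
  have h : C (dx a) = D 1 * C a - C a * D 1 := by rw [D_one_mul_C]; abel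
  calc D (-1) * C (dx a) * D (-1)
      = (D (-1) * D 1) * C a * D (-1) - D (-1) * C a * (D 1 * D (-1)) := by rw [h]; noncomm_ring
    _ = _ := by rw [D_neg_one_mul_D_one, D_one_mul_D_neg_one, one_mul, mul_one]

/-- A term with `l > 0` derivatives on `a` comes from `∂^(l-1)`, and `choose (l-1) l = 0`. -/
theorem coeff_neg_one_mul_C (A : PDO R) (a : R) :
    (A * C a).coeff (-1) = A.coeff (-1) * a := by
  obtain ⟨M, hA⟩ := A.exists_ordLE
  replace hA := hA.mono (le_max_left M 0)
  obtain ⟨n, hn⟩ : ∃ n : ℕ, (-1 : ℤ) = max M 0 + 0 - n := ⟨(max M 0 + 1).toNat, by omega⟩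
  conv_lhs => rw [hn, C, coeff_mul_monomial 0 a hA]
  rw [Finset.sum_eq_single_of_mem 0 (by simp)]
  · rw [show max M 0 - ((n : ℤ) - (0 : ℕ)) = -1 by push_cast; omega]
    simp
  · intro l _ hl
    rw [show max M 0 - ((n : ℤ) - l) = ((l - 1 : ℕ) : ℤ) by omega, Ring.choose_natCast,
      Nat.choose_eq_zero_of_lt (by omega)]
    simp

/-- Turns evaluation of a differential operator into ring multiplication: the `l`-th term carries
`choose l l = 1`. -/
theorem coeff_zero_mul_C (A : PDO R) (f : R) : (A * C f).coeff 0 = A.posApply f := by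
  obtain ⟨M, hA⟩ := A.exists_ordLE
  obtain ⟨n, hA⟩ : ∃ n : ℕ, A.OrdLE n := ⟨M.toNat, hA.mono (by omega)⟩
  conv_lhs => rw [show (0 : ℤ) = n + 0 - n by ring, C, coeff_mul_monomial 0 f hA]
  rw [posApply, finsum_eq_sum_of_support_subset (s := Finset.range (n + 1))]
  · refine Finset.sum_congr rfl fun l hl => ?_
    rw [show (n : ℤ) - (n - l) = l by ring, Ring.choose_natCast, Nat.choose_self]
    simp
  · intro l hl
    rw [Function.mem_support] at hl
    by_contra h
    refine hl ?_
    rw [hA l (by simpa using h), zero_mul]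

theorem res_mul_C (A : PDO R) (a : R) : (A * C a).res = A.res * a := coeff_neg_one_mul_C A a

theorem res_C_mul (a : R) (A : PDO R) : (C a * A).res = a * A.res := coeff_C_mul a A (-1)

/-- `Res(A f ∂⁻¹) = A_{≥ 0}(f)` -/
theorem res_mul_C_mul_D (A : PDO R) (f : R) : (A * C f * D (-1)).res = A.posApply f := by
  rw [res, coeff_mul_D, ← coeff_zero_mul_C]
  rfl

/-- The projection to `A_{≥ 0}` is irrelevant in the definition of a squared eigenfunction
potential. -/
theorem res_sep (A : PDO R) (f g : R) : (D (-1) * C g * A.pos * C f * D (-1)).res =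
    (D (-1) * C g * A * C f * D (-1)).res := by
  conv_rhs => rw [← pos_add_neg A]
  have h : (D (-1) * C g * A.neg * C f * D (-1)).OrdLE (-1 + 0 + -1 + 0 + -1) :=
    ((((ordLE_D _).mul (ordLE_C g)).mul (ordLE_negPart A)).mul (ordLE_C f)).mul (ordLE_D _)
  rw [mul_add, add_mul, add_mul, res_add, res.eq_def (_ * A.neg * _ * _), h (-1) (by norm_num),
    add_zero]

section Map

variable {S : Type*} [CommRing S] [Algebra ℚ S] [TimeAlgebra S] (φ : R →+ S)

theorem iterate_dx_of_comm (hdx : ∀ a, φ (dx a) = dx (φ a)) (n : ℕ) (a : R) :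
    φ (dx^[n] a) = dx^[n] (φ a) := by
  induction n generalizing a with
  | zero => rfl
  | succ n ih => rw [Function.iterate_succ_apply, ih, hdx, Function.iterate_succ_apply]

theorem map_mul (hmul : ∀ a b, φ (a * b) = φ a * φ b) (hdx : ∀ a, φ (dx a) = dx (φ a))
    (A B : PDO R) : (A * B).map φ = A.map φ * B.map φ := by
  ext k
  obtain ⟨M, hA⟩ := A.exists_ordLE
  obtain ⟨M', hB⟩ := B.exists_ordLE
  rw [coeff_map, coeff_mul_eq_sum hA hB, coeff_mul_eq_sum (hA.map φ) (hB.map φ), map_sum]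
  simp only [hmul, map_zsmul, iterate_dx_of_comm φ hdx, coeff_map]

end Map

theorem map_mul_derivation (d : R →+ R) (hd : ∀ a b, d (a * b) = d a * b + a * d b)
    (hdx : ∀ a, d (dx a) = dx (d a)) (A B : PDO R) :
    (A * B).map d = A.map d * B + A * B.map d := by
  ext k
  obtain ⟨M, hA⟩ := A.exists_ordLE
  obtain ⟨M', hB⟩ := B.exists_ordLE
  rw [coeff_map, coeff_add, coeff_mul_eq_sum hA hB, coeff_mul_eq_sum (hA.map d) hB,
    coeff_mul_eq_sum hA (hB.map d), map_sum, ← Finset.sum_add_distrib]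
  simp only [hd, map_zsmul, iterate_dx_of_comm d hdx, coeff_map]

/-- If the coefficients of `A` and `B` lie in additive subgroups `S₁` and `S₂` with
`S₁ · S₂ ⊆ S₃` and `∂ S₂ ⊆ S₂`, then those of `A B` lie in `S₃`. -/
theorem coeff_mul_mem {S₁ S₂ S₃ : AddSubgroup R} (hmul : ∀ a ∈ S₁, ∀ b ∈ S₂, a * b ∈ S₃)
    (hdx : ∀ b ∈ S₂, dx b ∈ S₂) {A B : PDO R} (hA : ∀ k, A.coeff k ∈ S₁)
    (hB : ∀ k, B.coeff k ∈ S₂) (k : ℤ) : (A * B).coeff k ∈ S₃ := by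
  have hit : ∀ (n : ℕ), ∀ b ∈ S₂, dx^[n] b ∈ S₂ := fun n => by
    induction n with
    | zero => exact fun b hb => hb
    | succ n ih => exact fun b hb => ih _ (hdx b hb)
  rw [coeff_mul]
  exact finsum_induction (· ∈ S₃) (zero_mem S₃) (fun _ _ => add_mem)
    fun p => hmul _ (hA _) _ (zsmul_mem (hit _ _ (hB _)) _)

end PDO

/-! ### The dressing operator of the squared eigenfunction flow -/

section Dressing

variable {R : Type*} [CommRing R] [Algebra ℚ R] [TimeAlgebra R]

open PDO (C D)

/-- The operator `q ∂⁻¹ r`. -/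
def sqOp (q r : R) : PDO R := C q * D (-1) * C r

/-- Between the two factors `∂⁻¹` stands `r a q = b'`, to which `∂⁻¹ b' ∂⁻¹ = b∂⁻¹ - ∂⁻¹b` applies.
All composition rules for dressing operators are instances of this. -/
theorem sqOp_mul_C_mul_sqOp {q r a b : R} (h : dx b = q * r * a) :
    sqOp q r * C a * sqOp q r = C b * sqOp q r - sqOp q r * C b := by
  have h1 : C r * C a * C q = C (dx b) := by
    rw [← PDO.C_mul, ← PDO.C_mul, h]
    congr 1
    ring
  have h2 : C q * C b = C b * C q := by rw [← PDO.C_mul, ← PDO.C_mul, mul_comm]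
  have h3 : C r * C b = C b * C r := by rw [← PDO.C_mul, ← PDO.C_mul, mul_comm]
  calc sqOp q r * C a * sqOp q r
      = C q * (D (-1) * (C r * C a * C q) * D (-1)) * C r := by simp only [sqOp, mul_assoc]
    _ = (C q * C b) * D (-1) * C r - C q * D (-1) * (C b * C r) := by
      rw [h1, PDO.D_neg_one_mul_C_dx_mul_D_neg_one]
      noncomm_ring
    _ = _ := by
      rw [h2, ← h3]
      simp only [sqOp, mul_assoc]

theorem sqOp_mul_C_comm (q r : R) {s : R} (hs : dx s = 0) :
    sqOp q r * C s = C s * sqOp q r := by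
  have h := PDO.D_neg_one_mul_C_dx_mul_D_neg_one s
  rw [hs, PDO.C_zero, mul_zero, zero_mul, eq_comm, sub_eq_zero] at h
  have h2 : C q * C s = C s * C q := by rw [← PDO.C_mul, ← PDO.C_mul, mul_comm]
  have h3 : C r * C s = C s * C r := by rw [← PDO.C_mul, ← PDO.C_mul, mul_comm]
  calc sqOp q r * C s = C q * D (-1) * (C r * C s) := by simp only [sqOp, mul_assoc]
    _ = C q * (D (-1) * C s) * C r := by rw [h3]; simp only [mul_assoc]
    _ = C q * C s * D (-1) * C r := by rw [← h]; simp only [mul_assoc]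
    _ = _ := by rw [h2]; simp only [sqOp, mul_assoc]

/-- The dressing operator `1 + t q ∂⁻¹ r`. -/
def dressOp (q r t : R) : PDO R := 1 + C t * sqOp q r

/-- The operator `1 - q ∂⁻¹ r t`. -/
def dressInv (q r t : R) : PDO R := 1 - sqOp q r * C t

variable {q r ω s v : R}

theorem dx_of_mul_one_sub_eq_one (hω : dx ω = q * r) (hs : dx s = 0)
    (hv : v * (1 - s * ω) = 1) : dx v = q * r * (s * v ^ 2) := by
  have h := congrArg dx hv
  simp only [Derivation.leibniz, map_sub, Derivation.map_one_eq_zero, smul_eq_mul, hs, hω] at h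
  linear_combination v * h - dx v * hv

/-- Here `s` is any constant, so the lemma serves both the formal parameter and `s = 1`. The
quadratic term is resolved by `(q∂⁻¹r)² = ω q∂⁻¹r - q∂⁻¹r ω` together with `s v ω = v - 1`. -/
theorem dressOp_mul_dressInv (hω : dx ω = q * r) (hs : dx s = 0) (hv : v * (1 - s * ω) = 1) :
    dressOp q r (s * v) * dressInv q r (s * v) = 1 := by
  have h1 : sqOp q r * sqOp q r = C ω * sqOp q r - sqOp q r * C ω := by
    rw [← sqOp_mul_C_mul_sqOp (a := 1) (by rw [hω, mul_one]), ← PDO.one_eq_C, mul_one]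
  have h2 : C (s * v) * C ω = C v - 1 := by
    rw [PDO.one_eq_C, ← PDO.C_mul, ← PDO.C_sub]
    congr 1
    linear_combination -hv
  have h3 : C ω * C (s * v) = C v - 1 := by rw [← h2, ← PDO.C_mul, ← PDO.C_mul, mul_comm]
  have h4 : C v * sqOp q r * C (s * v) = C (s * v) * sqOp q r * C v := by
    calc C v * sqOp q r * C (s * v) = C v * (sqOp q r * C s) * C v := by
          rw [PDO.C_mul]; simp only [mul_assoc]
      _ = _ := by
          rw [sqOp_mul_C_comm q r hs, mul_comm s v, PDO.C_mul]; simp only [mul_assoc]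
  calc dressOp q r (s * v) * dressInv q r (s * v)
      = 1 + C (s * v) * sqOp q r - sqOp q r * C (s * v)
          - C (s * v) * (sqOp q r * sqOp q r) * C (s * v) := by
        simp only [dressOp, dressInv]; noncomm_ring
    _ = 1 + C (s * v) * sqOp q r - sqOp q r * C (s * v)
          - ((C (s * v) * C ω) * sqOp q r * C (s * v)
            - C (s * v) * sqOp q r * (C ω * C (s * v))) := by
        rw [h1]; noncomm_ring
    _ = 1 - (C v * sqOp q r * C (s * v) - C (s * v) * sqOp q r * C v) := by
        rw [h2, h3]; noncomm_ring
    _ = 1 := by rw [h4, sub_self, sub_zero]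

/-- In this order the middle factor is `(s v)²`, and `q r (s v)²` is the `x`-derivative of `s v`, so
the quadratic term cancels the linear ones. -/
theorem dressInv_mul_dressOp (hω : dx ω = q * r) (hs : dx s = 0) (hv : v * (1 - s * ω) = 1) :
    dressInv q r (s * v) * dressOp q r (s * v) = 1 := by
  have h1 : sqOp q r * C ((s * v) * (s * v)) * sqOp q r =
      C (s * v) * sqOp q r - sqOp q r * C (s * v) := by
    refine sqOp_mul_C_mul_sqOp ?_
    rw [Derivation.leibniz, hs, dx_of_mul_one_sub_eq_one hω hs hv]
    simp only [smul_eq_mul]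
    ring
  calc dressInv q r (s * v) * dressOp q r (s * v)
      = 1 + C (s * v) * sqOp q r - sqOp q r * C (s * v)
          - sqOp q r * (C (s * v) * C (s * v)) * sqOp q r := by
        simp only [dressOp, dressInv]; noncomm_ring
    _ = 1 := by rw [← PDO.C_mul, h1]; noncomm_ring

/-- `(v q ∂⁻¹ r v) (1 + s v q ∂⁻¹ r) = v² q ∂⁻¹ r` -/
theorem sqOp_mul_dressOp (hω : dx ω = q * r) (hs : dx s = 0) (hv : v * (1 - s * ω) = 1) :
    sqOp (q * v) (r * v) * dressOp q r (s * v) = C (v ^ 2) * sqOp q r := by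
  have h1 : sqOp q r * C (v * (s * v)) * sqOp q r = C v * sqOp q r - sqOp q r * C v := by
    refine sqOp_mul_C_mul_sqOp ?_
    rw [dx_of_mul_one_sub_eq_one hω hs hv]
    ring
  have h2 : sqOp (q * v) (r * v) = C v * sqOp q r * C v := by
    rw [sqOp, mul_comm q v, PDO.C_mul, PDO.C_mul]
    simp only [sqOp, mul_assoc]
  calc sqOp (q * v) (r * v) * dressOp q r (s * v)
      = C v * sqOp q r * C v + C v * (sqOp q r * (C v * C (s * v)) * sqOp q r) := by
        rw [h2, dressOp]; noncomm_ring
    _ = C v * C v * sqOp q r := by rw [← PDO.C_mul, h1]; noncomm_ring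
    _ = _ := by rw [pow_two, PDO.C_mul]

end Dressing

/-! ### Power series in the flow parameter -/

section Series

variable {R : Type*} [CommRing R] [Algebra ℚ R]

theorem ds_apply (f : R⟦X⟧) : ds f = PowerSeries.derivative R f := rfl

theorem ds_mul (f g : R⟦X⟧) : ds (f * g) = ds f * g + f * ds g := by
  simp only [ds_apply, Derivation.leibniz, smul_eq_mul]
  ring

theorem ds_C (a : R) : ds (PowerSeries.C a) = 0 := PowerSeries.derivative_C

theorem ds_X : ds (PowerSeries.X : R⟦X⟧) = 1 := PowerSeries.derivative_X

theorem ds_one : ds (1 : R⟦X⟧) = 0 := by rw [← map_one PowerSeries.C, ds_C]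

theorem atZero_mul (f g : R⟦X⟧) : atZero (f * g) = atZero f * atZero g :=
  _root_.map_mul (PowerSeries.constantCoeff (R := R)) f g

theorem atZero_one : atZero (1 : R⟦X⟧) = 1 := map_one (PowerSeries.constantCoeff (R := R))

theorem atZero_C (a : R) : atZero (PowerSeries.C a) = a := PowerSeries.constantCoeff_C a

theorem atZero_X : atZero (PowerSeries.X : R⟦X⟧) = 0 := PowerSeries.constantCoeff_X

theorem coeff_coeffwise (d : Derivation ℚ R R) (f : R⟦X⟧) (m : ℕ) :
    PowerSeries.coeff m (coeffwise d f) = d (PowerSeries.coeff m f) := by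
  simp [coeffwise]

theorem coeffwise_C (d : Derivation ℚ R R) (a : R) :
    coeffwise d (PowerSeries.C a) = PowerSeries.C (d a) := by
  ext m
  rw [coeff_coeffwise, PowerSeries.coeff_C, PowerSeries.coeff_C]
  split_ifs <;> simp

theorem coeffwise_X (d : Derivation ℚ R R) : coeffwise d PowerSeries.X = 0 := by
  ext m
  rw [coeff_coeffwise, PowerSeries.coeff_X]
  split_ifs <;> simp

/-- The geometric series `∑ ωᵐ sᵐ`. -/
def geom (ω : R) : R⟦X⟧ := PowerSeries.mk fun m => ω ^ m

theorem geom_mul (ω : R) : geom ω * (1 - PowerSeries.X * PowerSeries.C ω) = 1 := by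
  ext m
  rw [mul_sub, mul_one, mul_left_comm, map_sub, mul_comm (geom ω), PowerSeries.coeff_one]
  cases m with
  | zero => simp [geom]
  | succ m => simp [geom, PowerSeries.coeff_succ_X_mul, pow_succ']

theorem geom_eq (ω : R) : 1 + PowerSeries.C ω * (PowerSeries.X * geom ω) = geom ω := by
  linear_combination -geom_mul ω

theorem ds_geom (ω : R) : ds (geom ω) = PowerSeries.C ω * geom ω ^ 2 := by
  have h := congrArg ds (geom_mul ω)
  simp only [ds_mul, _root_.map_sub, ds_one, ds_X, ds_C] at h
  linear_combination geom ω * h - ds (geom ω) * geom_mul ω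

theorem ds_X_mul_geom (ω : R) : ds (PowerSeries.X * geom ω) = geom ω ^ 2 := by
  rw [ds_mul, ds_X, ds_geom]
  linear_combination geom ω * geom_eq ω

/-- Integration in `s` raises the order of vanishing by one; the division by `m + 1` uses the
rational scalars. -/
theorem X_pow_succ_dvd_of_ds {f : R⟦X⟧} {n : ℕ} (h0 : atZero f = 0)
    (h : (PowerSeries.X : R⟦X⟧) ^ n ∣ ds f) : (PowerSeries.X : R⟦X⟧) ^ (n + 1) ∣ f := by
  rw [PowerSeries.X_pow_dvd_iff] at h ⊢
  intro m hm
  cases m with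
  | zero => simpa [atZero] using h0
  | succ m =>
    have h1 := h m (by omega)
    rw [ds_apply, PowerSeries.coeff_derivative] at h1
    have h2 : algebraMap ℚ R ((m : ℚ) + 1)⁻¹ * ((m : R) + 1) = 1 := by
      rw [show (m : R) + 1 = algebraMap ℚ R ((m : ℚ) + 1) by simp, ← _root_.map_mul,
        inv_mul_cancel₀ (by positivity), map_one]
    linear_combination algebraMap ℚ R ((m : ℚ) + 1)⁻¹ * h1 - PowerSeries.coeff (m + 1) f * h2

theorem eq_zero_of_X_pow_dvd {f : R⟦X⟧} (h : ∀ n, (PowerSeries.X : R⟦X⟧) ^ n ∣ f) : f = 0 := by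
  ext m
  exact PowerSeries.X_pow_dvd_iff.1 (h (m + 1)) m (by omega)

/-- Uniqueness for a scalar flow. -/
theorem eq_of_ds {f g : R⟦X⟧} (h0 : atZero f = atZero g) (h : f - g ∣ ds f - ds g) : f = g := by
  rw [← sub_eq_zero]
  refine eq_zero_of_X_pow_dvd fun n => ?_
  induction n with
  | zero => simp
  | succ n ih =>
    refine X_pow_succ_dvd_of_ds (by rw [_root_.map_sub, h0, sub_self]) ?_
    rw [_root_.map_sub]
    exact ih.trans h

variable [TimeAlgebra R]

theorem dx_series (f : R⟦X⟧) : dx f = coeffwise dx f := rfl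

theorem dx_X : dx (PowerSeries.X : R⟦X⟧) = 0 := coeffwise_X _

theorem dx_C (a : R) : PowerSeries.C (dx a) = dx (PowerSeries.C a) := (coeffwise_C _ a).symm

theorem atZero_dx (f : R⟦X⟧) : atZero (dx f) = dx (atZero f) := by
  simp [atZero, dx_series, coeffwise]

theorem ds_dx (f : R⟦X⟧) : ds (dx f) = dx (ds f) := by
  ext m
  rw [ds_apply, PowerSeries.coeff_derivative, dx_series, dx_series, coeff_coeffwise,
    coeff_coeffwise, ds_apply, PowerSeries.coeff_derivative, Derivation.leibniz,
    _root_.map_add, Derivation.map_natCast, Derivation.map_one_eq_zero]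
  simp only [smul_eq_mul]
  ring

/-- An operator over `R`, as an operator over `R⟦s⟧`. -/
def PDO.lift (A : PDO R) : PDO R⟦X⟧ := A.map (PowerSeries.C (R := R)).toAddMonoidHom

theorem PDO.lift_mul (A B : PDO R) : (A * B).lift = A.lift * B.lift :=
  PDO.map_mul _ (_root_.map_mul PowerSeries.C) dx_C A B

theorem PDO.lift_C (a : R) : (PDO.C a).lift = PDO.C (PowerSeries.C a) := PDO.map_C _ a

theorem PDO.lift_D (n : ℤ) : (PDO.D n : PDO R).lift = PDO.D n :=
  PDO.map_D _ (map_one (PowerSeries.C (R := R))) n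

theorem PDO.lift_sqOp (q r : R) :
    (sqOp q r).lift = sqOp (PowerSeries.C q) (PowerSeries.C r) := by
  rw [sqOp, PDO.lift_mul, PDO.lift_mul, PDO.lift_C, PDO.lift_C, PDO.lift_D, sqOp]

theorem PDO.map_ds_lift (A : PDO R) : A.lift.map ds = 0 := by
  ext k; exact congrArg _ (ds_C _)

theorem PDO.map_atZero_lift (A : PDO R) : A.lift.map atZero = A := by
  ext k; exact atZero_C _

theorem PDO.map_ds_mul (A B : PDO R⟦X⟧) :
    (A * B).map ds = A.map ds * B + A * B.map ds := PDO.map_mul_derivation ds ds_mul ds_dx A B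

theorem PDO.map_atZero_mul (A B : PDO R⟦X⟧) :
    (A * B).map atZero = A.map atZero * B.map atZero := PDO.map_mul atZero atZero_mul atZero_dx A B

/-- Uniqueness for a linear flow of operators. -/
theorem PDO.eq_of_map_ds {F G : PDO R⟦X⟧} (P Q : PDO R⟦X⟧) (h0 : F.map atZero = G.map atZero)
    (hF : F.map ds = P * F - F * Q) (hG : G.map ds = P * G - G * Q) : F = G := by
  rw [← sub_eq_zero]
  -- The difference solves the same linear equation with zero initial value. Since `s` is a constant
  -- for `∂`, the ideal `(sⁿ)` is stable under `∂`, so multiplication by `P` and `Q` keeps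
  -- coefficients in it and integration moves them to `(sⁿ⁺¹)`.
  have h : ∀ n k, (F - G).coeff k ∈ (Ideal.span {(PowerSeries.X : R⟦X⟧) ^ n}).toAddSubgroup := by
    intro n
    induction n with
    | zero => simp
    | succ n ih =>
      intro k
      rw [Submodule.mem_toAddSubgroup, Ideal.mem_span_singleton]
      refine X_pow_succ_dvd_of_ds ?_ ?_
      · rw [PDO.coeff_sub, _root_.map_sub, sub_eq_zero]
        exact congrArg (fun A => PDO.coeff A k) h0
      · rw [← Ideal.mem_span_singleton, ← Submodule.mem_toAddSubgroup]
        have h1 : ds ((F - G).coeff k) = (P * (F - G)).coeff k - ((F - G) * Q).coeff k := by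
          rw [← PDO.coeff_map, PDO.map_sub, hF, hG, ← PDO.coeff_sub]
          congr 1
          noncomm_ring
        rw [h1]
        refine sub_mem (PDO.coeff_mul_mem (S₁ := ⊤) ?_ ?_ (fun _ => AddSubgroup.mem_top _) ih k)
          (PDO.coeff_mul_mem (S₂ := ⊤) ?_ ?_ ih (fun _ => AddSubgroup.mem_top _) k)
        · exact fun a _ b hb => Ideal.mul_mem_left _ a hb
        · intro b hb
          rw [Submodule.mem_toAddSubgroup, Ideal.mem_span_singleton] at hb ⊢
          obtain ⟨c, rfl⟩ := hb
          rw [Derivation.leibniz, Derivation.leibniz_pow, dx_X, smul_zero, smul_zero, smul_zero,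
            add_zero]
          exact dvd_mul_right _ _
        · exact fun a ha b _ => Ideal.mul_mem_right b _ ha
        · exact fun _ _ => AddSubgroup.mem_top _
  refine PDO.ext (funext fun k => ?_)
  exact eq_zero_of_X_pow_dvd fun n => Ideal.mem_span_singleton.1 (h n k)

end Series

/-! ### Oscillating functions as operators -/

namespace Osc

variable {ε : ℤˣ} {R : Type*} [CommRing R]

theorem toPDO_ofPDO (A : PDO R) : (ofPDO ε A).toPDO = A := by
  ext k
  simp only [toPDO, ofPDO, smul_smul, ← Units.val_mul, Int.units_mul_self, Units.val_one, one_smul]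

theorem ofPDO_toPDO (f : Osc ε R) : ofPDO ε f.toPDO = f := by
  ext k
  simp only [toPDO, ofPDO, smul_smul, ← Units.val_mul, Int.units_mul_self, Units.val_one, one_smul]

theorem map_ofPDO {S : Type*} [CommRing S] (φ : R →+ S) (A : PDO R) :
    (ofPDO ε A).map φ = ofPDO ε (A.map φ) := by
  ext k
  simp only [map, ofPDO, PDO.map, map_zsmul]

theorem toPDO_map {S : Type*} [CommRing S] (φ : R →+ S) (f : Osc ε R) :
    (f.map φ).toPDO = f.toPDO.map φ := by
  rw [← ofPDO_toPDO f, map_ofPDO, toPDO_ofPDO, toPDO_ofPDO]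

theorem toPDO_injective : Function.Injective (toPDO : Osc ε R → PDO R) := fun f g h => by
  rw [← ofPDO_toPDO f, h, ofPDO_toPDO]

theorem toPDO_act [Algebra ℚ R] [TimeAlgebra R] (B : PDO R) (f : Osc ε R) :
    (act B f).toPDO = B * f.toPDO := toPDO_ofPDO _

end Osc

/-! ### The integral curve of the squared eigenfunction symmetry -/

section Flow

variable {ι κ R : Type*} [CommRing R] [Algebra ℚ R] [TimeAlgebra R]

/-- The system is triangular: `Ω(q,r)` obeys a closed Riccati equation; once it is known, `Ω(q',r)`,
`Ω(q,r')`, `q` and `r` obey linear equations; the rest is then linear or a plain integration. -/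
theorem IsSymmetryFlow.unique {i₀ : ι} {j₀ : κ} {N : Data ι κ R} {F G : Data ι κ R⟦X⟧}
    (hF : IsSymmetryFlow i₀ j₀ N F) (hG : IsSymmetryFlow i₀ j₀ N G) : F = G := by
  have hΩ₀ : F.Ω i₀ j₀ = G.Ω i₀ j₀ := by
    refine eq_of_ds ((hF.init_Ω _ _).trans (hG.init_Ω _ _).symm)
      ⟨F.Ω i₀ j₀ + G.Ω i₀ j₀, ?_⟩
    rw [hF.flow_Ω, hG.flow_Ω]
    ring
  have hΩi : ∀ i, F.Ω i j₀ = G.Ω i j₀ := fun i => by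
    refine eq_of_ds ((hF.init_Ω _ _).trans (hG.init_Ω _ _).symm) ⟨G.Ω i₀ j₀, ?_⟩
    rw [hF.flow_Ω, hG.flow_Ω, hΩ₀]
    ring
  have hΩj : ∀ j, F.Ω i₀ j = G.Ω i₀ j := fun j => by
    refine eq_of_ds ((hF.init_Ω _ _).trans (hG.init_Ω _ _).symm) ⟨G.Ω i₀ j₀, ?_⟩
    rw [hF.flow_Ω, hG.flow_Ω, hΩ₀]
    ring
  have hf₀ : F.f i₀ = G.f i₀ := by
    refine eq_of_ds ((hF.init_f _).trans (hG.init_f _).symm) ⟨G.Ω i₀ j₀, ?_⟩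
    rw [hF.flow_f, hG.flow_f, hΩ₀]
    ring
  have hg₀ : F.g j₀ = G.g j₀ := by
    refine eq_of_ds ((hF.init_g _).trans (hG.init_g _).symm) ⟨G.Ω i₀ j₀, ?_⟩
    rw [hF.flow_g, hG.flow_g, hΩ₀]
    ring
  refine Data.ext ?_ ?_ (funext fun i => ?_) (funext fun j => ?_) ?_ ?_
    (funext fun i => funext fun j => ?_) ?_
  · refine PDO.eq_of_map_ds _ _ (hF.init_L.trans hG.init_L.symm) hF.flow_L ?_
    rw [hf₀, hg₀]
    exact hG.flow_L
  · refine PDO.eq_of_map_ds (sqOp (G.f i₀) (G.g j₀)) 0 (hF.init_W.trans hG.init_W.symm) ?_ ?_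
    · rw [hF.flow_W, hf₀, hg₀, mul_zero, sub_zero, sqOp]
    · rw [hG.flow_W, mul_zero, sub_zero, sqOp]
  · refine eq_of_ds ((hF.init_f _).trans (hG.init_f _).symm) ⟨0, ?_⟩
    rw [hF.flow_f, hG.flow_f, hΩi, hf₀]
    ring
  · refine eq_of_ds ((hF.init_g _).trans (hG.init_g _).symm) ⟨0, ?_⟩
    rw [hF.flow_g, hG.flow_g, hΩj, hg₀]
    ring
  · refine Osc.toPDO_injective (PDO.eq_of_map_ds (sqOp (G.f i₀) (G.g j₀)) 0 ?_ ?_ ?_)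
    · rw [← Osc.toPDO_map, ← Osc.toPDO_map, hF.init_ψ, hG.init_ψ]
    · rw [← Osc.toPDO_map, hF.flow_ψ, hf₀, hg₀, mul_zero, sub_zero, sqOp, Osc.toPDO_act]
    · rw [← Osc.toPDO_map, hG.flow_ψ, mul_zero, sub_zero, sqOp, Osc.toPDO_act]
  · refine Osc.toPDO_injective (PDO.eq_of_map_ds (sqOp (G.g j₀) (G.f i₀)) 0 ?_ ?_ ?_)
    · rw [← Osc.toPDO_map, ← Osc.toPDO_map, hF.init_ψs, hG.init_ψs]
    · rw [← Osc.toPDO_map, hF.flow_ψs, hf₀, hg₀, mul_zero, sub_zero, sqOp, Osc.toPDO_act]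
    · rw [← Osc.toPDO_map, hG.flow_ψs, mul_zero, sub_zero, sqOp, Osc.toPDO_act]
  · refine eq_of_ds ((hF.init_Ω _ _).trans (hG.init_Ω _ _).symm) ⟨0, ?_⟩
    rw [hF.flow_Ω, hG.flow_Ω, hΩi, hΩj]
    ring
  · refine eq_of_ds (hF.init_τ.trans hG.init_τ.symm) ⟨-G.Ω i₀ j₀, ?_⟩
    rw [hF.flow_τ, hG.flow_τ, hΩ₀]
    ring

local notation "c" => (PowerSeries.C : R →+* R⟦X⟧)

/-- The integral curve through `N`, in closed form. -/
def flow (i₀ : ι) (j₀ : κ) (N : Data ι κ R) : Data ι κ R⟦X⟧ where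
  L := dressOp (c (N.f i₀)) (c (N.g j₀)) (PowerSeries.X * geom (N.Ω i₀ j₀)) * N.L.lift *
    dressInv (c (N.f i₀)) (c (N.g j₀)) (PowerSeries.X * geom (N.Ω i₀ j₀))
  W := dressOp (c (N.f i₀)) (c (N.g j₀)) (PowerSeries.X * geom (N.Ω i₀ j₀)) * N.W.lift
  f i := c (N.f i) + PowerSeries.X * geom (N.Ω i₀ j₀) * (c (N.f i₀) * c (N.Ω i j₀))
  g j := c (N.g j) + PowerSeries.X * geom (N.Ω i₀ j₀) * (c (N.g j₀) * c (N.Ω i₀ j))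
  ψ := Osc.ofPDO 1 (dressOp (c (N.f i₀)) (c (N.g j₀)) (PowerSeries.X * geom (N.Ω i₀ j₀)) *
    N.ψ.toPDO.lift)
  -- The roles of `q` and `r` are exchanged because `ψs` is dressed by the adjoint of the inverse
  -- operator.
  ψs := Osc.ofPDO (-1) (dressOp (c (N.g j₀)) (c (N.f i₀)) (PowerSeries.X * geom (N.Ω i₀ j₀)) *
    N.ψs.toPDO.lift)
  Ω i j := c (N.Ω i j) + PowerSeries.X * geom (N.Ω i₀ j₀) * (c (N.Ω i j₀) * c (N.Ω i₀ j))
  τ := c N.τ * (1 - PowerSeries.X * c (N.Ω i₀ j₀))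

theorem map_atZero_dressOp (q r ω : R) :
    (dressOp (c q) (c r) (PowerSeries.X * geom ω)).map atZero = 1 := by
  rw [dressOp, PDO.map_add, PDO.map_atZero_mul, PDO.one_eq_C, PDO.map_C, PDO.map_C, atZero_mul,
    atZero_X, zero_mul, PDO.C_zero, zero_mul, add_zero, atZero_one]
  rfl

theorem map_atZero_dressInv (q r ω : R) :
    (dressInv (c q) (c r) (PowerSeries.X * geom ω)).map atZero = 1 := by
  rw [dressInv, PDO.map_sub, PDO.map_atZero_mul, PDO.one_eq_C, PDO.map_C, PDO.map_C, atZero_mul,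
    atZero_X, zero_mul, PDO.C_zero, mul_zero, sub_zero, atZero_one]
  rfl

/-- The derivative of `s v` is `v²`, so `G' = v² q∂⁻¹r`, which is the evolved operator `(qv)∂⁻¹(rv)`
times `G`. -/
theorem map_ds_dressOp {q r ω : R} (hω : dx ω = q * r) :
    (dressOp (c q) (c r) (PowerSeries.X * geom ω)).map ds =
      sqOp (c q * geom ω) (c r * geom ω) *
        dressOp (c q) (c r) (PowerSeries.X * geom ω) := by
  rw [sqOp_mul_dressOp (ω := c ω) (by rw [← dx_C, hω, map_mul]) dx_X (geom_mul ω), dressOp,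
    PDO.map_add, PDO.map_ds_mul, PDO.one_eq_C, PDO.map_C, PDO.map_C, ds_one, ds_X_mul_geom,
    ← PDO.lift_sqOp, PDO.map_ds_lift, mul_zero, PDO.C_zero, zero_add, add_zero]

/-- Obtained by differentiating `G H = 1` and cancelling `G` with `H G = 1`. -/
theorem map_ds_dressInv {q r ω : R} (hω : dx ω = q * r) :
    (dressInv (c q) (c r) (PowerSeries.X * geom ω)).map ds =
      -(dressInv (c q) (c r) (PowerSeries.X * geom ω) *
        sqOp (c q * geom ω) (c r * geom ω)) := by
  have hω' : dx (c ω) = c q * c r := by rw [← dx_C, hω, map_mul]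
  have h1 := dressOp_mul_dressInv hω' dx_X (geom_mul ω)
  have h2 := dressInv_mul_dressOp hω' dx_X (geom_mul ω)
  set G := dressOp (c q) (c r) (PowerSeries.X * geom ω)
  set H := dressInv (c q) (c r) (PowerSeries.X * geom ω)
  have h3 := congrArg (PDO.map ds) h1
  rw [PDO.map_ds_mul, map_ds_dressOp hω, PDO.one_eq_C, PDO.map_C, ds_one, PDO.C_zero] at h3
  calc H.map ds = (H * G) * H.map ds := by rw [h2, one_mul]
    _ = H * (sqOp (c q * geom ω) (c r * geom ω) * G * H + G * H.map ds)
        - H * sqOp (c q * geom ω) (c r * geom ω) * (G * H) := by noncomm_ring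
    _ = _ := by rw [h3, h1]; noncomm_ring

theorem flow_f_self (i₀ : ι) (j₀ : κ) (N : Data ι κ R) :
    (flow i₀ j₀ N).f i₀ = c (N.f i₀) * geom (N.Ω i₀ j₀) := by
  simp only [flow]
  linear_combination c (N.f i₀) * geom_eq (N.Ω i₀ j₀)

theorem flow_g_self (i₀ : ι) (j₀ : κ) (N : Data ι κ R) :
    (flow i₀ j₀ N).g j₀ = c (N.g j₀) * geom (N.Ω i₀ j₀) := by
  simp only [flow]
  linear_combination c (N.g j₀) * geom_eq (N.Ω i₀ j₀)

theorem flow_Ω_left (i₀ : ι) (j₀ : κ) (N : Data ι κ R) (i : ι) :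
    (flow i₀ j₀ N).Ω i j₀ = c (N.Ω i j₀) * geom (N.Ω i₀ j₀) := by
  simp only [flow]
  linear_combination c (N.Ω i j₀) * geom_eq (N.Ω i₀ j₀)

theorem flow_Ω_right (i₀ : ι) (j₀ : κ) (N : Data ι κ R) (j : κ) :
    (flow i₀ j₀ N).Ω i₀ j = c (N.Ω i₀ j) * geom (N.Ω i₀ j₀) := by
  simp only [flow]
  linear_combination c (N.Ω i₀ j) * geom_eq (N.Ω i₀ j₀)

theorem isSymmetryFlow_flow (i₀ : ι) (j₀ : κ) (N : Data ι κ R)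
    (hω : dx (N.Ω i₀ j₀) = N.f i₀ * N.g j₀) : IsSymmetryFlow i₀ j₀ N (flow i₀ j₀ N) where
  init_L := by
    simp only [flow]
    rw [PDO.map_atZero_mul, PDO.map_atZero_mul, map_atZero_dressOp, map_atZero_dressInv,
      PDO.map_atZero_lift, one_mul, mul_one]
  init_W := by
    simp only [flow]
    rw [PDO.map_atZero_mul, map_atZero_dressOp, PDO.map_atZero_lift, one_mul]
  init_f i := by simp [flow, atZero_mul, atZero_X, atZero_C]
  init_g i := by simp [flow, atZero_mul, atZero_X, atZero_C]
  init_ψ := by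
    simp only [flow]
    rw [Osc.map_ofPDO, PDO.map_atZero_mul, map_atZero_dressOp, PDO.map_atZero_lift, one_mul,
      Osc.ofPDO_toPDO]
  init_ψs := by
    simp only [flow]
    rw [Osc.map_ofPDO, PDO.map_atZero_mul, map_atZero_dressOp, PDO.map_atZero_lift, one_mul,
      Osc.ofPDO_toPDO]
  init_Ω i j := by simp [flow, atZero_mul, atZero_X, atZero_C]
  init_τ := by simp [flow, atZero_mul, atZero_X, atZero_C, atZero_one]
  flow_L := by
    rw [flow_f_self, flow_g_self, ← sqOp]
    simp only [flow]
    rw [PDO.map_ds_mul, PDO.map_ds_mul, map_ds_dressOp hω, map_ds_dressInv hω, PDO.map_ds_lift]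
    noncomm_ring
  flow_W := by
    rw [flow_f_self, flow_g_self, ← sqOp]
    simp only [flow]
    rw [PDO.map_ds_mul, map_ds_dressOp hω, PDO.map_ds_lift, mul_zero, add_zero, mul_assoc]
  flow_f i := by
    rw [flow_f_self, flow_Ω_left]
    simp only [flow]
    rw [map_add, ds_mul, ds_X_mul_geom, ds_mul, ds_C, ds_C, ds_C]
    ring
  flow_g j := by
    rw [flow_g_self, flow_Ω_right]
    simp only [flow]
    rw [map_add, ds_mul, ds_X_mul_geom, ds_mul, ds_C, ds_C, ds_C]
    ring
  flow_ψ := by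
    refine Osc.toPDO_injective ?_
    rw [flow_f_self, flow_g_self, ← sqOp, Osc.toPDO_act, Osc.toPDO_map]
    simp only [flow]
    rw [Osc.toPDO_ofPDO, PDO.map_ds_mul, map_ds_dressOp hω, PDO.map_ds_lift, mul_zero, add_zero,
      mul_assoc]
  flow_ψs := by
    refine Osc.toPDO_injective ?_
    rw [flow_f_self, flow_g_self, ← sqOp, Osc.toPDO_act, Osc.toPDO_map]
    simp only [flow]
    rw [Osc.toPDO_ofPDO, PDO.map_ds_mul, map_ds_dressOp (by rw [hω, mul_comm]), PDO.map_ds_lift,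
      mul_zero, add_zero, mul_assoc]
  flow_Ω i j := by
    rw [flow_Ω_left, flow_Ω_right]
    simp only [flow]
    rw [map_add, ds_mul, ds_X_mul_geom, ds_mul, ds_C, ds_C, ds_C]
    ring
  flow_τ := by
    rw [flow_Ω_left]
    simp only [flow]
    rw [ds_mul, map_sub, ds_mul, ds_one, ds_X, ds_C, ds_C]
    linear_combination c (N.Ω i₀ j₀) * c N.τ * geom_mul (N.Ω i₀ j₀)

end Flow

/-! ### Convergence at `s = 1` -/

section Convergence

variable {R : Type*} [CommRing R] [Algebra ℚ R] [TimeAlgebra R] [TopologicalSpace R]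
  [IsTopologicalRing R]

local notation "c" => (PowerSeries.C : R →+* R⟦X⟧)

theorem SumsTo.unique [T2Space R] {F : R⟦X⟧} {a b : R} (h₁ : SumsTo F a) (h₂ : SumsTo F b) :
    a = b := HasSum.unique h₁ h₂

theorem SumsTo.add {F G : R⟦X⟧} {a b : R} (h₁ : SumsTo F a) (h₂ : SumsTo G b) :
    SumsTo (F + G) (a + b) := by
  simpa only [SumsTo, _root_.map_add] using HasSum.add h₁ h₂

theorem SumsTo.neg {F : R⟦X⟧} {a : R} (h₁ : SumsTo F a) : SumsTo (-F) (-a) := by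
  simpa only [SumsTo, _root_.map_neg] using HasSum.neg h₁

theorem SumsTo.sub {F G : R⟦X⟧} {a b : R} (h₁ : SumsTo F a) (h₂ : SumsTo G b) :
    SumsTo (F - G) (a - b) := by
  simpa only [SumsTo, _root_.map_sub] using HasSum.sub h₁ h₂

theorem SumsTo.C_mul {F : R⟦X⟧} {a : R} (b : R) (h₁ : SumsTo F a) : SumsTo (c b * F) (b * a) := by
  simpa only [SumsTo, PowerSeries.coeff_C_mul] using HasSum.mul_left b h₁

theorem SumsTo.mul_C {F : R⟦X⟧} {a : R} (b : R) (h₁ : SumsTo F a) : SumsTo (F * c b) (a * b) := by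
  rw [mul_comm, mul_comm a]
  exact h₁.C_mul b

/-- Evaluation takes place at `s = 1`, so a shift of the coefficients does not change the sum. -/
theorem SumsTo.X_mul {F : R⟦X⟧} {a : R} (h₁ : SumsTo F a) : SumsTo (PowerSeries.X * F) a := by
  have h : HasSum (fun m : ℕ => PowerSeries.coeff (m + 1) (PowerSeries.X * F)) a := by
    simp only [PowerSeries.coeff_succ_X_mul]
    exact h₁
  have h2 := (hasSum_nat_add_iff (f := fun m => PowerSeries.coeff m (PowerSeries.X * F)) 1).1 h
  rwa [Finset.sum_range_one, PowerSeries.coeff_zero_X_mul, add_zero] at h2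

theorem sumsTo_C (a : R) : SumsTo (c a) a := by
  have h := hasSum_ite_eq (0 : ℕ) a
  simpa only [SumsTo, PowerSeries.coeff_C] using h

theorem sumsTo_sum {α : Type*} {s : Finset α} {F : α → R⟦X⟧} {a : α → R}
    (h : ∀ i ∈ s, SumsTo (F i) (a i)) : SumsTo (∑ i ∈ s, F i) (∑ i ∈ s, a i) := by
  simpa only [SumsTo, map_sum] using hasSum_sum h

/-- The coefficients of `F` sum to those of `A`. -/
def PDO.SumsTo (F : PDO R⟦X⟧) (A : PDO R) : Prop := ∀ k, KP.SumsTo (F.coeff k) (A.coeff k)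

namespace PDO

variable {F G : PDO R⟦X⟧} {A B : PDO R}

theorem SumsTo.unique [T2Space R] (h₁ : F.SumsTo A) (h₂ : F.SumsTo B) : A = B :=
  PDO.ext (funext fun k => (h₁ k).unique (h₂ k))

theorem SumsTo.add (h₁ : F.SumsTo A) (h₂ : G.SumsTo B) : (F + G).SumsTo (A + B) :=
  fun k => (h₁ k).add (h₂ k)

theorem SumsTo.sub (h₁ : F.SumsTo A) (h₂ : G.SumsTo B) : (F - G).SumsTo (A - B) :=
  fun k => (h₁ k).sub (h₂ k)

theorem SumsTo.X_mul (h : F.SumsTo A) : (C PowerSeries.X * F).SumsTo A := fun k => by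
  rw [coeff_C_mul]
  exact (h k).X_mul

theorem SumsTo.C_mul (h : F.SumsTo A) (a : R) : (C (c a) * F).SumsTo (C a * A) := fun k => by
  rw [coeff_C_mul, coeff_C_mul]
  exact (h k).C_mul a

theorem sumsTo_lift (A : PDO R) : A.lift.SumsTo A := fun k => sumsTo_C (A.coeff k)

/-- Only one factor depends on `s`, so each coefficient is a finite combination of convergent series
with fixed coefficients in `R`. -/
theorem SumsTo.mul_lift (h : F.SumsTo A) (B : PDO R) : (F * B.lift).SumsTo (A * B) := fun k => by
  obtain ⟨M, hF⟩ := F.exists_ordLE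
  obtain ⟨M', hA⟩ := A.exists_ordLE
  obtain ⟨K, hB⟩ := B.exists_ordLE
  have hB' : B.lift.OrdLE K := hB.map _
  rw [coeff_mul_eq_sum (hF.mono (le_max_left M M')) hB',
    coeff_mul_eq_sum (hA.mono (le_max_right M M')) hB]
  refine sumsTo_sum fun p _ => ?_
  have h1 : dx^[p.2] (B.lift.coeff (k - p.1 + p.2)) = c (dx^[p.2] (B.coeff (k - p.1 + p.2))) :=
    (iterate_dx_of_comm (PowerSeries.C (R := R)).toAddMonoidHom dx_C _ _).symm
  rw [h1, ← map_zsmul]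
  exact (h p.1).mul_C _

end PDO

/-- Summing both sides of `1 + ω s v = v` gives `1 + ω a = a`. -/
theorem isUnit_of_sumsTo_geom [T2Space R] {ω a : R} (h : SumsTo (geom ω) a) :
    a * (1 - ω) = 1 := by
  have h1 : SumsTo (c 1 + c ω * (PowerSeries.X * geom ω)) (1 + ω * a) :=
    (sumsTo_C 1).add (h.X_mul.C_mul ω)
  rw [map_one, geom_eq] at h1
  linear_combination h.unique h1

/-- The additive group of the series `F` for which `F (1 - ω s)ʲ` is a polynomial for some `j`. -/
def ratSeries (ω : R) : AddSubgroup R⟦X⟧ where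
  carrier := {F | ∃ (j : ℕ) (P : Polynomial R), F = P * geom ω ^ j}
  zero_mem' := ⟨0, 0, by simp⟩
  add_mem' := by
    rintro F G ⟨j, P, rfl⟩ ⟨k, Q, rfl⟩
    -- Common denominator: `geom ω` is the inverse of `1 - ωs`.
    refine ⟨j + k, P * (1 - Polynomial.X * Polynomial.C ω) ^ k +
      Q * (1 - Polynomial.X * Polynomial.C ω) ^ j, ?_⟩
    have h : ∀ n : ℕ, geom ω ^ n * (1 - PowerSeries.X * PowerSeries.C ω) ^ n = 1 := fun n => by
      rw [← mul_pow, geom_mul, one_pow]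
    push_cast
    rw [pow_add]
    linear_combination (-(P * geom ω ^ j)) * h k - (Q * geom ω ^ k) * h j
  neg_mem' := by
    rintro F ⟨j, P, rfl⟩
    exact ⟨j, -P, by simp⟩

theorem mul_mem_ratSeries {ω : R} (F : R⟦X⟧) (hF : F ∈ ratSeries ω) (G : R⟦X⟧)
    (hG : G ∈ ratSeries ω) : F * G ∈ ratSeries ω := by
  obtain ⟨j, P, rfl⟩ := hF
  obtain ⟨k, Q, rfl⟩ := hG
  exact ⟨j + k, P * Q, by push_cast; ring⟩

theorem coe_mem_ratSeries (ω : R) (P : Polynomial R) : (P : R⟦X⟧) ∈ ratSeries ω := ⟨0, P, by simp⟩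

theorem C_mem_ratSeries (ω a : R) : c a ∈ ratSeries ω := by
  simpa using coe_mem_ratSeries ω (Polynomial.C a)

theorem X_mem_ratSeries (ω : R) : PowerSeries.X ∈ ratSeries ω := by
  simpa using coe_mem_ratSeries ω Polynomial.X

theorem geom_mem_ratSeries (ω : R) : geom ω ∈ ratSeries ω := ⟨1, 1, by simp⟩

/-- Closure under `∂` makes products of operators with such coefficients stay in the same class; the
essential case is `∂v = s ω_x v²`. -/
theorem dx_mem_ratSeries {ω : R} (F : R⟦X⟧) (hF : F ∈ ratSeries ω) : dx F ∈ ratSeries ω := by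
  obtain ⟨j, P, rfl⟩ := hF
  have hg : dx (geom ω) ∈ ratSeries ω := by
    have h : dx (geom ω) = PowerSeries.X * geom ω * geom ω * c (dx ω) := by
      have h1 := congrArg dx (geom_mul ω)
      simp only [Derivation.leibniz, _root_.map_sub, Derivation.map_one_eq_zero, smul_eq_mul, dx_X,
        ← dx_C] at h1
      linear_combination geom ω * h1 - dx (geom ω) * geom_mul ω
    rw [h]
    exact mul_mem_ratSeries _ (mul_mem_ratSeries _ (mul_mem_ratSeries _ (X_mem_ratSeries ω) _
      (geom_mem_ratSeries ω)) _ (geom_mem_ratSeries ω)) _ (C_mem_ratSeries ω _)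
  have hP : dx (P : R⟦X⟧) ∈ ratSeries ω := by
    induction P using Polynomial.induction_on' with
    | add P Q hP hQ =>
      rw [Polynomial.coe_add, _root_.map_add]
      exact add_mem hP hQ
    | monomial n a =>
      have h : ((Polynomial.monomial n a : Polynomial R) : R⟦X⟧) = c a * PowerSeries.X ^ n := by
        rw [← Polynomial.C_mul_X_pow_eq_monomial]
        simp
      have h' : dx (c a * PowerSeries.X ^ n) =
          ((Polynomial.monomial n (dx a) : Polynomial R) : R⟦X⟧) := by
        rw [Derivation.leibniz, Derivation.leibniz_pow, dx_X, ← dx_C,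
          ← Polynomial.C_mul_X_pow_eq_monomial, smul_zero, smul_zero, smul_zero, zero_add]
        simp only [smul_eq_mul, Polynomial.coe_mul, Polynomial.coe_C,
          Polynomial.coe_pow, Polynomial.coe_X, mul_comm]
      rw [h, h']
      exact coe_mem_ratSeries ω _
  have hpow : ∀ n : ℕ, geom ω ^ n ∈ ratSeries ω := fun n => ⟨n, 1, by simp⟩
  rw [Derivation.leibniz, Derivation.leibniz_pow]
  simp only [smul_eq_mul]
  exact add_mem (mul_mem_ratSeries _ (coe_mem_ratSeries ω P) _
    (nsmul_mem (mul_mem_ratSeries _ (hpow _) _ hg) _)) (mul_mem_ratSeries _ (hpow _) _ hP)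

/-- Since `(j+1) v^(j+2) = s d/ds v^(j+1) + (j+1) v^(j+1)`, passing to the next power multiplies the
`m`-th coefficient by `(m + j + 1)/(j + 1)`. The extra factor `m` is absorbed by the weight `mᵏ`,
which is why the induction is over all `k` at once. -/
theorem summable_pow_mul_coeff_geom_pow {ω : R}
    (h : ∀ k : ℕ, Summable fun m : ℕ => (m : R) ^ k * ω ^ m) (j : ℕ) (k : ℕ) :
    Summable fun m : ℕ => (m : R) ^ k * PowerSeries.coeff m (geom ω ^ (j + 1)) := by
  induction j generalizing k with
  | zero => simpa [geom] using h k
  | succ j ih =>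
    have h1 : (j + 1 : R⟦X⟧) * geom ω ^ (j + 2) =
        PowerSeries.X * ds (geom ω ^ (j + 1)) + (j + 1 : R⟦X⟧) * geom ω ^ (j + 1) := by
      have h2 : ds (geom ω ^ (j + 1)) = (j + 1 : R⟦X⟧) * geom ω ^ j * ds (geom ω) := by
        rw [ds_apply, Derivation.leibniz_pow, ds_apply]
        simp [mul_assoc]
      rw [h2, ds_geom]
      linear_combination (-(j + 1 : R⟦X⟧)) * geom ω ^ (j + 1) * geom_eq ω
    have h2 : ∀ m : ℕ, ((j : R) + 1) * PowerSeries.coeff m (geom ω ^ (j + 2)) =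
        (m + (j + 1)) * PowerSeries.coeff m (geom ω ^ (j + 1)) := fun m => by
      have h3 := congrArg (PowerSeries.coeff m) h1
      rw [show ((j : R⟦X⟧) + 1) = c ((j : R) + 1) by simp, PowerSeries.coeff_C_mul,
        _root_.map_add, PowerSeries.coeff_C_mul] at h3
      rw [h3]
      cases m with
      | zero => simp
      | succ m =>
        rw [PowerSeries.coeff_succ_X_mul, ds_apply, PowerSeries.coeff_derivative]
        push_cast
        ring
    have h4 : algebraMap ℚ R ((j : ℚ) + 1)⁻¹ * ((j : R) + 1) = 1 := by
      rw [show (j : R) + 1 = algebraMap ℚ R ((j : ℚ) + 1) by simp, ← _root_.map_mul,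
        inv_mul_cancel₀ (by positivity), map_one]
    have h5 := (((ih (k + 1)).add ((ih k).mul_left ((j : R) + 1))).mul_left
      (algebraMap ℚ R ((j : ℚ) + 1)⁻¹))
    refine h5.congr fun m => ?_
    linear_combination (-(algebraMap ℚ R ((j : ℚ) + 1)⁻¹ * m ^ k)) * h2 m
      + (m ^ k * PowerSeries.coeff m (geom ω ^ (j + 2))) * h4

theorem exists_sumsTo_of_mem_ratSeries {ω : R}
    (h : ∀ k : ℕ, Summable fun m : ℕ => (m : R) ^ k * ω ^ m) {F : R⟦X⟧} (hF : F ∈ ratSeries ω) :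
    ∃ a, SumsTo F a := by
  obtain ⟨j, P, rfl⟩ := hF
  have hg : ∃ a, SumsTo (geom ω ^ j) a := by
    cases j with
    | zero => exact ⟨1, by simpa using sumsTo_C (1 : R)⟩
    | succ j =>
      have h1 := summable_pow_mul_coeff_geom_pow h j 0
      simp only [pow_zero, one_mul] at h1
      exact h1
  obtain ⟨g, hg⟩ := hg
  induction P using Polynomial.induction_on' with
  | add P Q hP hQ =>
    obtain ⟨a, ha⟩ := hP
    obtain ⟨b, hb⟩ := hQ
    exact ⟨a + b, by simpa [add_mul] using ha.add hb⟩
  | monomial n a =>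
    refine ⟨a * g, ?_⟩
    have h1 : ∀ n : ℕ, SumsTo (PowerSeries.X ^ n * geom ω ^ j) g := fun n => by
      induction n with
      | zero => simpa using hg
      | succ n ih => simpa only [pow_succ', mul_assoc] using ih.X_mul
    rw [← Polynomial.C_mul_X_pow_eq_monomial]
    simpa [mul_assoc] using (h1 n).C_mul a

theorem PDO.exists_sumsTo {ω : R} (h : ∀ k : ℕ, Summable fun m : ℕ => (m : R) ^ k * ω ^ m)
    {F : PDO R⟦X⟧} (hF : ∀ k, F.coeff k ∈ ratSeries ω) : ∃ A : PDO R, F.SumsTo A := by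
  choose a ha using fun k => exists_sumsTo_of_mem_ratSeries h (hF k)
  obtain ⟨M, hM⟩ := F.exists_ordLE
  -- Above the order of `F` all series vanish and sum to `0`; the cut-off makes the limit visibly of
  -- bounded order.
  refine ⟨⟨fun k => if k ≤ M then a k else 0, M, fun k hk => if_neg (by omega)⟩, fun k => ?_⟩
  by_cases hk : k ≤ M
  · simpa only [if_pos hk] using ha k
  · rw [hM k (by omega)]
    simpa only [if_neg hk, map_zero] using sumsTo_C (0 : R)

theorem PDO.mul_mem_ratSeries {ω : R} {F G : PDO R⟦X⟧} (hF : ∀ k, F.coeff k ∈ ratSeries ω)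
    (hG : ∀ k, G.coeff k ∈ ratSeries ω) (k : ℤ) : (F * G).coeff k ∈ ratSeries ω :=
  PDO.coeff_mul_mem KP.mul_mem_ratSeries dx_mem_ratSeries hF hG k

theorem PDO.lift_mem_ratSeries (ω : R) (A : PDO R) (k : ℤ) : A.lift.coeff k ∈ ratSeries ω :=
  C_mem_ratSeries ω _

theorem PDO.C_mem_ratSeries {ω : R} {F : R⟦X⟧} (hF : F ∈ ratSeries ω) (k : ℤ) :
    (PDO.C F).coeff k ∈ ratSeries ω := by
  rw [PDO.coeff_C]
  split_ifs
  · exact hF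
  · exact zero_mem _

theorem X_mul_geom_mem_ratSeries (ω : R) : PowerSeries.X * geom ω ∈ ratSeries ω :=
  mul_mem_ratSeries _ (X_mem_ratSeries ω) _ (geom_mem_ratSeries ω)

theorem dressOp_mem_ratSeries (q r ω : R) (k : ℤ) :
    (dressOp (c q) (c r) (PowerSeries.X * geom ω)).coeff k ∈ ratSeries ω := by
  rw [dressOp, PDO.coeff_add, ← PDO.lift_sqOp]
  refine add_mem ?_ (PDO.mul_mem_ratSeries (PDO.C_mem_ratSeries (X_mul_geom_mem_ratSeries ω))
    (PDO.lift_mem_ratSeries ω _) k)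
  exact PDO.C_mem_ratSeries (by simpa using KP.C_mem_ratSeries ω 1) k

theorem dressInv_mem_ratSeries (q r ω : R) (k : ℤ) :
    (dressInv (c q) (c r) (PowerSeries.X * geom ω)).coeff k ∈ ratSeries ω := by
  rw [dressInv, PDO.coeff_sub, ← PDO.lift_sqOp]
  refine sub_mem ?_ (PDO.mul_mem_ratSeries (PDO.lift_mem_ratSeries ω _)
    (PDO.C_mem_ratSeries (X_mul_geom_mem_ratSeries ω)) k)
  exact PDO.C_mem_ratSeries (by simpa using KP.C_mem_ratSeries ω 1) k

theorem Osc.exists_sumsTo_ofPDO {ω : R} {ε : ℤˣ}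
    (h : ∀ k : ℕ, Summable fun m : ℕ => (m : R) ^ k * ω ^ m) {F : PDO R⟦X⟧}
    (hF : ∀ k, F.coeff k ∈ ratSeries ω) :
    ∃ f : Osc ε R, ∀ k, SumsTo ((Osc.ofPDO ε F).coeff k) (f.coeff k) := by
  obtain ⟨A, hA⟩ := PDO.exists_sumsTo h hF
  refine ⟨Osc.ofPDO ε A, fun k => ?_⟩
  rcases Int.units_eq_one_or (ε ^ k) with h1 | h1
  · simpa [Osc.ofPDO, h1] using hA k
  · simpa [Osc.ofPDO, h1] using (hA k).neg

variable {ι κ : Type*}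

theorem exists_sumsTo_flow (i₀ : ι) (j₀ : κ) (N : Data ι κ R)
    (h : ∀ k : ℕ, Summable fun m : ℕ => (m : R) ^ k * N.Ω i₀ j₀ ^ m) :
    ∃ N' : Data ι κ R, Data.SumsTo (flow i₀ j₀ N) N' := by
  have hc := fun a => KP.C_mem_ratSeries (N.Ω i₀ j₀) a
  have hs : ∀ a b d : R, c a + PowerSeries.X * geom (N.Ω i₀ j₀) * (c b * c d) ∈
      ratSeries (N.Ω i₀ j₀) := fun a b d => add_mem (hc a)
    (KP.mul_mem_ratSeries _ (X_mul_geom_mem_ratSeries _) _ (KP.mul_mem_ratSeries _ (hc b) _ (hc d)))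
  obtain ⟨W, hW⟩ := PDO.exists_sumsTo h (F := (flow i₀ j₀ N).W)
    (PDO.mul_mem_ratSeries (dressOp_mem_ratSeries _ _ _) (PDO.lift_mem_ratSeries _ _))
  obtain ⟨L, hL⟩ := PDO.exists_sumsTo h (F := (flow i₀ j₀ N).L)
    (PDO.mul_mem_ratSeries (PDO.mul_mem_ratSeries (dressOp_mem_ratSeries _ _ _)
      (PDO.lift_mem_ratSeries _ _)) (dressInv_mem_ratSeries _ _ _))
  obtain ⟨ψ, hψ⟩ : ∃ ψ : Osc 1 R, ∀ k, SumsTo ((flow i₀ j₀ N).ψ.coeff k) (ψ.coeff k) :=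
    Osc.exists_sumsTo_ofPDO h
    (PDO.mul_mem_ratSeries (dressOp_mem_ratSeries _ _ _) (PDO.lift_mem_ratSeries _ _))
  obtain ⟨ψs, hψs⟩ : ∃ ψ : Osc (-1) R, ∀ k, SumsTo ((flow i₀ j₀ N).ψs.coeff k) (ψ.coeff k) :=
    Osc.exists_sumsTo_ofPDO h
    (PDO.mul_mem_ratSeries (dressOp_mem_ratSeries _ _ _) (PDO.lift_mem_ratSeries _ _))
  choose f hf using fun i => exists_sumsTo_of_mem_ratSeries h
    (F := (flow i₀ j₀ N).f i) (hs _ _ _)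
  choose g hg using fun i => exists_sumsTo_of_mem_ratSeries h
    (F := (flow i₀ j₀ N).g i) (hs _ _ _)
  choose Ω hΩ using fun i j => exists_sumsTo_of_mem_ratSeries h
    (F := (flow i₀ j₀ N).Ω i j) (hs _ _ _)
  obtain ⟨τ, hτ⟩ := exists_sumsTo_of_mem_ratSeries h (F := (flow i₀ j₀ N).τ)
    (KP.mul_mem_ratSeries _ (hc _) _ (sub_mem (by simpa using hc 1)
      (KP.mul_mem_ratSeries _ (X_mem_ratSeries _) _ (hc _))))
  exact ⟨⟨L, W, f, g, ψ, ψs, Ω, τ⟩, hL, hW, hf, hg, hψ, hψs, hΩ, hτ⟩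

end Convergence

/-! ### Constants, powers of conjugates and the formal adjoint -/

namespace PDO

variable {R : Type*} [CommRing R] [Algebra ℚ R] [TimeAlgebra R]

theorem C_mul_comm_of_dx_eq_zero {s : R} (hs : dx s = 0) (A : PDO R) : C s * A = A * C s := by
  ext k
  obtain ⟨M, hA⟩ := A.exists_ordLE
  rw [coeff_C_mul]
  by_cases hk : M < k
  · have h : (A * C s).OrdLE (M + 0) := hA.mul (ordLE_C s)
    rw [h k (by omega), hA k hk, mul_zero]
  obtain ⟨n, rfl⟩ : ∃ n : ℕ, k = M + 0 - n := ⟨(M - k).toNat, by omega⟩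
  rw [C, coeff_mul_monomial 0 s hA, Finset.sum_eq_single_of_mem 0 (by simp)]
  · simp [mul_comm]
  · intro l _ hl
    obtain ⟨l, rfl⟩ := Nat.exists_eq_succ_of_ne_zero hl
    rw [Function.iterate_succ_apply, hs, iterate_map_zero, smul_zero, mul_zero]

theorem conj_pow {G H : PDO R} (h : H * G = 1) (L : PDO R) (n : ℕ) (hGH : G * H = 1) :
    (G * L * H) ^ n = G * L ^ n * H := by
  induction n with
  | zero => rw [pow_zero, pow_zero, mul_one, hGH]
  | succ n ih =>
    calc (G * L * H) ^ (n + 1) = G * L ^ n * (H * G) * L * H := by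
          rw [pow_succ, ih]; noncomm_ring
      _ = _ := by rw [h, pow_succ]; noncomm_ring

/-! ### The formal adjoint -/

theorem adjoint_coeff_eq_sum {A : PDO R} {N : ℤ} (hA : A.OrdLE N) (k : ℤ) {n : ℕ}
    (hn : N < k + n) : A.adjoint.coeff k = ∑ l ∈ Finset.range n,
      (((-1 : ℤˣ) ^ (k + l) : ℤˣ) : ℤ) • Ring.choose (k + l) l • dx^[l] (A.coeff (k + l)) := by
  refine finsum_eq_sum_of_support_subset _ fun l hl => ?_
  rw [Function.mem_support] at hl
  by_contra h
  rw [Finset.coe_range, Set.mem_Iio] at h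
  exact hl (by rw [hA _ (by omega), iterate_map_zero, smul_zero, smul_zero])

theorem OrdLE.adjoint {A : PDO R} {N : ℤ} (hA : A.OrdLE N) : A.adjoint.OrdLE N := fun k hk => by
  rw [adjoint_coeff_eq_sum hA k (n := 0) (by simpa using hk), Finset.sum_range_zero]

theorem adjoint_add (A B : PDO R) : (A + B).adjoint = A.adjoint + B.adjoint := by
  ext k
  obtain ⟨N, hA, hB⟩ := exists_ordLE₂ A B
  have hn : N < k + ((N - k + 1).toNat : ℕ) := by omega
  rw [coeff_add, adjoint_coeff_eq_sum hA k hn, adjoint_coeff_eq_sum hB k hn,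
    adjoint_coeff_eq_sum (hA.add hB) k hn, ← Finset.sum_add_distrib]
  simp only [coeff_add, iterate_map_add, smul_add]

theorem adjoint_C (a : R) : (C a).adjoint = C a := by
  ext k
  rw [adjoint_coeff_eq_sum (ordLE_C a) k (n := (1 - k).toNat + 1) (by omega), coeff_C]
  split_ifs with h
  · subst h
    rw [Finset.sum_eq_single_of_mem 0 (by simp)]
    · simp [coeff_C]
    · intro l _ hl
      rw [coeff_C, if_neg (by omega), iterate_map_zero, smul_zero, smul_zero]
  · refine Finset.sum_eq_zero fun l _ => ?_
    rw [coeff_C]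
    split_ifs with h1
    · rw [h1, Ring.choose_zero_pos ℤ (by omega), zero_smul, smul_zero]
    · rw [iterate_map_zero, smul_zero, smul_zero]

theorem coeff_D_one_mul (A : PDO R) (k : ℤ) :
    (D 1 * A).coeff k = A.coeff (k - 1) + dx (A.coeff k) := by
  obtain ⟨M, hA⟩ := A.exists_ordLE
  by_cases hk : 1 + M < k
  · have h : (D 1 * A).OrdLE (1 + M) := (ordLE_D 1).mul hA
    rw [h k hk, hA _ (by omega), hA _ (by omega), map_zero, add_zero]
  obtain ⟨n, rfl⟩ : ∃ n : ℕ, k = 1 + M - n := ⟨(1 + M - k).toNat, by omega⟩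
  rw [D, coeff_monomial_mul 1 1 hA]
  have h : ∀ l : ℕ, 2 ≤ l → Ring.choose (1 : ℤ) l = 0 := fun l hl => by
    rw [show (1 : ℤ) = ((1 : ℕ) : ℤ) from rfl, Ring.choose_natCast,
      Nat.choose_eq_zero_of_lt (by omega), Nat.cast_zero]
  rw [Finset.sum_range_succ']
  cases n with
  | zero =>
    have h1 : A.coeff (1 + M - (0 : ℕ)) = 0 := hA _ (by push_cast; omega)
    rw [h1]
    simp
  | succ n =>
    rw [Finset.sum_range_succ', Finset.sum_eq_zero]
    · rw [show 1 + M - ((n + 1 : ℕ) : ℤ) - 1 = M - ((n + 1 : ℕ) - (0 : ℕ) : ℤ) by push_cast; ring,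
        show 1 + M - ((n + 1 : ℕ) : ℤ) = M - ((n + 1 : ℕ) - (0 + 1 : ℕ) : ℤ) by push_cast; ring]
      simp [add_comm]
    · intro l _
      rw [h _ (by omega), zero_smul, mul_zero]

/-- Pascal's rule for `choose (k + l + 1) (l + 1)`. One of the two resulting sums comes from the
shifted coefficient, the other from its `x`-derivative. -/
theorem coeff_adjoint_sub_one_add_dx (A : PDO R) (k : ℤ) :
    A.adjoint.coeff (k - 1) + dx (A.adjoint.coeff k) = -(A * D 1).adjoint.coeff k := by
  obtain ⟨N, hA⟩ := A.exists_ordLE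
  have hn : N + 1 < k + ((N - k + 2).toNat : ℕ) := by omega
  set n := (N - k + 2).toNat
  rw [adjoint_coeff_eq_sum hA (k - 1) (n := n + 1) (by push_cast; omega),
    adjoint_coeff_eq_sum hA k (n := n) (by omega),
    adjoint_coeff_eq_sum (N := N + 1) (hA.mul (ordLE_D 1)) k (n := n + 1) (by push_cast; omega)]
  rw [Finset.sum_range_succ', Finset.sum_range_succ', map_sum, add_right_comm,
    ← Finset.sum_add_distrib, neg_add, ← Finset.sum_neg_distrib]
  congr 1
  · refine Finset.sum_congr rfl fun l _ => ?_
    rw [coeff_mul_D, show k + ((l + 1 : ℕ) : ℤ) - 1 = k + l by push_cast; ring,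
      show k - 1 + ((l + 1 : ℕ) : ℤ) = k + l by push_cast; ring,
      show k + ((l + 1 : ℕ) : ℤ) = k + l + 1 by push_cast; ring, Ring.choose_succ_succ,
      zpow_add_one, Function.iterate_succ_apply']
    simp only [map_zsmul, Units.val_neg, mul_neg, mul_one, neg_smul, add_smul, smul_add]
    abel
  · rw [coeff_mul_D, show k - 1 + ((0 : ℕ) : ℤ) = k - 1 by simp, show k + ((0 : ℕ) : ℤ) = k by simp,
      zpow_sub_one]
    simp

/-- `(A ∂)^* = -∂ A^*` -/
theorem adjoint_mul_D_one (A : PDO R) : (A * D 1).adjoint = -(D 1 * A.adjoint) := by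
  ext k
  rw [coeff_neg, coeff_D_one_mul, coeff_adjoint_sub_one_add_dx, neg_neg]

/-- `(∂ A)^* = -A^* ∂` -/
theorem adjoint_D_one_mul (A : PDO R) : (D 1 * A).adjoint = -(A.adjoint * D 1) := by
  have h : D 1 * A = A * D 1 + A.map dx.toLinearMap.toAddMonoidHom := by
    ext k
    rw [coeff_D_one_mul, coeff_add, coeff_mul_D]
    rfl
  have h2 : (A.map dx.toLinearMap.toAddMonoidHom).adjoint =
      A.adjoint.map dx.toLinearMap.toAddMonoidHom := by
    ext k
    obtain ⟨N, hA⟩ := A.exists_ordLE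
    have hn : N < k + ((N - k + 1).toNat : ℕ) := by omega
    rw [coeff_map, adjoint_coeff_eq_sum hA k hn, adjoint_coeff_eq_sum (hA.map _) k hn, map_sum]
    refine Finset.sum_congr rfl fun l _ => ?_
    rw [map_zsmul, map_zsmul, coeff_map]
    congr 2
    exact (Function.iterate_succ_apply _ _ _).symm.trans (Function.iterate_succ_apply' _ _ _)
  rw [h, adjoint_add, adjoint_mul_D_one, h2]
  ext k
  rw [coeff_add, coeff_neg, coeff_neg, coeff_D_one_mul, coeff_mul_D]
  change -(_ + dx (A.adjoint.coeff k)) + dx (A.adjoint.coeff k) = _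
  ring

theorem coeff_neg_one_adjoint (A : PDO R) : A.adjoint.coeff (-1) = -A.coeff (-1) := by
  obtain ⟨N, hA⟩ := A.exists_ordLE
  rw [adjoint_coeff_eq_sum hA (-1) (n := (N + 1).toNat + 1) (by omega),
    Finset.sum_eq_single_of_mem 0 (by simp)]
  · simp
  · intro l _ hl
    rw [show (-1 : ℤ) + l = ((l - 1 : ℕ) : ℤ) by omega, Ring.choose_natCast,
      Nat.choose_eq_zero_of_lt (by omega), Nat.cast_zero, zero_smul, smul_zero]

end PDO

open PDO (C D)

/-! ### Adjoints of the dressing operators -/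

section Adjoint

variable {R : Type*} [CommRing R] [Algebra ℚ R] [TimeAlgebra R]

theorem ordLE_sqOp (q r : R) : (sqOp q r).OrdLE (-1) :=
  ((PDO.ordLE_C q).mul (PDO.ordLE_D (-1))).mul (PDO.ordLE_C r)

/-- `(q ∂⁻¹ r)^* = -r ∂⁻¹ q` -/
theorem adjoint_sqOp (q r : R) : (sqOp q r).adjoint = -sqOp r q := by
  -- Let `E(a)` be the defect, the left-hand side. Taking adjoints of `∂ a∂⁻¹r = ar + a'∂⁻¹r` gives
  -- `E(a) = -E(a')∂⁻¹`. Iteration bounds the order of `E(a)` by every negative integer, so it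
  -- vanishes.
  have h1 : ∀ a : R, (sqOp a r).adjoint + sqOp r a =
      -(((sqOp (dx a) r).adjoint + sqOp r (dx a)) * D (-1)) := by
    intro a
    have e1 : D 1 * sqOp a r = C (a * r) + sqOp (dx a) r := by
      calc D 1 * sqOp a r = (D 1 * C a) * D (-1) * C r := by simp only [sqOp, mul_assoc]
        _ = C a * (D 1 * D (-1)) * C r + C (dx a) * D (-1) * C r := by
          rw [PDO.D_one_mul_C]; noncomm_ring
        _ = _ := by rw [PDO.D_one_mul_D_neg_one, mul_one, PDO.C_mul, sqOp]
    have e2 := congrArg PDO.adjoint e1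
    rw [PDO.adjoint_D_one_mul, PDO.adjoint_add, PDO.adjoint_C] at e2
    have e3 : sqOp r a * D 1 = C (a * r) - sqOp r (dx a) := by
      calc sqOp r a * D 1 = C r * D (-1) * (C a * D 1) := by simp only [sqOp, mul_assoc]
        _ = C r * (D (-1) * D 1) * C a - C r * D (-1) * C (dx a) := by
          rw [← add_sub_cancel_right (C a * D 1) (C (dx a)), ← PDO.D_one_mul_C]; noncomm_ring
        _ = _ := by rw [PDO.D_neg_one_mul_D_one, mul_one, mul_comm a r, PDO.C_mul, sqOp]
    calc (sqOp a r).adjoint + sqOp r a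
        = ((sqOp a r).adjoint * D 1 + sqOp r a * D 1) * D (-1) := by
          rw [← add_mul, mul_assoc, PDO.D_one_mul_D_neg_one, mul_one]
      _ = _ := by
          rw [e3, ← neg_neg ((sqOp a r).adjoint * D 1), e2]
          noncomm_ring
  have h2 : ∀ (n : ℕ) (a : R), ((sqOp a r).adjoint + sqOp r a).OrdLE (-n) := by
    intro n
    induction n with
    | zero =>
      exact fun a => ((ordLE_sqOp a r).adjoint.add (ordLE_sqOp r a)).mono (by simp)
    | succ n ih =>
      intro a k hk
      rw [h1, PDO.coeff_neg, PDO.coeff_mul_D, ih (dx a) _ (by push_cast at hk; omega), neg_zero]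
  rw [← add_eq_zero_iff_eq_neg]
  refine PDO.ext (funext fun k => ?_)
  exact h2 (k.natAbs + 1) q k (by omega)

/-- Matches `(T⁻¹)^*` with the operator by which the flow dresses the adjoint wave function. -/
theorem adjoint_dressInv (q r t : R) : (dressInv q r t).adjoint = dressOp r q t := by
  have h1 : sqOp q r * C t = sqOp q (r * t) := by rw [sqOp, sqOp, PDO.C_mul, mul_assoc]
  have h2 : C t * sqOp r q = sqOp (r * t) q := by
    rw [sqOp, sqOp, mul_comm r t, PDO.C_mul]; simp only [mul_assoc]
  have h3 : dressInv q r t = C 1 + sqOp (-q) (r * t) := by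
    rw [dressInv, h1, sqOp, sqOp, PDO.C_neg, PDO.one_eq_C]; noncomm_ring
  rw [h3, PDO.adjoint_add, PDO.adjoint_C, adjoint_sqOp, dressOp, h2, PDO.one_eq_C, sqOp, sqOp,
    PDO.C_neg]
  noncomm_ring

end Adjoint

/-! ### The binary Darboux operator -/

section Darboux

variable {R : Type*} [CommRing R] [Algebra ℚ R] [TimeAlgebra R] {q r ω v : R}

theorem inverse_eq_of_mul_eq_one {a b : R} (h : a * b = 1) : Ring.inverse a = b := by
  have h1 := Ring.inverse_mul_cancel a (IsUnit.of_mul_eq_one b h)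
  linear_combination b * h1 - Ring.inverse a * h

theorem TDadj_sub_one (q ω : R) : TDadj q (ω - 1) = Ring.inverse q * (1 - ω) := by
  rw [TDadj]
  ring

theorem TDadj_mul_eq_one (hq : IsUnit q) (hv : v * (1 - ω) = 1) :
    TDadj q (ω - 1) * (q * v) = 1 := by
  rw [TDadj_sub_one]
  linear_combination hv + (1 - ω) * v * Ring.inverse_mul_cancel q hq

theorem inverse_TDadj (hq : IsUnit q) (hv : v * (1 - ω) = 1) :
    Ring.inverse (TDadj q (ω - 1)) = q * v :=
  inverse_eq_of_mul_eq_one (TDadj_mul_eq_one hq hv)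

/-- The heart of the identification. With the constant `-1` in the potential, `r⁽¹⁾ = q⁻¹(1 - ω)`,
and the product is `q v ∂⁻¹ (1 - ω) ∂ q⁻¹`. Moving `1 - ω` to the right of `∂` leaves `1` plus a
term with `(1 - ω)' = -qr`. -/
theorem TI_mul_TD (hq : IsUnit q) (hω : dx ω = q * r) (hv : v * (1 - ω) = 1) :
    TI (TDadj q (ω - 1)) * TD q = dressOp q r v := by
  have hp := Ring.inverse_mul_cancel q hq
  rw [TI, TD, inverse_TDadj hq hv, TDadj_sub_one]
  set p := Ring.inverse q
  have h1 : C (p * (1 - ω)) * C q = C (1 - ω) := by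
    rw [← PDO.C_mul]
    congr 1
    linear_combination (1 - ω) * hp
  have h2 : C (1 - ω) * D 1 = D 1 * C (1 - ω) + C (q * r) := by
    rw [PDO.D_one_mul_C, map_sub, Derivation.map_one_eq_zero, hω, zero_sub, PDO.C_neg]
    abel
  calc C (q * v) * D (-1) * C (p * (1 - ω)) * (C q * D 1 * C p)
      = C (q * v) * D (-1) * ((C (p * (1 - ω)) * C q) * D 1) * C p := by simp only [mul_assoc]
    _ = C (q * v) * (D (-1) * D 1) * C (1 - ω) * C p + C (q * v) * D (-1) * (C (q * r) * C p) := by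
      rw [h1, h2]; noncomm_ring
    _ = C (q * v * (1 - ω) * p) + C (q * v) * D (-1) * C r := by
      rw [PDO.D_neg_one_mul_D_one, mul_one, ← PDO.C_mul, ← PDO.C_mul, ← PDO.C_mul,
        show q * r * p = r by linear_combination r * hp]
    _ = _ := by
      rw [show q * v * (1 - ω) * p = 1 by linear_combination hv + v * (1 - ω) * hp, dressOp, sqOp,
        mul_comm q v, PDO.C_mul, PDO.one_eq_C]
      simp only [mul_assoc]

/-- The product is `q∂⁻¹ v ∂ q⁻¹(1 - ω)`; here `v` is moved past `∂`, using `v' = q r v²`. -/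
theorem TDinv_mul_TIinv (hq : IsUnit q) (hω : dx ω = q * r) (hv : v * (1 - ω) = 1) :
    TDinv q * TIinv (TDadj q (ω - 1)) = dressInv q r v := by
  have hp := Ring.inverse_mul_cancel q hq
  rw [TDinv, TIinv, inverse_TDadj hq hv, TDadj_sub_one]
  set p := Ring.inverse q
  have hdv : dx v = q * r * v ^ 2 := by
    simpa using dx_of_mul_one_sub_eq_one (s := 1) hω (Derivation.map_one_eq_zero _)
      (by rw [one_mul]; exact hv)
  have h1 : C p * C (q * v) = C v := by
    rw [← PDO.C_mul]
    congr 1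
    linear_combination v * hp
  have h2 : C v * D 1 = D 1 * C v - C (q * r * v ^ 2) := by
    rw [PDO.D_one_mul_C, hdv]
    abel
  calc C q * D (-1) * C p * (C (q * v) * D 1 * C (p * (1 - ω)))
      = C q * D (-1) * ((C p * C (q * v)) * D 1) * C (p * (1 - ω)) := by simp only [mul_assoc]
    _ = C q * (D (-1) * D 1) * C v * C (p * (1 - ω)) -
          C q * D (-1) * (C (q * r * v ^ 2) * C (p * (1 - ω))) := by
      rw [h1, h2]; noncomm_ring
    _ = C (q * v * (p * (1 - ω))) - C q * D (-1) * C (r * v) := by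
      rw [PDO.D_neg_one_mul_D_one, mul_one, ← PDO.C_mul, ← PDO.C_mul, ← PDO.C_mul,
        show q * r * v ^ 2 * (p * (1 - ω)) = r * v by
          linear_combination r * v * hv + r * v * (v * (1 - ω)) * hp]
    _ = _ := by
      rw [show q * v * (p * (1 - ω)) = 1 by linear_combination hv + v * (1 - ω) * hp, dressInv,
        sqOp, PDO.C_mul, PDO.one_eq_C]
      simp only [mul_assoc]

theorem TDinv_mul_TD (hq : IsUnit q) : TDinv q * TD q = 1 := by
  have hp := Ring.inverse_mul_cancel q hq
  rw [TDinv, TD]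
  set p := Ring.inverse q
  calc C q * D (-1) * C p * (C q * D 1 * C p)
      = C q * D (-1) * (C p * C q) * D 1 * C p := by simp only [mul_assoc]
    _ = C q * (D (-1) * D 1) * C p := by
      rw [← PDO.C_mul, hp, ← PDO.one_eq_C, mul_one]; simp only [mul_assoc]
    _ = 1 := by
      rw [PDO.D_neg_one_mul_D_one, mul_one, ← PDO.C_mul, mul_comm, hp, PDO.one_eq_C]

theorem TD_mul_TDinv (hq : IsUnit q) : TD q * TDinv q = 1 := by
  have hp := Ring.inverse_mul_cancel q hq
  rw [TDinv, TD]
  set p := Ring.inverse q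
  calc C q * D 1 * C p * (C q * D (-1) * C p)
      = C q * D 1 * (C p * C q) * D (-1) * C p := by simp only [mul_assoc]
    _ = C q * (D 1 * D (-1)) * C p := by
      rw [← PDO.C_mul, hp, ← PDO.one_eq_C, mul_one]; simp only [mul_assoc]
    _ = 1 := by
      rw [PDO.D_one_mul_D_neg_one, mul_one, ← PDO.C_mul, mul_comm, hp, PDO.one_eq_C]

end Darboux

/-! ### Transformation of squared eigenfunction potentials -/

section SEP

variable {R : Type*} [CommRing R] [Algebra ℚ R] [TimeAlgebra R]

/-- Without the projection, the residue contains `Lⁿ` itself, which behaves well under conjugation;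
the brackets are the pieces that dressing operators act on. -/
theorem isSEP_iff {L : PDO R} {f g a : R} : IsSEP L f g a ↔ dx a = f * g ∧
    ∀ n : ℕ+, dt n a = ((D (-1) * C g) * L ^ (n : ℕ) * (C f * D (-1))).res := by
  simp only [IsSEP, PDO.res_sep]
  simp only [mul_assoc]

theorem D_mul_C_mul_D {w a : R} (h : dx w = a) :
    D (-1) * C a * D (-1) = C w * D (-1) - D (-1) * C w := by
  rw [← h, PDO.D_neg_one_mul_C_dx_mul_D_neg_one]

variable {L : PDO R} {q r ω v : R}

theorem derivation_of_mul_one_sub_eq_one (hv : v * (1 - ω) = 1) (d : Derivation ℚ R R) :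
    d v = v ^ 2 * d ω := by
  have h := congrArg d hv
  simp only [Derivation.leibniz, map_sub, Derivation.map_one_eq_zero, smul_eq_mul] at h
  linear_combination v * h - d v * hv

theorem dressInv_mul_dressOp_one (hω : dx ω = q * r) (hv : v * (1 - ω) = 1) :
    dressInv q r v * dressOp q r v = 1 := by
  simpa using dressInv_mul_dressOp (s := 1) hω (Derivation.map_one_eq_zero _)
    (by rw [one_mul]; exact hv)

theorem dressOp_mul_dressInv_one (hω : dx ω = q * r) (hv : v * (1 - ω) = 1) :
    dressOp q r v * dressInv q r v = 1 := by
  simpa using dressOp_mul_dressInv (s := 1) hω (Derivation.map_one_eq_zero _)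
    (by rw [one_mul]; exact hv)

/-- The dressing operators are absorbed into the outer factors: `H f^{[1]} ∂⁻¹ = f∂⁻¹ + q∂⁻¹ (v d)`
and `∂⁻¹ g^{[1]} G = ∂⁻¹g + (v b) ∂⁻¹r`. The residue then becomes a combination of the four known
residues, with coefficients that match the Leibniz rule for `a + v d b`, since `v` has time
derivative `v²` times that of `ω`. -/
theorem IsSEP.dress {f g a b d : R} (hω : IsSEP L q r ω) (hv : v * (1 - ω) = 1)
    (ha : IsSEP L f g a) (hb : IsSEP L q g b) (hd : IsSEP L f r d) :
    IsSEP (dressOp q r v * L * dressInv q r v) (f + v * (q * d)) (g + v * (r * b))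
      (a + v * (d * b)) := by
  rw [isSEP_iff] at *
  have hdv := derivation_of_mul_one_sub_eq_one hv
  refine ⟨?_, fun n => ?_⟩
  · simp only [map_add, Derivation.leibniz, smul_eq_mul, hdv, hω.1, ha.1, hb.1, hd.1]
    ring
  -- So `v d` is the transform of `Ω(f,r)`, up to the factor `v` in `r v`; this primitive lets `∂⁻¹
  -- · ∂⁻¹` be resolved.
  have hw : dx (v * d) = r * v * (f + v * (q * d)) := by
    simp only [Derivation.leibniz, smul_eq_mul, hdv, hω.1, hd.1]
    ring
  have hw' : dx (v * b) = (g + v * (r * b)) * (v * q) := by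
    simp only [Derivation.leibniz, smul_eq_mul, hdv, hω.1, hb.1]
    ring
  have e1 : dressInv q r v * (C (f + v * (q * d)) * D (-1)) =
      C f * D (-1) + C q * D (-1) * C (v * d) := by
    calc dressInv q r v * (C (f + v * (q * d)) * D (-1))
        = C (f + v * (q * d)) * D (-1) -
            C q * (D (-1) * (C r * C v * C (f + v * (q * d))) * D (-1)) := by
          simp only [dressInv, sqOp]; noncomm_ring
      _ = C f * D (-1) + (C (v * (q * d)) - C q * C (v * d)) * D (-1)
            + C q * D (-1) * C (v * d) := by
          rw [← PDO.C_mul, ← PDO.C_mul, D_mul_C_mul_D hw, PDO.C_add]; noncomm_ring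
      _ = _ := by
          rw [← PDO.C_mul, show v * (q * d) = q * (v * d) by ring, sub_self, zero_mul, add_zero]
  have e2 : D (-1) * C (g + v * (r * b)) * dressOp q r v =
      D (-1) * C g + C (v * b) * D (-1) * C r := by
    calc D (-1) * C (g + v * (r * b)) * dressOp q r v
        = D (-1) * C (g + v * (r * b)) +
            (D (-1) * (C (g + v * (r * b)) * (C v * C q)) * D (-1)) * C r := by
          simp only [dressOp, sqOp]; noncomm_ring
      _ = D (-1) * C g + D (-1) * (C (v * (r * b)) - C (v * b) * C r)
            + C (v * b) * D (-1) * C r := by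
          rw [← PDO.C_mul, ← PDO.C_mul, D_mul_C_mul_D hw', PDO.C_add]; noncomm_ring
      _ = _ := by
          rw [← PDO.C_mul, show v * (r * b) = v * b * r by ring, sub_self, mul_zero, add_zero]
  have e3 : D (-1) * C (g + v * (r * b)) * (dressOp q r v * L * dressInv q r v) ^ (n : ℕ) *
      (C (f + v * (q * d)) * D (-1)) =
      D (-1) * C g * L ^ (n : ℕ) * (C f * D (-1)) +
      C (v * b) * (D (-1) * C r * L ^ (n : ℕ) * (C f * D (-1))) +
      D (-1) * C g * L ^ (n : ℕ) * (C q * D (-1)) * C (v * d) +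
      C (v * b) * (D (-1) * C r * L ^ (n : ℕ) * (C q * D (-1)) * C (v * d)) := by
    rw [PDO.conj_pow (dressInv_mul_dressOp_one hω.1 hv) L n (dressOp_mul_dressInv_one hω.1 hv)]
    calc _ = (D (-1) * C (g + v * (r * b)) * dressOp q r v) * L ^ (n : ℕ) *
          (dressInv q r v * (C (f + v * (q * d)) * D (-1))) := by simp only [mul_assoc]
      _ = _ := by rw [e1, e2]; noncomm_ring
  rw [e3]
  simp only [PDO.res_add, PDO.res_C_mul, PDO.res_mul_C, ← ha.2, ← hb.2, ← hd.2, ← hω.2, map_add,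
    Derivation.leibniz, smul_eq_mul, hdv]
  ring

/-- Integration by parts: the product of the two functions is `(1 - ω)(q⁻¹f)'`, with primitive `(1 -
ω)q⁻¹f + d`. For the time flows, `T_D` is absorbed into the outer factors; the terms without a left
`∂⁻¹` have residues `(Lⁿ)_{≥0}` applied to `f` and to `q`, which are time derivatives by the
eigenfunction equations. -/
theorem IsSEP.elementaryDarboux {f d : R} (hq : IsUnit q) (hqe : IsEigenfunction L q)
    (hfe : IsEigenfunction L f) (hω : IsSEP L q r ω) (hd : IsSEP L f r d) :
    IsSEP (TD q * L * TDinv q) (TDeigen q f) (TDadj q (ω - 1))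
      (Ring.inverse q * (1 - ω) * f + d) := by
  rw [isSEP_iff] at *
  have hp := Ring.inverse_mul_cancel q hq
  have hdp : ∀ d : Derivation ℚ R R, d (Ring.inverse q) = -(Ring.inverse q ^ 2 * d q) := fun d => by
    have h := congrArg d hp
    simp only [Derivation.leibniz, Derivation.map_one_eq_zero, smul_eq_mul] at h
    linear_combination Ring.inverse q * h - d (Ring.inverse q) * hp
  rw [TDeigen, TDadj_sub_one]
  refine ⟨?_, fun n => ?_⟩
  · simp only [map_add, map_sub, Derivation.map_one_eq_zero, Derivation.leibniz, smul_eq_mul, hdp,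
      hω.1, hd.1]
    linear_combination (-(f * r) - (1 - ω) * Ring.inverse q * dx f +
      (1 - ω) * Ring.inverse q ^ 2 * f * dx q) * hp
  have e1 : TDinv q * (C (q * dx (Ring.inverse q * f)) * D (-1)) =
      C f * D (-1) - C q * D (-1) * C (Ring.inverse q * f) := by
    calc TDinv q * (C (q * dx (Ring.inverse q * f)) * D (-1))
        = C q * (D (-1) * (C (Ring.inverse q) * C (q * dx (Ring.inverse q * f))) * D (-1)) := by
          simp only [TDinv]; noncomm_ring
      _ = C q * C (Ring.inverse q * f) * D (-1) - C q * D (-1) * C (Ring.inverse q * f) := by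
          rw [← PDO.C_mul, D_mul_C_mul_D (w := Ring.inverse q * f)]
          · noncomm_ring
          · linear_combination -dx (Ring.inverse q * f) * hp
      _ = _ := by
          rw [← PDO.C_mul, show q * (Ring.inverse q * f) = f by linear_combination f * hp]
  have e2 : D (-1) * C (Ring.inverse q * (1 - ω)) * TD q =
      C ((1 - ω) * Ring.inverse q) + D (-1) * C r := by
    have h2 : C (1 - ω) * D 1 = D 1 * C (1 - ω) + C (q * r) := by
      rw [PDO.D_one_mul_C, map_sub, Derivation.map_one_eq_zero, hω.1, zero_sub, PDO.C_neg]
      abel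
    calc D (-1) * C (Ring.inverse q * (1 - ω)) * TD q
        = D (-1) * ((C (Ring.inverse q * (1 - ω)) * C q) * D 1) * C (Ring.inverse q) := by
          simp only [TD, mul_assoc]
      _ = (D (-1) * D 1) * (C (1 - ω) * C (Ring.inverse q)) +
            D (-1) * (C (q * r) * C (Ring.inverse q)) := by
          rw [← PDO.C_mul, show Ring.inverse q * (1 - ω) * q = 1 - ω by
            linear_combination (1 - ω) * hp, h2]
          noncomm_ring
      _ = _ := by
          rw [PDO.D_neg_one_mul_D_one, one_mul, ← PDO.C_mul, ← PDO.C_mul,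
            show q * r * Ring.inverse q = r by linear_combination r * hp]
  have e3 : D (-1) * C (Ring.inverse q * (1 - ω)) * (TD q * L * TDinv q) ^ (n : ℕ) *
      (C (q * dx (Ring.inverse q * f)) * D (-1)) =
      C ((1 - ω) * Ring.inverse q) * (L ^ (n : ℕ) * C f * D (-1)) -
      C ((1 - ω) * Ring.inverse q) * (L ^ (n : ℕ) * C q * D (-1) * C (Ring.inverse q * f)) +
      D (-1) * C r * L ^ (n : ℕ) * (C f * D (-1)) -
      D (-1) * C r * L ^ (n : ℕ) * (C q * D (-1)) * C (Ring.inverse q * f) := by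
    rw [PDO.conj_pow (TDinv_mul_TD hq) L n (TD_mul_TDinv hq)]
    calc _ = (D (-1) * C (Ring.inverse q * (1 - ω)) * TD q) * L ^ (n : ℕ) *
          (TDinv q * (C (q * dx (Ring.inverse q * f)) * D (-1))) := by simp only [mul_assoc]
      _ = _ := by rw [e1, e2]; noncomm_ring
  rw [e3]
  simp only [PDO.res_add, PDO.res_sub, PDO.res_C_mul, PDO.res_mul_C, PDO.res_mul_C_mul_D,
    ← hqe n, ← hfe n, ← hd.2, ← hω.2, map_add, map_sub, Derivation.map_one_eq_zero,
    Derivation.leibniz, smul_eq_mul, hdp]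
  ring

end SEP

/-! ### The limit of the integral curve -/

section Limit

variable {R : Type*} [CommRing R] [Algebra ℚ R] [TimeAlgebra R] [TopologicalSpace R]
  [IsTopologicalRing R]

local notation "c" => (PowerSeries.C : R →+* R⟦X⟧)

theorem SumsTo.add_X_mul_geom {ω v : R} (h : SumsTo (geom ω) v) (a b d : R) :
    SumsTo (c a + PowerSeries.X * geom ω * (c b * c d)) (a + v * (b * d)) := by
  rw [← map_mul]
  exact (sumsTo_C a).add (h.X_mul.mul_C (b * d))

theorem SumsTo.dressOp_mul_lift {ω v : R} (h : SumsTo (geom ω) v) (q r : R) (A : PDO R) :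
    (dressOp (c q) (c r) (PowerSeries.X * geom ω) * A.lift).SumsTo (dressOp q r v * A) := by
  rw [dressOp, dressOp, add_mul, add_mul, one_mul, one_mul, ← PDO.lift_sqOp, mul_assoc, mul_assoc,
    ← PDO.lift_mul]
  refine (PDO.sumsTo_lift A).add fun k => ?_
  rw [PDO.coeff_C_mul, PDO.coeff_C_mul]
  exact h.X_mul.mul_C _

/-- `(1 - ω s) (G L G⁻¹) (1 - ω s)` is a polynomial in `s`, where
`G = 1 + s (1 - ω s)⁻¹ q ∂⁻¹ r`. -/
theorem conj_dressOp_eq (q r ω : R) (L : PDO R) :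
    C (1 - PowerSeries.X * c ω) * (dressOp (c q) (c r) (PowerSeries.X * geom ω) * L.lift *
      dressInv (c q) (c r) (PowerSeries.X * geom ω)) * C (1 - PowerSeries.X * c ω) =
    L.lift + C PowerSeries.X * ((sqOp q r - C ω) * L - L * (sqOp q r + C ω)).lift -
      C PowerSeries.X * (C PowerSeries.X *
        ((sqOp q r - C ω) * L * (sqOp q r + C ω)).lift) := by
  have hX : ∀ A : PDO R⟦X⟧, C PowerSeries.X * A = A * C PowerSeries.X :=
    PDO.C_mul_comm_of_dx_eq_zero dx_X
  have hu : C (1 - PowerSeries.X * c ω) = 1 - C PowerSeries.X * (C ω).lift := by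
    rw [PDO.C_sub, PDO.C_mul, PDO.lift_C, PDO.one_eq_C]
  have h1 : C (1 - PowerSeries.X * c ω) * dressOp (c q) (c r) (PowerSeries.X * geom ω) =
      1 + C PowerSeries.X * ((sqOp q r).lift - (C ω).lift) := by
    rw [dressOp, mul_add, ← mul_assoc, ← PDO.C_mul, mul_one, hu, ← PDO.lift_sqOp,
      show (1 - PowerSeries.X * c ω) * (PowerSeries.X * geom ω) = PowerSeries.X by
        linear_combination PowerSeries.X * geom_mul ω]
    noncomm_ring
  have h2 : dressInv (c q) (c r) (PowerSeries.X * geom ω) * C (1 - PowerSeries.X * c ω) =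
      1 - C PowerSeries.X * ((sqOp q r).lift + (C ω).lift) := by
    rw [dressInv, sub_mul, mul_assoc, ← PDO.C_mul, one_mul, hu, ← PDO.lift_sqOp,
      show PowerSeries.X * geom ω * (1 - PowerSeries.X * c ω) = PowerSeries.X by
        linear_combination PowerSeries.X * geom_mul ω, ← hX]
    noncomm_ring
  have hadd : ∀ A B : PDO R, (A + B).lift = A.lift + B.lift := PDO.map_add _
  have hsub : ∀ A B : PDO R, (A - B).lift = A.lift - B.lift := PDO.map_sub _
  have e : ∀ P Q A S : PDO R⟦X⟧, S * A = A * S → S * P = P * S →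
      (1 + S * P) * A * (1 - S * Q) = A + S * (P * A - A * Q) - S * (S * (P * A * Q)) := by
    intro P Q A S h1 h2
    calc (1 + S * P) * A * (1 - S * Q)
        = A + S * (P * A) - (A * S) * Q - S * (P * (A * S) * Q) := by noncomm_ring
      _ = A + S * (P * A) - S * A * Q - S * ((P * S) * A * Q) := by rw [← h1]; noncomm_ring
      _ = _ := by rw [← h2]; noncomm_ring
  calc _ = (C (1 - PowerSeries.X * c ω) * dressOp (c q) (c r) (PowerSeries.X * geom ω)) * L.lift *
        (dressInv (c q) (c r) (PowerSeries.X * geom ω) * C (1 - PowerSeries.X * c ω)) := by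
        simp only [mul_assoc]
    _ = _ := by
        rw [h1, h2, e _ _ _ _ (hX _) (hX _)]
        simp only [PDO.lift_mul, hadd, hsub]

/-- Both outer factors depend on `s`, and a product of two convergent series cannot be summed factor
by factor here. Multiplication by the polynomial `1 - ωs` on each side is harmless and leaves a
polynomial whose value at `s = 1` is explicit; `1 - ω` is then cancelled. -/
theorem eq_of_sumsTo_conj [T2Space R] {q r ω v : R} (hv : v * (1 - ω) = 1) {L L' : PDO R}
    (h : (dressOp (c q) (c r) (PowerSeries.X * geom ω) * L.lift *
      dressInv (c q) (c r) (PowerSeries.X * geom ω)).SumsTo L') :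
    L' = dressOp q r v * L * dressInv q r v := by
  have h1 := PDO.SumsTo.sub ((PDO.sumsTo_lift L).add
    (PDO.sumsTo_lift ((sqOp q r - C ω) * L - L * (sqOp q r + C ω))).X_mul)
    (PDO.sumsTo_lift ((sqOp q r - C ω) * L * (sqOp q r + C ω))).X_mul.X_mul
  rw [← conj_dressOp_eq] at h1
  have hX : ∀ A : PDO R⟦X⟧, C PowerSeries.X * A = A * C PowerSeries.X :=
    PDO.C_mul_comm_of_dx_eq_zero dx_X
  have hL : ∀ {F : PDO R⟦X⟧} {A : PDO R}, F.SumsTo A →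
      (C (1 - PowerSeries.X * c ω) * F).SumsTo (A - C ω * A) := fun {F A} hF => by
    rw [PDO.C_sub, PDO.C_mul, sub_mul, ← PDO.one_eq_C, one_mul, mul_assoc]
    exact hF.sub (hF.C_mul ω).X_mul
  have hR : ∀ {F : PDO R⟦X⟧} {A : PDO R}, F.SumsTo A →
      (F * C (1 - PowerSeries.X * c ω)).SumsTo (A - A * C ω) := fun {F A} hF => by
    rw [PDO.C_sub, PDO.C_mul, mul_sub, ← PDO.one_eq_C, mul_one, ← mul_assoc, ← hX, mul_assoc,
      ← PDO.lift_C]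
    exact hF.sub (hF.mul_lift _).X_mul
  have h2 := (hR (hL h)).unique h1
  have hv1 : C v * (1 - C ω) = 1 := by
    rw [PDO.one_eq_C, ← PDO.C_sub, ← PDO.C_mul, hv]
  have hv2 : (1 - C ω) * C v = 1 := by
    rw [PDO.one_eq_C, ← PDO.C_sub, ← PDO.C_mul, mul_comm, hv]
  calc L' = (C v * (1 - C ω)) * L' * ((1 - C ω) * C v) := by rw [hv1, hv2, one_mul, mul_one]
    _ = C v * (L' - C ω * L' - (L' - C ω * L') * C ω) * C v := by noncomm_ring
    _ = (C v * (1 - C ω) + C v * sqOp q r) * L * ((1 - C ω) * C v - sqOp q r * C v) := by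
      rw [h2]; noncomm_ring
    _ = _ := by rw [hv1, hv2, dressOp, dressInv]

theorem Osc.eq_of_sumsTo [T2Space R] {ε : ℤˣ} {F : PDO R⟦X⟧} {A : PDO R} {f : Osc ε R}
    (hF : F.SumsTo A) (h : ∀ k, SumsTo ((Osc.ofPDO ε F).coeff k) (f.coeff k)) :
    f = Osc.ofPDO ε A := by
  refine Osc.ext (funext fun k => (h k).unique ?_)
  rcases Int.units_eq_one_or (ε ^ k) with h1 | h1
  · simpa [Osc.ofPDO, h1] using hF k
  · simpa [Osc.ofPDO, h1] using (hF k).neg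

variable {ι κ : Type*}

/-- The curve through `q` is `q` times the geometric series, and `q` is invertible. -/
theorem exists_sumsTo_geom {i₀ : ι} {j₀ : κ} {N N' : Data ι κ R} (hq : IsUnit (N.f i₀))
    (h : Data.SumsTo (flow i₀ j₀ N) N') : ∃ v, SumsTo (geom (N.Ω i₀ j₀)) v := by
  have h1 := (h.f i₀).C_mul (Ring.inverse (N.f i₀))
  rw [flow_f_self, ← mul_assoc, ← map_mul, Ring.inverse_mul_cancel _ hq, map_one, one_mul] at h1
  exact ⟨_, h1⟩

theorem isBinaryDarboux_of_sumsTo [T2Space R] {i₀ : ι} {j₀ : κ} {N N' : Data ι κ R}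
    (hN : N.IsSolution) (hq : IsUnit (N.f i₀)) (h : Data.SumsTo (flow i₀ j₀ N) N')
    (hτ : ∀ v, v * (1 - N.Ω i₀ j₀) = 1 →
      IsTau (Osc.ofPDO 1 (dressOp (N.f i₀) (N.g j₀) v * N.W)) (N.τ * (1 - N.Ω i₀ j₀))) :
    IsBinaryDarboux i₀ j₀ (N.Ω i₀ j₀ - 1) N N' := by
  obtain ⟨v, hgeom⟩ := exists_sumsTo_geom hq h
  have hv := isUnit_of_sumsTo_geom hgeom
  have hsep := hN.sep i₀ j₀
  have hf : ∀ i, N'.f i = N.f i + v * (N.f i₀ * N.Ω i j₀) := fun i =>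
    (h.f i).unique (hgeom.add_X_mul_geom _ _ _)
  have hg : ∀ j, N'.g j = N.g j + v * (N.g j₀ * N.Ω i₀ j) := fun j =>
    (h.g j).unique (hgeom.add_X_mul_geom _ _ _)
  have hΩ : ∀ i j, N'.Ω i j = N.Ω i j + v * (N.Ω i j₀ * N.Ω i₀ j) := fun i j =>
    (h.Ω i j).unique (hgeom.add_X_mul_geom _ _ _)
  have hτ' : N'.τ = N.τ * (1 - N.Ω i₀ j₀) := by
    refine h.τ.unique (SumsTo.C_mul _ ?_)
    rw [← map_one c]
    exact (sumsTo_C 1).sub (sumsTo_C _).X_mul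
  have hW : N'.W = dressOp (N.f i₀) (N.g j₀) v * N.W :=
    PDO.SumsTo.unique h.W (hgeom.dressOp_mul_lift _ _ _)
  have hL : N'.L = dressOp (N.f i₀) (N.g j₀) v * N.L * dressInv (N.f i₀) (N.g j₀) v :=
    eq_of_sumsTo_conj hv h.L
  have hψ : N'.ψ = Osc.ofPDO 1 (dressOp (N.f i₀) (N.g j₀) v * N.ψ.toPDO) :=
    Osc.eq_of_sumsTo (hgeom.dressOp_mul_lift _ _ _) h.ψ
  have hψs : N'.ψs = Osc.ofPDO (-1) (dressOp (N.g j₀) (N.f i₀) v * N.ψs.toPDO) :=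
    Osc.eq_of_sumsTo (hgeom.dressOp_mul_lift _ _ _) h.ψs
  have hT := TI_mul_TD hq hsep.1 hv
  have hT' := TDinv_mul_TIinv hq hsep.1 hv
  have hr1 := TDadj_mul_eq_one hq hv
  refine
    { sep := ?_
      isUnit_q := hq
      isUnit_r1 := IsUnit.of_mul_eq_one _ hr1
      L := by rw [hT, hT', hL]
      W := by rw [hT, hW]
      f := fun i => ⟨_, hsep.elementaryDarboux hq (hN.eigen i₀) (hN.eigen i) (hN.sep i j₀), ?_⟩
      g := fun j => ?_
      ψ := by rw [hT, hψ, Osc.act]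
      ψs := by rw [hT', adjoint_dressInv, hψs, Osc.act]
      Ω := fun i j => ?_
      τ := ?_ }
  -- Changing `ω` by the constant `-1` affects no derivative.
  · exact ⟨by rw [map_sub, Derivation.map_one_eq_zero, sub_zero, hsep.1], fun n => by
      rw [map_sub, Derivation.map_one_eq_zero, sub_zero, hsep.2 n]⟩
  · rw [hf, TIeigen, inverse_TDadj hq hv]
    linear_combination (-N.f i) * hv
      - N.f i * v * (1 - N.Ω i₀ j₀) * Ring.inverse_mul_cancel _ hq
  · have hdv : dx v = v ^ 2 * (N.f i₀ * N.g j₀) := by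
      rw [derivation_of_mul_one_sub_eq_one hv, hsep.1]
    have h1 : N.f i₀ * v * (Ring.inverse (N.f i₀) * N.Ω i₀ j) = v * N.Ω i₀ j := by
      linear_combination v * N.Ω i₀ j * Ring.inverse_mul_cancel _ hq
    rw [hg, TIadj, inverse_TDadj hq hv, TDadj_sub_one, TDadj, mul_neg, h1, map_neg,
      Derivation.leibniz, hdv, (hN.sep i₀ j).1]
    simp only [smul_eq_mul]
    have hp := Ring.inverse_mul_cancel _ hq
    linear_combination (-(N.g j + v * (N.g j₀ * N.Ω i₀ j))) * hv
      - (v * (1 - N.Ω i₀ j₀) * (N.g j + v * (N.g j₀ * N.Ω i₀ j))) * hp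
  · rw [hL, hf, hg, hΩ]
    exact hsep.dress hv (hN.sep i j) (hN.sep i₀ j) (hN.sep i j₀)
  · rw [hτ', hψ, hN.wave, Osc.toPDO_ofPDO]
    exact hτ v hv

end Limit

/-! ### Positive and negative parts, and expansions of operators of order at most zero -/

namespace PDO

section Additive

variable {R : Type*} [CommRing R]

theorem pos_add (A B : PDO R) : (A + B).pos = A.pos + B.pos := by
  ext k; simp only [coeff_pos, coeff_add]; split_ifs <;> simp

theorem neg_add (A B : PDO R) : (A + B).neg = A.neg + B.neg := by
  ext k; simp only [coeff_negPart, coeff_add]; split_ifs <;> simp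

theorem pos_eq_zero {A : PDO R} (hA : A.OrdLE (-1)) : A.pos = 0 := by
  ext k
  rw [coeff_pos, coeff_zero]
  split_ifs
  · exact hA k (by omega)
  · rfl

theorem neg_eq_self {A : PDO R} (hA : A.OrdLE (-1)) : A.neg = A := by
  ext k
  rw [coeff_negPart]
  split_ifs
  · rfl
  · exact (hA k (by omega)).symm

theorem pos_sum {α : Type*} (s : Finset α) (A : α → PDO R) :
    (∑ i ∈ s, A i).pos = ∑ i ∈ s, (A i).pos := by
  ext k
  simp only [coeff_pos, coeff_sum]
  split_ifs
  · rfl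
  · simp

theorem pos_C (a : R) : (C a).pos = C a := by
  ext k; simp only [coeff_pos, coeff_C]; split_ifs <;> first | rfl | omega

end Additive

variable {R : Type*} [CommRing R] [Algebra ℚ R] [TimeAlgebra R]

theorem pos_C_mul (a : R) (A : PDO R) : (C a * A).pos = C a * A.pos := by
  ext k; simp only [coeff_pos, coeff_C_mul, mul_ite, mul_zero]

theorem coeff_mul_top {A B : PDO R} {M M' : ℤ} (hA : A.OrdLE M) (hB : B.OrdLE M') :
    (A * B).coeff (M + M') = A.coeff M * B.coeff M' := by
  rw [coeff_mul_eq_sum hA hB, show M + M' - M' = M by ring, Finset.Icc_self,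
    show (M + M' - (M + M') + 1).toNat = 1 by omega]
  simp

/-- As `W` is monic of order zero, a top coefficient of `V` in positive order would survive as the
top coefficient of `W V = 1`. -/
theorem ordLE_zero_of_mul_eq_one {W V : PDO R} (hW : W.OrdLE 0) (hW0 : W.coeff 0 = 1)
    (h : W * V = 1) : V.OrdLE 0 := by
  have h1 : ∀ n : ℕ, V.OrdLE n → V.OrdLE 0 := by
    intro n
    induction n with
    | zero => exact id
    | succ n ih =>
      intro hn
      refine ih fun k hk => ?_
      by_cases hk' : k = ((n + 1 : ℕ) : ℤ)
      · have h2 := coeff_mul_top hW hn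
        rw [h, hW0, one_mul, zero_add, one_eq_C, coeff_C, if_neg (by omega)] at h2
        rw [hk', ← h2]
      · exact hn k (by push_cast at hk' ⊢; omega)
  obtain ⟨N, hN⟩ := V.exists_ordLE
  exact h1 N.toNat (hN.mono (by omega))

theorem exists_eq_sum_add {A : PDO R} (hA : A.OrdLE 0) (n : ℕ) : ∃ B : PDO R,
    B.OrdLE (-(n + 1)) ∧ A = ∑ k ∈ Finset.range (n + 1), C (A.coeff (-k)) * D (-k) + B := by
  refine ⟨A - ∑ k ∈ Finset.range (n + 1), C (A.coeff (-k)) * D (-k), fun i hi => ?_, by abel⟩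
  rw [coeff_sub, coeff_sum]
  simp only [coeff_C_mul, coeff_D]
  by_cases h : 0 < i
  · rw [hA i h, zero_sub, neg_eq_zero]
    exact Finset.sum_eq_zero fun k _ => by rw [if_neg (by omega), mul_zero]
  · rw [Finset.sum_eq_single_of_mem (-i).toNat (by rw [Finset.mem_range]; omega)]
    · rw [if_pos (by omega), show -(((-i).toNat : ℕ) : ℤ) = i by omega]
      ring
    · intro k _ hk
      rw [if_neg (by omega), mul_zero]

/-- The tail of `A` below `∂⁻ⁿ` gives an operator of order at most `-2`, which has no residue. What
remains is a convolution, that is, a product of generating series in `z`. -/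
theorem res_mul_D_mul {A Q : PDO R} (hA : A.OrdLE 0) (hQ : Q.OrdLE (-1)) (n : ℕ) :
    (A * D n * Q).res =
      ∑ k ∈ Finset.range (n + 1), A.coeff (-k) * (D ((n - k : ℕ) : ℤ) * Q).res := by
  obtain ⟨B, hB, e⟩ := exists_eq_sum_add hA n
  have h0 : (B * D n * Q).res = 0 := ((hB.mul (ordLE_D n)).mul hQ) (-1) (by omega)
  conv_lhs => rw [e]
  rw [add_mul, add_mul, res_add, h0, add_zero, Finset.sum_mul, Finset.sum_mul]
  refine (coeff_sum _ _ _).trans (Finset.sum_congr rfl fun k hk => ?_)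
  rw [Finset.mem_range] at hk
  rw [mul_assoc (C _), D_mul_D, show -(k : ℤ) + n = ((n - k : ℕ) : ℤ) by omega, mul_assoc]
  exact res_C_mul _ _

theorem pos_mul_D_mul {A V : PDO R} (hA : A.OrdLE 0) (hV : V.OrdLE 0) (n : ℕ) :
    (A * D n * V).pos =
      ∑ k ∈ Finset.range (n + 1), C (A.coeff (-k)) * (D ((n - k : ℕ) : ℤ) * V).pos := by
  obtain ⟨B, hB, e⟩ := exists_eq_sum_add hA n
  have h0 : (B * D n * V).pos = 0 :=
    pos_eq_zero (((hB.mul (ordLE_D n)).mul hV).mono (by omega))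
  conv_lhs => rw [e]
  rw [add_mul, add_mul, pos_add, h0, add_zero, Finset.sum_mul, Finset.sum_mul, pos_sum]
  refine Finset.sum_congr rfl fun k hk => ?_
  rw [Finset.mem_range] at hk
  rw [mul_assoc (C _), D_mul_D, show -(k : ℤ) + n = ((n - k : ℕ) : ℤ) by omega, mul_assoc,
    pos_C_mul]

theorem posApply_add (A B : PDO R) (f : R) : (A + B).posApply f = A.posApply f + B.posApply f := by
  rw [← coeff_zero_mul_C, add_mul, coeff_add, coeff_zero_mul_C, coeff_zero_mul_C]

/-- `(∂⁻¹ g P)_- = ∂⁻¹ P^*(g)` for a differential operator `P`. -/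
theorem neg_D_mul_C_mul_pos (A : PDO R) (g : R) :
    (D (-1) * C g * A.pos).neg = D (-1) * C (A.pos.adjoint.posApply g) := by
  -- Induction on the power of `∂`: with `h = P^*(g)`, right multiplication by `∂` turns `∂⁻¹h` into
  -- `h - ∂⁻¹h'`, while `(P∂)^*(g) = -h'`. The positive part of `∂⁻¹gP` stays positive.
  have hmon : ∀ (i : ℕ) (a : R), (D (-1) * C g * (C a * D i)).neg =
      D (-1) * C ((C a * D i).adjoint.posApply g) := by
    intro i a
    induction i with
    | zero =>
      have h1 : (D (-1) * C g * C a).OrdLE (-1) :=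
        ((ordLE_D (-1)).mul (ordLE_C g)).mul (ordLE_C a)
      rw [Nat.cast_zero, ← one_eq_D, mul_one, neg_eq_self h1, adjoint_C,
        ← coeff_zero_mul_C, ← C_mul, coeff_C, if_pos rfl, mul_assoc, ← C_mul, mul_comm]
    | succ i ih =>
      have h1 : C a * D ((i + 1 : ℕ) : ℤ) = C a * D (i : ℤ) * D 1 := by
        rw [mul_assoc, D_mul_D, Nat.cast_add, Nat.cast_one]
      set P := C a * D (i : ℤ) with hP
      have h2 : P.coeff (-1) = 0 := by
        rw [hP, coeff_C_mul, coeff_D, if_neg (by omega), mul_zero]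
      have h3 : (P * D 1).adjoint.posApply g = -dx (P.adjoint.posApply g) := by
        rw [adjoint_mul_D_one, ← coeff_zero_mul_C, neg_mul, mul_assoc, coeff_neg, coeff_D_one_mul,
          ← coeff_zero_mul_C, zero_sub, coeff_neg_one_mul_C, coeff_neg_one_adjoint, h2]
        simp
      have h4 : (D (-1) * C (dx (P.adjoint.posApply g)) : PDO R).OrdLE (-1) :=
        (ordLE_D (-1)).mul (ordLE_C _)
      have h5 : ((D (-1) * C g * P).pos * D 1).neg = 0 := by
        ext k
        rw [coeff_negPart, coeff_mul_D, coeff_pos, coeff_zero]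
        split_ifs <;> first | omega | rfl
      have h6 : D (-1) * C (P.adjoint.posApply g) * D 1 =
          C (P.adjoint.posApply g) - D (-1) * C (dx (P.adjoint.posApply g)) := by
        calc _ = D (-1) * (C (P.adjoint.posApply g) * D 1 + C (dx (P.adjoint.posApply g)))
              - D (-1) * C (dx (P.adjoint.posApply g)) := by noncomm_ring
          _ = _ := by rw [← D_one_mul_C, ← mul_assoc, D_neg_one_mul_D_one, one_mul]
      have h7 : ∀ b : R, (C b).neg = 0 := fun b => by
        ext k
        rw [coeff_negPart, coeff_C, coeff_zero]
        split_ifs <;> first | omega | rfl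
      rw [h1, h3, ← mul_assoc]
      conv_lhs => rw [← pos_add_neg (D (-1) * C g * P), add_mul, neg_add, h5, zero_add, ih, h6]
      rw [sub_eq_add_neg, neg_add, h7, zero_add, C_neg, mul_neg]
      refine neg_eq_self fun k hk => ?_
      rw [coeff_neg, h4 k hk, neg_zero]
  obtain ⟨N, hN⟩ := A.exists_ordLE
  have e : A.pos = ∑ i ∈ Finset.range (N.toNat + 1), C (A.coeff i) * D (i : ℤ) := by
    ext k
    simp only [coeff_pos, coeff_sum, coeff_C_mul, coeff_D]
    split_ifs with hk
    · obtain ⟨n, rfl⟩ := Int.eq_ofNat_of_zero_le hk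
      by_cases hn : n < N.toNat + 1
      · rw [Finset.sum_eq_single_of_mem n (Finset.mem_range.2 hn)]
        · simp
        · intro i _ hi
          rw [if_neg (by omega), mul_zero]
      · rw [hN _ (by omega), Finset.sum_eq_zero]
        intro i hi
        rw [Finset.mem_range] at hi
        rw [if_neg (by omega), mul_zero]
    · exact (Finset.sum_eq_zero fun i _ => by rw [if_neg (by omega), mul_zero]).symm
  rw [e]
  induction Finset.range (N.toNat + 1) using Finset.induction_on with
  | empty =>
    have h0 : (0 : PDO R) = C 0 := C_zero.symm
    rw [Finset.sum_empty, mul_zero, h0, adjoint_C, ← coeff_zero_mul_C, ← C_mul, zero_mul, coeff_C,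
      if_pos rfl, C_zero, mul_zero, neg_eq_self fun k _ => rfl]
  | insert i s hi ih =>
    rw [Finset.sum_insert hi, mul_add, neg_add, hmon, ih, adjoint_add, posApply_add, C_add, mul_add]

end PDO

/-! ### Miwa shifts -/

section Miwa

variable {R : Type*} [CommRing R] [Algebra ℚ R] [TimeAlgebra R]

local notation "c" => (PowerSeries.C : R →+* R⟦X⟧)

/-- The coefficient of `zᴺ` in `(z d/dz + ∑ zⁿ ∂/∂tₙ) F`. -/
def miwaCoeff (F : R⟦X⟧) (N : ℕ) : R :=
  N * PowerSeries.coeff N F +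
    ∑ j ∈ Finset.range N, dt (Nat.succPNat j) (PowerSeries.coeff (N - 1 - j) F)

/-- The derivation `z d/dz + ∑ zⁿ ∂/∂tₙ`, cut off at `n ≤ M`. -/
def miwaTrunc (M : ℕ) : Derivation ℚ R⟦X⟧ R⟦X⟧ :=
  (PowerSeries.X : R⟦X⟧) • (PowerSeries.derivative R).restrictScalars ℚ +
    ∑ j ∈ Finset.range M, (PowerSeries.X ^ (j + 1) : R⟦X⟧) • coeffwise (dt (Nat.succPNat j))

/-- Each coefficient of the infinite sum of derivations sees only a finite truncation, so the
Leibniz rule for `miwaDer` is inherited from honest finite sums. -/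
theorem coeff_miwaTrunc {M N : ℕ} (h : N ≤ M) (F : R⟦X⟧) :
    PowerSeries.coeff N (miwaTrunc M F) = miwaCoeff F N := by
  have h1 : miwaTrunc M F = PowerSeries.X * PowerSeries.derivative R F +
      ∑ j ∈ Finset.range M, PowerSeries.X ^ (j + 1) * coeffwise (dt (Nat.succPNat j)) F := by
    rw [miwaTrunc, Derivation.add_apply, ← Derivation.coeFnAddMonoidHom_apply (∑ j ∈ _, _), map_sum,
      Finset.sum_apply]
    rfl
  rw [h1, map_add, map_sum, miwaCoeff]
  congr 1
  · cases N with
    | zero => simp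
    | succ N =>
      rw [PowerSeries.coeff_succ_X_mul, PowerSeries.coeff_derivative]
      push_cast
      ring
  · rw [← Finset.sum_subset (Finset.range_subset_range.2 h)]
    · refine Finset.sum_congr rfl fun j hj => ?_
      rw [Finset.mem_range] at hj
      rw [PowerSeries.coeff_X_pow_mul', if_pos (by omega), coeff_coeffwise,
        show N - (j + 1) = N - 1 - j by omega]
    · intro j _ hj
      rw [Finset.mem_range] at hj
      rw [PowerSeries.coeff_X_pow_mul', if_neg (by omega)]

/-- The derivation `z d/dz + ∑ zⁿ ∂/∂tₙ` of `R⟦z⟧`. -/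
def miwaDer : Derivation ℚ R⟦X⟧ R⟦X⟧ :=
  Derivation.mk'
    { toFun := fun F => PowerSeries.mk (miwaCoeff F)
      map_add' := fun F G => by
        ext N
        simp only [PowerSeries.coeff_mk, map_add, ← coeff_miwaTrunc le_rfl]
      map_smul' := fun a F => by
        ext N
        simp only [PowerSeries.coeff_mk, RingHom.id_apply, ← coeff_miwaTrunc le_rfl]
        rw [Derivation.map_smul]
        simp only [PowerSeries.coeff_mk, PowerSeries.coeff_smul, ← coeff_miwaTrunc le_rfl] }
    (fun F G => by
      ext N
      simp only [LinearMap.coe_mk, AddHom.coe_mk, PowerSeries.coeff_mk,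
        ← coeff_miwaTrunc (le_refl N), Derivation.leibniz, smul_eq_mul, map_add,
        PowerSeries.coeff_mul]
      congr 1 <;>
      · refine Finset.sum_congr rfl fun p hp => ?_
        rw [mem_antidiagonal] at hp
        rw [coeff_miwaTrunc (by omega)])

theorem coeff_miwaDer (F : R⟦X⟧) (N : ℕ) : PowerSeries.coeff N (miwaDer F) = miwaCoeff F N :=
  PowerSeries.coeff_mk N (miwaCoeff F)

theorem miwaCoeff_succ_eq_zero_iff (F : R⟦X⟧) (k : ℕ) : miwaCoeff F (k + 1) = 0 ↔
    PowerSeries.coeff (k + 1) F = -(((k + 1 : ℚ)⁻¹) • ∑ j : Fin (k + 1),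
      dt (Nat.succPNat j) (PowerSeries.coeff (k - j) F)) := by
  rw [miwaCoeff, Finset.sum_range, Nat.add_sub_cancel, ← smul_neg, eq_inv_smul_iff₀ (by positivity),
    ← add_eq_zero_iff_eq_neg, Algebra.smul_def]
  simp

/-- Vanishing of the coefficients of `miwaDer F` is the recursion defining `miwa`. A series killed
by `miwaDer` is thus the Miwa shift of its constant term, which is how tau functions are recognised
below. -/
theorem coeff_eq_miwa {F : R⟦X⟧} (hF : miwaDer F = 0) (k : ℕ) :
    PowerSeries.coeff k F = miwa (PowerSeries.coeff 0 F) k := by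
  induction k using Nat.strong_induction_on with
  | _ k ih =>
    cases k with
    | zero => rw [miwa]
    | succ k =>
      have h1 : miwaCoeff F (k + 1) = 0 := by rw [← coeff_miwaDer, hF, map_zero]
      rw [(miwaCoeff_succ_eq_zero_iff F k).1 h1, miwa]
      congr 2
      exact Finset.sum_congr rfl fun j _ => by rw [ih _ (by omega)]

theorem miwaDer_mk_miwa (f : R) : miwaDer (PowerSeries.mk (miwa f)) = 0 := by
  ext N
  rw [coeff_miwaDer, map_zero]
  cases N with
  | zero => simp [miwaCoeff]
  | succ k =>
    rw [miwaCoeff_succ_eq_zero_iff]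
    simp only [PowerSeries.coeff_mk]
    rw [miwa]

theorem miwaCoeff_C (a : R) (n : ℕ) : miwaCoeff (c a) (n + 1) = dt (Nat.succPNat n) a := by
  rw [miwaCoeff, Finset.sum_range_succ, Finset.sum_eq_zero]
  · simp [PowerSeries.coeff_C]
  · intro j hj
    rw [Finset.mem_range] at hj
    rw [PowerSeries.coeff_C, if_neg (by omega), map_zero]

/-- The symbol `∑ a_{-k} zᵏ` of an operator of order `≤ 0`. -/
def sym (A : PDO R) : R⟦X⟧ := PowerSeries.mk fun k => A.coeff (-k)

theorem coeff_sym (A : PDO R) (k : ℕ) : PowerSeries.coeff k (sym A) = A.coeff (-k) :=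
  PowerSeries.coeff_mk _ _

/-- The series `K` with `(z d/dz + ∑ zⁿ ∂/∂tₙ) sym W = (K - 1) sym W` for a dressing
operator `W = V⁻¹`. -/
def kernelSeries (W V : PDO R) : R⟦X⟧ := PowerSeries.mk fun M =>
  ∑ m ∈ Finset.range (M + 1), ((D (m : ℤ) * V).pos * W).coeff (m - M)

/-- Since `V W = 1`, the flow reads `-X∂ⁿ + (X∂ⁿV)_{≥0} W`. The terms `-X∂ⁿ` with `n ≤ N` cancel the
contribution of `z d/dz` to the coefficient of `zᴺ`. Expanding `X` in powers of `∂⁻¹` in the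
positive parts gives a convolution with a series depending only on `W` and `V`, hence the same for
every such `X`. -/
theorem miwaDer_sym {W V X : PDO R} (hVW : V * W = 1) (hV : V.OrdLE 0) (hX : X.OrdLE 0)
    (hflow : ∀ n : ℕ+, X.map (dt n).toLinearMap.toAddMonoidHom = -((X * D (n : ℕ) * V).neg * W)) :
    miwaDer (sym X) + sym ((X * V).pos * W) = sym X * kernelSeries W V := by
  ext N
  have h1 : ∀ j ∈ Finset.range N, dt (Nat.succPNat j) (X.coeff (-((N - 1 - j : ℕ) : ℤ))) =
      ((X * D ((j + 1 : ℕ) : ℤ) * V).pos * W).coeff ((j + 1 : ℕ) - N) - X.coeff (-N) := by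
    intro j hj
    rw [Finset.mem_range] at hj
    have h2 : dt (Nat.succPNat j) (X.coeff (-((N - 1 - j : ℕ) : ℤ))) =
        (X.map (dt (Nat.succPNat j)).toLinearMap.toAddMonoidHom).coeff ((j + 1 : ℕ) - N) := by
      rw [show (-((N - 1 - j : ℕ) : ℤ)) = ((j + 1 : ℕ) : ℤ) - N by omega]
      rfl
    have h3 : (X * D ((j + 1 : ℕ) : ℤ) * V).neg * W =
        X * D ((j + 1 : ℕ) : ℤ) - (X * D ((j + 1 : ℕ) : ℤ) * V).pos * W := by
      rw [eq_sub_iff_add_eq, add_comm, ← add_mul, PDO.pos_add_neg, mul_assoc, hVW, mul_one]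
    rw [h2, hflow, Nat.succPNat_coe, Nat.succ_eq_add_one, h3, PDO.coeff_neg, PDO.coeff_sub,
      PDO.coeff_mul_D, show ((j + 1 : ℕ) : ℤ) - N - ((j + 1 : ℕ) : ℤ) = -N by ring]
    ring
  have h2 : PowerSeries.coeff N (miwaDer (sym X) + sym ((X * V).pos * W)) =
      ∑ n ∈ Finset.range (N + 1), ((X * D (n : ℤ) * V).pos * W).coeff (n - N) := by
    rw [map_add, coeff_miwaDer, miwaCoeff, Finset.sum_range_succ', coeff_sym]
    simp only [coeff_sym]
    rw [Finset.sum_congr rfl h1, Finset.sum_sub_distrib, Finset.sum_const, Finset.card_range,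
      nsmul_eq_mul, Nat.cast_zero, ← PDO.one_eq_D, mul_one, zero_sub]
    ring
  have h3 : ∀ n ∈ Finset.range (N + 1), ((X * D (n : ℤ) * V).pos * W).coeff (n - N) =
      ∑ k ∈ Finset.range (n + 1), X.coeff (-k) *
        ((D ((n - k : ℕ) : ℤ) * V).pos * W).coeff (((n - k : ℕ) : ℤ) + k - N) := by
    intro n _
    rw [PDO.pos_mul_D_mul hX hV, Finset.sum_mul, PDO.coeff_sum]
    refine Finset.sum_congr rfl fun k hk => ?_
    rw [Finset.mem_range] at hk
    rw [mul_assoc, PDO.coeff_C_mul, show ((n - k : ℕ) : ℤ) + k - N = n - N by omega]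
  rw [h2, Finset.sum_congr rfl h3]
  refine (Finset.sum_range_diag_flip (N + 1) fun k m =>
    X.coeff (-k) * ((D (m : ℤ) * V).pos * W).coeff ((m : ℤ) + k - N)).trans ?_
  rw [PowerSeries.coeff_mul, Finset.Nat.sum_antidiagonal_eq_sum_range_succ_mk]
  refine Finset.sum_congr rfl fun k hk => ?_
  rw [Finset.mem_range] at hk
  rw [coeff_sym, kernelSeries, PowerSeries.coeff_mk, Finset.mul_sum,
    show N + 1 - k = N - k + 1 by omega]
  refine Finset.sum_congr rfl fun m _ => ?_
  rw [show (m : ℤ) - ((N - k : ℕ) : ℤ) = m + k - N by omega]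

end Miwa

/-! ### Tau functions -/

section Tau

variable {R : Type*} [CommRing R] [Algebra ℚ R] [TimeAlgebra R]

local notation "c" => (PowerSeries.C : R →+* R⟦X⟧)

/-- A Fay-type identity: the Miwa shift of `ω` is `ω - q x/w`, where `w` and `x` are the symbols of
`W` and `∂⁻¹rW`. It is proved by applying `miwaDer` to the right-hand side. -/
theorem isTau_dressOp {L W V : PDO R} {q r ω v τ : R} (hW0 : W.coeff 0 = 1) (hW : W.OrdLE 0)
    (hWV : W * V = 1) (hVW : V * W = 1) (hL : L = W * D 1 * V)
    (hflow : ∀ n : ℕ+, W.map (dt n).toLinearMap.toAddMonoidHom = -((L ^ (n : ℕ)).neg * W))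
    (hq : IsEigenfunction L q) (hr : IsAdjointEigenfunction L r) (hω : IsSEP L q r ω)
    (hτ : IsTau (Osc.ofPDO 1 W) τ) (hv : v * (1 - ω) = 1) :
    IsTau (Osc.ofPDO 1 (dressOp q r v * W)) (τ * (1 - ω)) := by
  have hV : V.OrdLE 0 := PDO.ordLE_zero_of_mul_eq_one hW hW0 hWV
  have hLn : ∀ n : ℕ, L ^ n = W * D (n : ℤ) * V := fun n => by
    rw [hL, PDO.conj_pow hVW _ _ hWV, PDO.D_one_pow]
  set X : PDO R := D (-1) * C r * W with hXdef
  have hX1 : X.OrdLE (-1) := ((PDO.ordLE_D (-1)).mul (PDO.ordLE_C r)).mul hW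
  have hX : X.OrdLE 0 := hX1.mono (by norm_num)
  -- `X = ∂⁻¹rW` obeys the same type of equation as `W`: the adjoint eigenfunction equation for `r`
  -- supplies the part `(∂⁻¹ r (Lⁿ)_{≥0})_- = ∂⁻¹ ((Lⁿ)_{≥0})^*(r)`.
  have hXflow : ∀ n : ℕ+, X.map (dt n).toLinearMap.toAddMonoidHom =
      -((X * D (n : ℕ) * V).neg * W) := by
    intro n
    set d : R →+ R := (dt n).toLinearMap.toAddMonoidHom with hd
    have hmul : ∀ A B : PDO R, (A * B).map d = A.map d * B + A * B.map d :=
      PDO.map_mul_derivation d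
        (fun a b => by
          change dt n (a * b) = dt n a * b + a * dt n b
          rw [Derivation.leibniz, smul_eq_mul, smul_eq_mul]
          ring)
        (fun a => TimeAlgebra.dt_comm _ _ _)
    have hD : (D (-1) : PDO R).map d = 0 := by
      ext k
      change dt n (if k = -1 then 1 else 0) = 0
      split_ifs <;> simp
    have hCr : (C r).map d = -C ((L ^ (n : ℕ)).pos.adjoint.posApply r) := by
      rw [PDO.map_C, ← PDO.C_neg, ← hr n]
      rfl
    have h1 : (D (-1) * C r * (L ^ (n : ℕ)).neg).OrdLE (-1) :=
      (((PDO.ordLE_D (-1)).mul (PDO.ordLE_C r)).mul (PDO.ordLE_negPart _)).mono (by norm_num)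
    have h2 : X * D (n : ℕ) * V = D (-1) * C r * L ^ (n : ℕ) := by
      rw [hLn, hXdef]; simp only [mul_assoc]
    have h3 : (D (-1) * C r * L ^ (n : ℕ)).neg =
        D (-1) * C ((L ^ (n : ℕ)).pos.adjoint.posApply r) + D (-1) * C r * (L ^ (n : ℕ)).neg := by
      rw [← PDO.neg_D_mul_C_mul_pos]
      conv_lhs => rw [← PDO.pos_add_neg (L ^ (n : ℕ)), mul_add, PDO.neg_add, PDO.neg_eq_self h1]
    rw [h2, h3, hXdef, hmul, hmul, hD, hCr, hflow n]
    noncomm_ring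
  have hWK := miwaDer_sym hVW hV hW (fun n => by rw [hflow n, hLn])
  have hXK := miwaDer_sym hVW hV hX hXflow
  have hXV : (X * V).OrdLE (-1) := hX1.mul hV
  have hsym0 : sym (0 : PDO R) = 0 := by ext k; rw [coeff_sym]; simp
  rw [hWV, PDO.one_eq_C, PDO.pos_C, ← PDO.one_eq_C, one_mul] at hWK
  rw [PDO.pos_eq_zero hXV, zero_mul, hsym0, add_zero] at hXK
  set w := sym W
  set x := sym X
  set K := kernelSeries W V
  set Q : PDO R := V * C q * D (-1) with hQdef
  have hQ : Q.OrdLE (-1) := (hV.mul (PDO.ordLE_C q)).mul (PDO.ordLE_D (-1))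
  -- The common factor of the time derivatives of `ω` and `q`: both are residues of `A∂ⁿQ`, with `A
  -- = X` and `A = W` respectively.
  set ρ : R⟦X⟧ := PowerSeries.mk fun n => (D (n : ℤ) * Q).res with hρ
  have hres : ∀ {A : PDO R}, A.OrdLE 0 → ∀ n : ℕ,
      (A * D (n : ℤ) * Q).res = PowerSeries.coeff n (sym A * ρ) := fun {A} hA n => by
    rw [PDO.res_mul_D_mul hA hQ, PowerSeries.coeff_mul,
      Finset.Nat.sum_antidiagonal_eq_sum_range_succ_mk]
    refine Finset.sum_congr rfl fun k _ => ?_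
    rw [coeff_sym, hρ, PowerSeries.coeff_mk]
  have hΩρ : miwaDer (c ω) = x * ρ := by
    ext n
    rw [← hres hX, coeff_miwaDer]
    cases n with
    | zero =>
      have h1 : (X * D ((0 : ℕ) : ℤ) * Q).OrdLE (-1 + 0 + -1) :=
        (hX1.mul (PDO.ordLE_D 0)).mul hQ
      rw [PDO.res.eq_def, h1 (-1) (by norm_num)]
      simp [miwaCoeff]
    | succ n =>
      rw [miwaCoeff_C, hω.2, PDO.res_sep, hLn, hXdef, hQdef, Nat.succPNat_coe]
      simp only [mul_assoc, Nat.succ_eq_add_one]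
  have hqρ : miwaDer (c q) + c q = w * ρ := by
    ext n
    rw [← hres hW, map_add, coeff_miwaDer]
    cases n with
    | zero =>
      rw [Nat.cast_zero, ← PDO.one_eq_D, mul_one, hQdef, ← mul_assoc, ← mul_assoc, hWV, one_mul,
        PDO.res.eq_def, PDO.coeff_C_mul, PDO.coeff_D]
      simp [miwaCoeff]
    | succ n =>
      rw [miwaCoeff_C, hq, ← PDO.res_mul_C_mul_D, hLn, hQdef, Nat.succPNat_coe,
        PowerSeries.coeff_C, if_neg (by omega), add_zero]
      simp only [mul_assoc, Nat.succ_eq_add_one]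
  obtain ⟨w', hw'⟩ : ∃ w', w * w' = 1 := by
    have h1 : IsUnit w := by
      rw [PowerSeries.isUnit_iff_constantCoeff, ← PowerSeries.coeff_zero_eq_constantCoeff_apply,
        coeff_sym]
      simp [hW0]
    exact h1.exists_right_inv
  have hdw' : miwaDer w' = w' - w' * K := by
    have h1 := congrArg miwaDer hw'
    simp only [Derivation.leibniz, smul_eq_mul, Derivation.map_one_eq_zero] at h1
    linear_combination w' * h1 - w' ^ 2 * hWK + (w' - w' * K - miwaDer w') * hw'
  -- The kernel series cancels in the ratio `x/w`, leaving `x/w` times `∇q + q = wρ`, that is `xρ =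
  -- ∇ω`.
  have hY : miwaDer (c ω - c q * (x * w')) = 0 := by
    simp only [map_sub, Derivation.leibniz, smul_eq_mul, hdw', hXK, hΩρ]
    linear_combination (-(x * w')) * hqρ - x * ρ * hw'
  have hτw : miwaDer (c τ * w) = 0 := by
    have h1 : c τ * w = PowerSeries.mk (miwa τ) := by
      ext k
      rw [PowerSeries.coeff_C_mul, coeff_sym, PowerSeries.coeff_mk, ← hτ.2.1 k]
      simp [Osc.ofPDO]
    rw [h1, miwaDer_mk_miwa]
  -- A product of two series killed by the derivation, hence killed; its constant term is `τ(1 - ω)`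
  -- because `x` has no constant term.
  set F := (1 - (c ω - c q * (x * w'))) * (c τ * w) with hF
  have hF0 : miwaDer F = 0 := by
    rw [hF, Derivation.leibniz, map_sub, Derivation.map_one_eq_zero, hY, hτw]
    simp
  have hF1 : F = c (τ * (1 - ω)) * w + c (τ * q) * x := by
    rw [hF]
    simp only [map_mul, map_sub, map_one]
    linear_combination c q * x * c τ * hw'
  have hF2 : ∀ k : ℕ, PowerSeries.coeff k F =
      τ * (1 - ω) * W.coeff (-k) + τ * q * X.coeff (-k) := fun k => by
    rw [hF1, map_add, PowerSeries.coeff_C_mul, PowerSeries.coeff_C_mul, coeff_sym, coeff_sym]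
  have hF3 : PowerSeries.coeff 0 F = τ * (1 - ω) := by
    rw [hF2, Nat.cast_zero, neg_zero, hW0, hX1 0 (by norm_num), mul_zero, mul_one, add_zero]
  have hG : dressOp q r v * W = W + C (v * q) * X := by
    rw [dressOp, sqOp, PDO.C_mul, hXdef]
    noncomm_ring
  rw [hG]
  refine ⟨hτ.1.mul (IsUnit.of_mul_eq_one_right v hv), fun k => ?_, fun k hk => ?_⟩
  · rw [← hF3, ← coeff_eq_miwa hF0, hF3, hF2]
    simp only [Osc.ofPDO, PDO.coeff_add, PDO.coeff_C_mul, one_zpow, Units.val_one, one_smul]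
    linear_combination τ * q * X.coeff (-k) * hv
  · simp only [Osc.ofPDO, PDO.coeff_add, PDO.coeff_C_mul, hW k hk, hX k hk, mul_zero, add_zero,
      smul_zero]

end Tau

end KP

end

theorem mainTheorem2 {ι κ R : Type*} [CommRing R] [Algebra ℚ R] [KP.TimeAlgebra R]
    [TopologicalSpace R] [IsTopologicalRing R] [T2Space R]
    (N : KP.Data ι κ R) (hN : N.IsSolution) (i₀ : ι) (j₀ : κ) (hq : IsUnit (N.f i₀)) :
    (∃! F : KP.Data ι κ (PowerSeries R), KP.IsSymmetryFlow i₀ j₀ N F) ∧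
    ∀ F : KP.Data ι κ (PowerSeries R), KP.IsSymmetryFlow i₀ j₀ N F →
      (∀ N' : KP.Data ι κ R, KP.Data.SumsTo F N' →
        KP.IsBinaryDarboux i₀ j₀ (N.Ω i₀ j₀ - 1) N N') ∧
      ((∀ k : ℕ, Summable fun m : ℕ => (m : R) ^ k * N.Ω i₀ j₀ ^ m) →
        ∃ N' : KP.Data ι κ R, KP.Data.SumsTo F N') := by
  have hflow := KP.isSymmetryFlow_flow i₀ j₀ N (hN.sep i₀ j₀).1
  refine ⟨⟨_, hflow, fun G hG => hG.unique hflow⟩, fun F hF => ?_⟩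
  obtain rfl := hF.unique hflow
  refine ⟨fun N' hN' => KP.isBinaryDarboux_of_sumsTo hN hq hN' fun v hv => ?_,
    KP.exists_sumsTo_flow i₀ j₀ N⟩
  obtain ⟨V, hWV, hVW, hL, -, hdress⟩ := hN.dressing
  exact KP.isTau_dressOp hN.monic.1 hN.monic.2 hWV hVW hL hdress (hN.eigen i₀) (hN.adjEigen j₀)
    (hN.sep i₀ j₀) (hN.wave ▸ hN.tau) hv
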